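/- Let $X$ be a paracompact topological space. Let $\Lambda$ be a sheaf of associative unital $\mathbb C$-algebras on $X$ with an increasing filtration $\Lambda_0\subseteq\Lambda_1\subseteq\cdots$ by subsheaves of $\mathbb C$-vector spaces that is exhaustive ($\Lambda=\bigcup_n\Lambda_n$ as sheaves) and satisfies $\Lambda_m\Lambda_n\subseteq\Lambda_{m+n}$. Let $\mathcal A$ be a sheaf of $\Lambda$-$\Lambda$-bimodules (with $\mathbb C$ acting in the same way from both sides) with an increasing exhaustive filtration $\mathcal A_0\subseteq\mathcal A_1\subseteq\cdots$ by subsheaves of $\mathbb C$-vector spaces such that $\Lambda_m\mathcal A_n\subseteq\mathcal A_{m+n}$ and $\mathcal A_n\Lambda_m\subseteq\mathcal A_{m+n}$. A *filtered square-zero extension* of $\Lambda$ by $\mathcal A$ is a short exact sequence $0\to\mathcal A\xrightarrow{i}\Gamma\xrightarrow{p}\Lambda\to0$ of sheaves of $\mathbb C$-vector spaces in which $\Gamma$ is a sheaf of associative unital $\mathbb C$-algebras with an increasing exhaustive filtration with $\Gamma_m\Gamma_n\subseteq\Gamma_{m+n}$, $p$ is a homomorphism of sheaves of algebras, $i(\mathcal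 A)\cdot i(\mathcal A)=0$, $\gamma\, i(a)=i(p(\gamma)a)$ and $i(a)\gamma=i(a\,p(\gamma))$ for all local sections, $p(\Gamma_n)\subseteq\Lambda_n$, and $i$ is strict, i.e. $i(\mathcal A)\cap\Gamma_n=i(\mathcal A_n)$ for all $n$. It is *locally trivial* if $X$ has an open cover $\{U_\alpha\}$ such that over each $U_\alpha$ there is a filtration-preserving $\mathbb C$-linear morphism of sheaves $j_\alpha:\Lambda|_{U_\alpha}\to\Gamma|_{U_\alpha}$ with $p\circ j_\alpha=\mathrm{id}$; it is *split* if there is a filtration-preserving homomorphism of sheaves of algebras $j:\Lambda\to\Gamma$ with $p\circ j=\mathrm{id}$. Two extensions are *equivalent* if there is a filtration-preserving homomorphism of sheaves of algebras $\kappa:\Gamma\to\Gamma'$ with $\kappa\circ i=i'$ and $p'\circ\kappa=p$. Let $\mathrm{exal}_f(\Lambda,\mathcal A)$ be the set of equivalence classes of locally trivial filtered square-zero extensions of $\Lambda$ by $\mathcal A$. For $n\ge0$ let $\mathcal C_f^n(\Lambda,\mathcal A)$ be the sheaf of filtration-preserving Hochschild cochains: its sections over $U$ are the morphisms of sheaves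 of $\mathbb C$-vector spaces $f:\Lambda^{\otimes n}|_U\to\mathcal A|_U$ with $f(\Lambda_{i_1}\otimes\cdots\otimes\Lambda_{i_n})\subseteq\mathcal A_{i_1+\cdots+i_n}$ for all $i_1,\dots,i_n$. With the Hochschild differential these sheaves form a complex $\mathcal C_f^\bullet(\Lambda,\mathcal A)$; let $\sigma_{\ge1}\mathcal C_f^\bullet(\Lambda,\mathcal A)$ be its brutal truncation $0\to\mathcal C_f^1\to\mathcal C_f^2\to\cdots$, with $\mathcal C_f^n$ in degree $n$. Then $\mathrm{exal}_f(\Lambda,\mathcal A)$ is a $\mathbb C$-vector space whose addition is the Baer sum, in which $c\cdot[\xi]$ is the class of the pushout of $\xi$ along multiplication by $c$ on $\mathcal A$, and whose zero element is the class of the split extensions; and there is an isomorphism of $\mathbb C$-vector spaces $$\mathrm{exal}_f(\Lambda,\mathcal A)\;\cong\;\mathbb H^2\bigl(X,\sigma_{\ge1}\mathcal C_f^\bullet(\Lambda,\mathcal A)\bigr),$$ where $\mathbb H^2(X,-)$ is hypercohomology, i.e. the second cohomology of the derived global sections $R\Gamma(X,-)$. -/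

import Mathlib

open CategoryTheory TopologicalSpace Opposite Limits
universe u
namespace FilteredDeformation

section Hochschild

variable {R M : Type u} [Ring R] [Algebra ℂ R] [AddCommGroup M] [Module ℂ M]
  [Module R M] [Module Rᵐᵒᵖ M] [IsScalarTower ℂ R M] [IsScalarTower ℂ Rᵐᵒᵖ M]

theorem contractNth_update {n : ℕ} (i : Fin n) (a : Fin (n + 1) → R) (k : Fin (n + 1)) :
    ∃ (k' : Fin n) (L : R →ₗ[ℂ] R), ∀ x : R,
      Fin.contractNth i.castSucc (· * ·) (Function.update a k x) =
        Function.update (Fin.contractNth i.castSucc (· * ·) a) k' (L x) := by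
  rcases lt_trichotomy (k : ℕ) (i : ℕ) with h | h | h
  · refine ⟨⟨k, by omega⟩, LinearMap.id, fun x => ?_⟩
    ext m
    simp only [Fin.contractNth, Function.update_apply, Fin.ext_iff, Fin.val_castSucc, Fin.val_succ,
      LinearMap.id_apply]
    split_ifs <;> first | rfl | omega
  · refine ⟨i, LinearMap.mulRight ℂ (a i.succ), fun x => ?_⟩
    ext m
    simp only [Fin.contractNth, Function.update_apply, Fin.ext_iff, Fin.val_castSucc, Fin.val_succ,
      LinearMap.mulRight_apply]
    split_ifs <;> first | rfl | omega | (congr 2; apply Fin.ext; simp; omega)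
  · by_cases h1 : (k : ℕ) = i + 1
    · refine ⟨i, LinearMap.mulLeft ℂ (a i.castSucc), fun x => ?_⟩
      ext m
      simp only [Fin.contractNth, Function.update_apply, Fin.ext_iff, Fin.val_castSucc,
        Fin.val_succ, LinearMap.mulLeft_apply]
      split_ifs <;> first | rfl | omega | (congr 2; apply Fin.ext; simp; omega)
    · refine ⟨⟨k - 1, by omega⟩, LinearMap.id, fun x => ?_⟩
      ext m
      simp only [Fin.contractNth, Function.update_apply, Fin.ext_iff, Fin.val_castSucc,
        Fin.val_succ, LinearMap.id_apply]
      split_ifs <;> first | rfl | omega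

/-- The multilinear map `a ↦ f (a₀, …, aᵢ aᵢ₊₁, …, aₙ)`. -/
def contractMap {n : ℕ} (i : Fin n) (f : MultilinearMap ℂ (fun _ : Fin n => R) M) :
    MultilinearMap ℂ (fun _ : Fin (n + 1) => R) M :=
  MultilinearMap.mk' (fun a => f (Fin.contractNth i.castSucc (· * ·) a))
    (fun a k x y => by
      obtain ⟨k', L, hL⟩ := contractNth_update i a k
      simp only [hL, map_add, MultilinearMap.map_update_add])
    (fun a k c x => by
      obtain ⟨k', L, hL⟩ := contractNth_update i a k
      simp only [hL, map_smul, MultilinearMap.map_update_smul])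

/-- The multilinear map `a ↦ a₀ · f (a₁, …, aₙ)`. -/
def leftMap {n : ℕ} (f : MultilinearMap ℂ (fun _ : Fin n => R) M) :
    MultilinearMap ℂ (fun _ : Fin (n + 1) => R) M :=
  MultilinearMap.mk' (fun a => a 0 • f (Fin.tail a))
    (fun a k x y => by
      refine Fin.cases ?_ (fun k => ?_) k
      · simp [Fin.tail_update_zero, add_smul]
      · simp [Function.update_of_ne, (Fin.succ_ne_zero k).symm])
    (fun a k c x => by
      refine Fin.cases ?_ (fun k => ?_) k
      · simp [Fin.tail_update_zero]
      · simp [Function.update_of_ne, (Fin.succ_ne_zero k).symm, smul_algebra_smul_comm])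

open scoped RightActions in
/-- The multilinear map `a ↦ f (a₀, …, aₙ₋₁) · aₙ`. -/
def rightMap {n : ℕ} (f : MultilinearMap ℂ (fun _ : Fin n => R) M) :
    MultilinearMap ℂ (fun _ : Fin (n + 1) => R) M :=
  MultilinearMap.mk' (fun a => f (Fin.init a) <• a (Fin.last n))
    (fun a k x y => by
      refine Fin.lastCases ?_ (fun k => ?_) k
      · simp [Fin.init_update_last, add_smul]
      · simp [Function.update_of_ne, (Fin.castSucc_lt_last k).ne'])
    (fun a k c x => by
      refine Fin.lastCases ?_ (fun k => ?_) k
      · simp [Fin.init_update_last]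
      · simp [Function.update_of_ne, (Fin.castSucc_lt_last k).ne', smul_algebra_smul_comm])

/-- The Hochschild differential
`(d f)(a₀, …, aₙ) = a₀ f(a₁, …, aₙ) + ∑_{0 ≤ i < n} (-1)^{i+1} f(a₀, …, aᵢ aᵢ₊₁, …, aₙ)
  + (-1)^{n+1} f(a₀, …, aₙ₋₁) aₙ`. -/
def hochschildD (n : ℕ) (f : MultilinearMap ℂ (fun _ : Fin n => R) M) :
    MultilinearMap ℂ (fun _ : Fin (n + 1) => R) M :=
  leftMap f + ∑ i : Fin n, (-1 : ℂ) ^ ((i : ℕ) + 1) • contractMap i f +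
    (-1 : ℂ) ^ (n + 1) • rightMap f


open scoped RightActions in
theorem hochschildD_apply (n : ℕ) (f : MultilinearMap ℂ (fun _ : Fin n => R) M)
    (a : Fin (n + 1) → R) :
    hochschildD n f a = a 0 • f (Fin.tail a) +
      ∑ i : Fin n, (-1 : ℂ) ^ ((i : ℕ) + 1) • f (Fin.contractNth i.castSucc (· * ·) a) +
      (-1 : ℂ) ^ (n + 1) • (f (Fin.init a) <• a (Fin.last n)) := by
  simp [hochschildD, leftMap, contractMap, rightMap]

/-- Contraction of the entries `i`, `i + 1` of an infinite sequence. -/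
def seqContract (i : ℕ) (a : ℕ → R) (k : ℕ) : R :=
  if k < i then a k else if k = i then a k * a (k + 1) else a (k + 1)

open scoped RightActions in
/-- The `j`-th coface of a cochain, in terms of infinite sequences. -/
def seqFace (n j : ℕ) (G : (ℕ → R) → M) (a : ℕ → R) : M :=
  if j = 0 then a 0 • G (fun k => a (k + 1))
  else if j ≤ n then G (seqContract (j - 1) a) else G a <• a n

theorem hochschildD_seq (n : ℕ) (f : MultilinearMap ℂ (fun _ : Fin n => R) M) (a : ℕ → R) :
    hochschildD n f (fun k => a k) =
      ∑ j ∈ Finset.range (n + 2), (-1 : ℂ) ^ j • seqFace n j (fun b => f fun k => b k) a := by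
  rw [hochschildD_apply, Finset.sum_range_succ, Finset.sum_range_succ', Finset.sum_range]
  have h1 : ∀ i : Fin n, Fin.contractNth i.castSucc (· * ·) (fun k : Fin (n + 1) => a k) =
      fun k : Fin n => seqContract (i : ℕ) a k := by
    intro i; ext k; simp [Fin.contractNth, seqContract]
  have h2 : ∀ i : Fin n, (i : ℕ) + 1 ≤ n := fun i => i.2
  simp only [h1, seqFace, Nat.add_sub_cancel, h2, if_true, Nat.succ_ne_zero, if_false]
  simp [add_comm]
  rfl

theorem alternating_sum_eq_zero (N : ℕ) (G : ℕ → ℕ → M)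
    (hG : ∀ i j, i < j → j ≤ N → G j i = G i (j - 1)) :
    ∑ j ∈ Finset.range (N + 1), (-1 : ℂ) ^ j •
      ∑ i ∈ Finset.range N, (-1 : ℂ) ^ i • G j i = 0 := by
  induction N with
  | zero => simp
  | succ N ih =>
    rw [Finset.sum_range_succ]
    have e : ∀ j ∈ Finset.range (N + 1), (-1 : ℂ) ^ j • ∑ i ∈ Finset.range (N + 1),
        (-1 : ℂ) ^ i • G j i = (-1 : ℂ) ^ j • ∑ i ∈ Finset.range N, (-1 : ℂ) ^ i • G j i +
          (-1 : ℂ) ^ j • (-1 : ℂ) ^ N • G j N := by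
      intro j _
      rw [Finset.sum_range_succ, smul_add]
    rw [Finset.sum_congr rfl e, Finset.sum_add_distrib, ih fun i j h h' => hG i j h (by omega),
      zero_add, Finset.smul_sum, ← Finset.sum_add_distrib]
    refine Finset.sum_eq_zero fun i hi => ?_
    rw [hG i (N + 1) (by simpa using hi) le_rfl, smul_smul, smul_smul, Nat.add_sub_cancel]
    rw [← add_smul]
    convert zero_smul ℂ _
    ring

theorem seqFace_seqFace [SMulCommClass R Rᵐᵒᵖ M] (n : ℕ) (G : (ℕ → R) → M)
    (hG : ∀ a b, (∀ k < n, a k = b k) → G a = G b) (a : ℕ → R) (i j : ℕ)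
    (hij : i < j) (hj : j ≤ n + 2) :
    seqFace (n + 1) j (seqFace n i G) a = seqFace (n + 1) i (seqFace n (j - 1) G) a := by
  rcases Nat.eq_zero_or_pos i with rfl | hi
  · by_cases h1 : j = 1
    · subst h1
      simp [seqFace, seqContract, mul_smul]
    · have h0 : j ≠ 0 := by omega
      have h0' : j - 1 ≠ 0 := by omega
      by_cases h2 : j ≤ n + 1
      · have h2' : j - 1 ≤ n := by omega
        have e : (fun k => seqContract (j - 1) a (k + 1)) =
            seqContract (j - 1 - 1) (fun k => a (k + 1)) := by
          ext k
          simp only [seqContract]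
          split_ifs <;> first | rfl | omega
        have e0 : seqContract (j - 1) a 0 = a 0 := by
          simp [seqContract, show 0 < j - 1 by omega]
        simp [seqFace, h0, h0', h2, h2', e, e0]
      · have h2' : ¬ j - 1 ≤ n := by omega
        simp [seqFace, h0, h0', h2, h2', smul_comm]
  · have hi0 : i ≠ 0 := by omega
    have h0 : j ≠ 0 := by omega
    have h0' : j - 1 ≠ 0 := by omega
    by_cases h2 : j ≤ n + 1
    · have h2' : j - 1 ≤ n := by omega
      have hi1 : i ≤ n := by omega
      have hi2 : i ≤ n + 1 := by omega
      simp only [seqFace, h0, h0', h2, h2', hi0, hi1, hi2, if_true, if_false]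
      congr 1
      ext k
      obtain ⟨i, rfl⟩ : ∃ i', i = i' + 1 := ⟨i - 1, by omega⟩
      obtain ⟨j, rfl⟩ : ∃ j', j = j' + 2 := ⟨j - 2, by omega⟩
      simp only [seqContract, Nat.add_sub_cancel, show j + 2 - 1 = j + 1 from rfl]
      split_ifs <;> grind
    · have h2' : ¬ j - 1 ≤ n := by omega
      have hi2 : i ≤ n + 1 := by omega
      simp only [seqFace, h0, h0', h2, h2', hi0, hi2, if_true, if_false]
      by_cases hi1 : i ≤ n
      · have e : seqContract (i - 1) a n = a (n + 1) := by
          simp [seqContract, show ¬ n < i - 1 by omega, show n ≠ i - 1 by omega]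
        simp only [hi1, if_true, e]
      · have e : seqContract (i - 1) a n = a n * a (n + 1) := by
          simp [seqContract, show i - 1 = n by omega]
        have e' : G (seqContract (i - 1) a) = G a := by
          refine hG _ _ fun k hk => ?_
          simp [seqContract, show k < i - 1 by omega]
        simp only [hi1, if_false, e, e', MulOpposite.op_mul, mul_smul]

/-- The Hochschild differential squares to zero. -/
theorem hochschildD_comp [SMulCommClass R Rᵐᵒᵖ M] (n : ℕ)
    (f : MultilinearMap ℂ (fun _ : Fin n => R) M) :
    hochschildD (n + 1) (hochschildD n f) = 0 := by
  ext a
  obtain ⟨b, rfl⟩ : ∃ b : ℕ → R, a = fun k : Fin (n + 1 + 1) => b (k : ℕ) :=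
    ⟨fun k => if h : k < n + 1 + 1 then a ⟨k, h⟩ else 0, by ext k; simp only [k.2, dif_pos]⟩
  rw [hochschildD_seq]
  simp only [hochschildD_seq]
  have key : ∀ j, seqFace (n + 1) j (fun c : ℕ → R => ∑ i ∈ Finset.range (n + 2),
      (-1 : ℂ) ^ i • seqFace n i (fun b => f fun k => b k) c) b =
      ∑ i ∈ Finset.range (n + 2), (-1 : ℂ) ^ i •
        seqFace (n + 1) j (seqFace n i (fun b => f fun k => b k)) b := by
    intro j
    by_cases h0 : j = 0
    · subst h0
      simp only [seqFace, if_true, Finset.smul_sum]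
      exact Finset.sum_congr rfl fun i _ => smul_algebra_smul_comm _ _ _
    · by_cases h1 : j ≤ n + 1
      · simp only [seqFace, h0, h1, if_true, if_false]
      · simp only [seqFace, h0, h1, if_false, Finset.smul_sum]
        exact Finset.sum_congr rfl fun i _ => smul_algebra_smul_comm _ _ _
  simp only [key]
  rw [zero_apply]
  refine alternating_sum_eq_zero (n + 2) _ fun i j hij hj => ?_
  exact seqFace_seqFace n _ (fun a b h => by congr 1; ext k; exact h k k.2) b i j hij hj

theorem sum_contractNth (n : ℕ) (i : Fin n) (d : Fin (n + 1) → ℕ) :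
    ∑ k, Fin.contractNth i.castSucc (· + ·) d k = ∑ k, d k := by
  obtain ⟨b, rfl⟩ : ∃ b : ℕ → ℕ, d = fun k : Fin (n + 1) => b (k : ℕ) :=
    ⟨fun k => if h : k < n + 1 then d ⟨k, h⟩ else 0, by ext k; simp only [k.2, dif_pos]⟩
  let c : ℕ → ℕ := fun k => if k < i then b k else if k = i then b k + b (k + 1) else b (k + 1)
  have h1 : ∀ k : Fin n, Fin.contractNth i.castSucc (· + ·) (fun k : Fin (n + 1) => b (k : ℕ)) k =
      c k := by
    intro k; simp [Fin.contractNth, c]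
  simp only [h1]
  rw [Fin.sum_univ_eq_sum_range c n, Fin.sum_univ_eq_sum_range b (n + 1)]
  have h2 : ∀ m : ℕ, ∑ k ∈ Finset.range m, c k =
      if m ≤ i then ∑ k ∈ Finset.range m, b k else ∑ k ∈ Finset.range (m + 1), b k := by
    intro m
    induction m with
    | zero => simp
    | succ m ih =>
      simp only [Finset.sum_range_succ] at ih ⊢
      simp only [ih, c]
      split_ifs <;> omega
  rw [h2 n, if_neg (by omega)]

end Hochschild

section Sections

variable {X : TopCat.{u}}

/-- The algebra of sections over `U` of a sheaf of algebras. -/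
abbrev AlgSec (F : TopCat.Sheaf (AlgCat.{u} ℂ) X) (U : Opens X) : Type u :=
  F.1.obj (op U)

/-- The restriction homomorphisms of a sheaf of algebras. -/
abbrev algRes (F : TopCat.Sheaf (AlgCat.{u} ℂ) X) ⦃U V : Opens X⦄ (h : V ≤ U) :
    AlgSec F U →ₐ[ℂ] AlgSec F V :=
  (F.1.map (homOfLE h).op).hom

/-- The vector space of sections over `U` of a sheaf of vector spaces. -/
abbrev VecSec (F : TopCat.Sheaf (ModuleCat.{u} ℂ) X) (U : Opens X) : Type u :=
  F.1.obj (op U)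

/-- The restriction maps of a sheaf of vector spaces. -/
abbrev vecRes (F : TopCat.Sheaf (ModuleCat.{u} ℂ) X) ⦃U V : Opens X⦄ (h : V ≤ U) :
    VecSec F U →ₗ[ℂ] VecSec F V :=
  (F.1.map (homOfLE h).op).hom

theorem algRes_self (F : TopCat.Sheaf (AlgCat.{u} ℂ) X) {U : Opens X} (h : U ≤ U)
    (s : AlgSec F U) : algRes F h s = s :=
  ConcreteCategory.congr_hom (F.1.map_id (op U)) s

theorem algRes_algRes (F : TopCat.Sheaf (AlgCat.{u} ℂ) X) {U V W : Opens X} (h : V ≤ U)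
    (h' : W ≤ V) (s : AlgSec F U) : algRes F h' (algRes F h s) = algRes F (h'.trans h) s :=
  (ConcreteCategory.congr_hom (F.1.map_comp (homOfLE h).op (homOfLE h').op) s).symm

theorem vecRes_self (F : TopCat.Sheaf (ModuleCat.{u} ℂ) X) {U : Opens X} (h : U ≤ U)
    (s : VecSec F U) : vecRes F h s = s :=
  ConcreteCategory.congr_hom (F.1.map_id (op U)) s

theorem vecRes_vecRes (F : TopCat.Sheaf (ModuleCat.{u} ℂ) X) {U V W : Opens X} (h : V ≤ U)
    (h' : W ≤ V) (s : VecSec F U) : vecRes F h' (vecRes F h s) = vecRes F (h'.trans h) s :=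
  (ConcreteCategory.congr_hom (F.1.map_comp (homOfLE h).op (homOfLE h').op) s).symm

theorem vec_glue (F : TopCat.Sheaf (ModuleCat.{u} ℂ) X) {ι : Type u} (W : ι → Opens X)
    (V : Opens X) (hW : ∀ i, W i ≤ V) (hV : V ≤ iSup W) (s : ∀ i, VecSec F (W i))
    (hs : ∀ i j (T : Opens X) (hi : T ≤ W i) (hj : T ≤ W j),
      vecRes F hi (s i) = vecRes F hj (s j)) :
    ∃! t : VecSec F V, ∀ i, vecRes F (hW i) t = s i :=
  F.existsUnique_gluing' W V (fun i => homOfLE (hW i)) hV s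
    (fun i j => hs i j _ inf_le_left inf_le_right)

theorem vec_ext (F : TopCat.Sheaf (ModuleCat.{u} ℂ) X) {ι : Type u} (W : ι → Opens X)
    (V : Opens X) (hW : ∀ i, W i ≤ V) (hV : V ≤ iSup W) (s t : VecSec F V)
    (hs : ∀ i, vecRes F (hW i) s = vecRes F (hW i) t) : s = t :=
  (vec_glue F W V hW hV (fun i => vecRes F (hW i) t)
    (fun i j T hi hj => by rw [vecRes_vecRes, vecRes_vecRes])).unique hs fun _ => rfl

theorem alg_glue (F : TopCat.Sheaf (AlgCat.{u} ℂ) X) {ι : Type u} (W : ι → Opens X)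
    (V : Opens X) (hW : ∀ i, W i ≤ V) (hV : V ≤ iSup W) (s : ∀ i, AlgSec F (W i))
    (hs : ∀ i j (T : Opens X) (hi : T ≤ W i) (hj : T ≤ W j),
      algRes F hi (s i) = algRes F hj (s j)) :
    ∃! t : AlgSec F V, ∀ i, algRes F (hW i) t = s i :=
  F.existsUnique_gluing' W V (fun i => homOfLE (hW i)) hV s
    (fun i j => hs i j _ inf_le_left inf_le_right)

/-- An increasing exhaustive filtration of a sheaf of vector spaces by subsheaves. The sheaf is
given by its sections and its restriction maps. -/
structure SheafFiltration (F : Opens X → Type u) [∀ U, AddCommGroup (F U)] [∀ U, Module ℂ (F U)]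
    (res : ∀ ⦃U V : Opens X⦄, V ≤ U → F U →ₗ[ℂ] F V) where
  /-- sections over `U` of the `n`-th step -/
  step : ℕ → ∀ U : Opens X, Submodule ℂ (F U)
  mono : ∀ (n : ℕ) (U : Opens X), step n U ≤ step (n + 1) U
  res_mem : ∀ (n : ℕ) ⦃U V : Opens X⦄ (h : V ≤ U), ∀ s ∈ step n U, res h s ∈ step n V
  mem_of_locally : ∀ (n : ℕ) (U : Opens X) (s : F U),
    (∀ x ∈ U, ∃ (V : Opens X) (h : V ≤ U), x ∈ V ∧ res h s ∈ step n V) → s ∈ step n U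
  exhaustive : ∀ (U : Opens X) (s : F U), ∀ x ∈ U,
    ∃ (V : Opens X) (h : V ≤ U), x ∈ V ∧ ∃ n, res h s ∈ step n V

end Sections

/-- A sheaf of filtered associative unital `ℂ`-algebras. -/
structure FilteredAlgebraSheaf (X : TopCat.{u}) where
  sheaf : TopCat.Sheaf (AlgCat.{u} ℂ) X
  filtration : SheafFiltration (AlgSec sheaf) fun _ _ h => (algRes sheaf h).toLinearMap
  mul_mem : ∀ (m n : ℕ) (U : Opens X) (a b : AlgSec sheaf U),
    a ∈ filtration.step m U → b ∈ filtration.step n U → a * b ∈ filtration.step (m + n) U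

namespace FilteredAlgebraSheaf

variable {X : TopCat.{u}} (Λ : FilteredAlgebraSheaf X)

/-- Sections over `U`. -/
abbrev Sec (U : Opens X) : Type u := AlgSec Λ.sheaf U

/-- Restriction of sections. -/
abbrev res ⦃U V : Opens X⦄ (h : V ≤ U) : Λ.Sec U →ₐ[ℂ] Λ.Sec V := algRes Λ.sheaf h

/-- Sections over `U` of the `n`-th step of the filtration. -/
abbrev fil (n : ℕ) (U : Opens X) : Submodule ℂ (Λ.Sec U) := Λ.filtration.step n U

end FilteredAlgebraSheaf

open scoped RightActions in
/-- A sheaf of filtered `Λ`-`Λ`-bimodules: a sheaf of vector spaces with commuting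
left and right actions of `Λ`, on both of which `ℂ` acts in the same way, and an increasing
exhaustive filtration compatible with both actions. -/
structure FilteredBimoduleSheaf {X : TopCat.{u}} (Λ : FilteredAlgebraSheaf X) where
  sheaf : TopCat.Sheaf (ModuleCat.{u} ℂ) X
  [left : ∀ U : Opens X, Module (Λ.Sec U) (VecSec sheaf U)]
  [right : ∀ U : Opens X, Module (Λ.Sec U)ᵐᵒᵖ (VecSec sheaf U)]
  [comm : ∀ U : Opens X, SMulCommClass (Λ.Sec U) (Λ.Sec U)ᵐᵒᵖ (VecSec sheaf U)]
  [left_tower : ∀ U : Opens X, IsScalarTower ℂ (Λ.Sec U) (VecSec sheaf U)]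
  [right_tower : ∀ U : Opens X, IsScalarTower ℂ (Λ.Sec U)ᵐᵒᵖ (VecSec sheaf U)]
  res_left : ∀ ⦃U V : Opens X⦄ (h : V ≤ U) (l : Λ.Sec U) (a : VecSec sheaf U),
    vecRes sheaf h (l • a) = Λ.res h l • vecRes sheaf h a
  res_right : ∀ ⦃U V : Opens X⦄ (h : V ≤ U) (l : Λ.Sec U) (a : VecSec sheaf U),
    vecRes sheaf h (a <• l) = vecRes sheaf h a <• Λ.res h l
  filtration : SheafFiltration (VecSec sheaf) (vecRes sheaf)
  left_mem : ∀ (m n : ℕ) (U : Opens X) (l : Λ.Sec U) (a : VecSec sheaf U),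
    l ∈ Λ.fil m U → a ∈ filtration.step n U → l • a ∈ filtration.step (m + n) U
  right_mem : ∀ (m n : ℕ) (U : Opens X) (l : Λ.Sec U) (a : VecSec sheaf U),
    l ∈ Λ.fil m U → a ∈ filtration.step n U → a <• l ∈ filtration.step (n + m) U

namespace FilteredBimoduleSheaf

attribute [instance] left right comm left_tower right_tower

variable {X : TopCat.{u}} {Λ : FilteredAlgebraSheaf X} (A : FilteredBimoduleSheaf Λ)

/-- Sections over `U`. -/
abbrev Sec (U : Opens X) : Type u := VecSec A.sheaf U

/-- Restriction of sections. -/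
abbrev res ⦃U V : Opens X⦄ (h : V ≤ U) : A.Sec U →ₗ[ℂ] A.Sec V := vecRes A.sheaf h

/-- Sections over `U` of the `n`-th step of the filtration. -/
abbrev fil (n : ℕ) (U : Opens X) : Submodule ℂ (A.Sec U) := A.filtration.step n U

end FilteredBimoduleSheaf

section Instances

instance : PreservesFilteredColimitsOfSize.{u, u} (forget (ModuleCat.{u} ℂ)) :=
  Limits.comp_preservesFilteredColimits (forget₂ (ModuleCat.{u} ℂ) AddCommGrpCat.{u})
    (forget AddCommGrpCat.{u})

instance : AB5OfSize.{u, u} (ModuleCat.{u} ℂ) where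
  ofShape J _ _ :=
    HasExactColimitsOfShape.domain_of_functor J (forget₂ (ModuleCat.{u} ℂ) AddCommGrpCat.{u})

instance : IsGrothendieckAbelian.{u} (ModuleCat.{u} ℂ) where

end Instances

section Cochains

variable {X : TopCat.{u}} (Λ : FilteredAlgebraSheaf X) (A : FilteredBimoduleSheaf Λ)

/-- The filtration preserving Hochschild `n`-cochains over `U`, i.e. the morphisms of sheaves of
vector spaces `Λ^{⊗n}|_U ⟶ A|_U` mapping `Λ_{i₁} ⊗ ⋯ ⊗ Λ_{iₙ}` to `A_{i₁ + ⋯ + iₙ}`. By the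
universal properties of the tensor product and of sheafification such a morphism is
a family of multilinear maps `Λ(V)^n → A(V)`, `V ⊆ U`, compatible with restrictions. -/
def filteredCochains (n : ℕ) (U : Opens X) :
    Submodule ℂ (∀ V : {V : Opens X // V ≤ U},
      MultilinearMap ℂ (fun _ : Fin n => Λ.Sec V) (A.Sec V)) where
  carrier := {f |
    (∀ (V W : {V : Opens X // V ≤ U}) (h : W.1 ≤ V.1) (a : Fin n → Λ.Sec V),
      A.res h (f V a) = f W fun k => Λ.res h (a k)) ∧
    ∀ (V : {V : Opens X // V ≤ U}) (d : Fin n → ℕ) (a : Fin n → Λ.Sec V),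
      (∀ k, a k ∈ Λ.fil (d k) V) → f V a ∈ A.fil (∑ k, d k) V}
  add_mem' := fun {f g} hf hg =>
    ⟨fun V W h a => by simp [hf.1 V W h, hg.1 V W h],
      fun V d a ha => add_mem (hf.2 V d a ha) (hg.2 V d a ha)⟩
  zero_mem' := ⟨fun V W h a => by simp, fun V d a ha => zero_mem _⟩
  smul_mem' := fun c f hf =>
    ⟨fun V W h a => by simp [hf.1 V W h],
      fun V d a ha => Submodule.smul_mem _ c (hf.2 V d a ha)⟩

/-- Restriction of cochains to a smaller open set. -/
def restrictCochain (n : ℕ) ⦃U V : Opens X⦄ (h : V ≤ U) :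
    filteredCochains Λ A n U →ₗ[ℂ] filteredCochains Λ A n V where
  toFun f := ⟨fun W => f.1 ⟨W.1, W.2.trans h⟩,
    fun W W' h' a => f.2.1 ⟨W.1, W.2.trans h⟩ ⟨W'.1, W'.2.trans h⟩ h' a,
    fun W d a ha => f.2.2 ⟨W.1, W.2.trans h⟩ d a ha⟩
  map_add' _ _ := rfl
  map_smul' _ _ := rfl

/-- The presheaf `U ↦ filteredCochains Λ A n U`. -/
def cochainPresheaf (n : ℕ) : TopCat.Presheaf (ModuleCat.{u} ℂ) X where
  obj U := ModuleCat.of ℂ (filteredCochains Λ A n U.unop)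
  map h := ModuleCat.ofHom (restrictCochain Λ A n h.unop.le)
  map_id _ := rfl
  map_comp _ _ := rfl

theorem cochainPresheaf_isSheaf (n : ℕ) : (cochainPresheaf Λ A n).IsSheaf := by
  rw [TopCat.Presheaf.isSheaf_iff_isSheafUniqueGluing]
  intro ι U sf hsf
  have compat : ∀ i j (T : Opens X) (hi : T ≤ U i) (hj : T ≤ U j),
      (sf i).1 ⟨T, hi⟩ = (sf j).1 ⟨T, hj⟩ := fun i j T hi hj =>
    congrFun (congrArg Subtype.val (hsf i j)) ⟨T, le_inf hi hj⟩
  have cov : ∀ V : {V : Opens X // V ≤ iSup U}, V.1 ≤ iSup fun i => V.1 ⊓ U i := fun V => by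
    rw [← inf_iSup_eq]; exact le_inf le_rfl V.2
  have glue : ∀ (V : {V : Opens X // V ≤ iSup U}) (a : Fin n → Λ.Sec V),
      ∃ t : A.Sec V, ∀ i, A.res inf_le_left t =
        (sf i).1 ⟨V.1 ⊓ U i, inf_le_right⟩ fun k => Λ.res inf_le_left (a k) := by
    intro V a
    refine (vec_glue A.sheaf (fun i => V.1 ⊓ U i) V.1 (fun i => inf_le_left) (cov V) _
      fun i j T hi hj => ?_).exists
    refine ((sf i).2.1 ⟨V.1 ⊓ U i, inf_le_right⟩ ⟨T, hi.trans inf_le_right⟩ hi _).trans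
      (Eq.trans ?_ ((sf j).2.1 ⟨V.1 ⊓ U j, inf_le_right⟩ ⟨T, hj.trans inf_le_right⟩ hj _).symm)
    simp only [algRes_algRes]
    rw [compat i j]
  choose G hG using glue
  have ext' : ∀ (V : {V : Opens X // V ≤ iSup U}) (s t : A.Sec V),
      (∀ i, A.res (inf_le_left : V.1 ⊓ U i ≤ V.1) s = A.res inf_le_left t) → s = t :=
    fun V s t => vec_ext A.sheaf (fun i => V.1 ⊓ U i) V.1 (fun i => inf_le_left) (cov V) s t
  have upd : ∀ (V W : Opens X) (h : W ≤ V) (a : Fin n → Λ.Sec V) (k : Fin n) (x : Λ.Sec V),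
      (fun j => Λ.res h (Function.update a k x j)) =
        Function.update (fun j => Λ.res h (a j)) k (Λ.res h x) := fun V W h a k x =>
    funext fun j => Function.apply_update (fun _ => ⇑(Λ.res h)) a k x j
  let g : ∀ V : {V : Opens X // V ≤ iSup U},
      MultilinearMap ℂ (fun _ : Fin n => Λ.Sec V) (A.Sec V) := fun V =>
    MultilinearMap.mk' (G V)
      (fun a k x y => ext' V _ _ fun i => by
        simp only [map_add, hG, upd, MultilinearMap.map_update_add])
      (fun a k c x => ext' V _ _ fun i => by
        simp only [map_smul, hG, upd, MultilinearMap.map_update_smul])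
  have hgG : ∀ V a, g V a = G V a := fun V a => rfl
  have key : ∀ (V : {V : Opens X // V ≤ iSup U}) (i : ι) (W : Opens X) (hV : W ≤ V.1)
      (hi : W ≤ U i) (a : Fin n → Λ.Sec V),
      A.res hV (G V a) = (sf i).1 ⟨W, hi⟩ fun k => Λ.res hV (a k) := by
    intro V i W hV hi a
    have h1 := congrArg (A.res (le_inf hV hi)) (hG V a i)
    rw [vecRes_vecRes] at h1
    rw [h1]
    refine ((sf i).2.1 ⟨V.1 ⊓ U i, inf_le_right⟩ ⟨W, hi⟩ (le_inf hV hi) _).trans ?_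
    simp only [algRes_algRes]
  refine ⟨⟨g, fun V W h a => ?_, fun V d a ha => ?_⟩, fun i => ?_, ?_⟩
  · rw [hgG, hgG]
    refine ext' W _ _ fun i => ?_
    rw [hG, vecRes_vecRes, key V i _ _ inf_le_right]
    simp only [algRes_algRes]
  · rw [hgG]
    refine A.filtration.mem_of_locally _ _ _ fun x hx => ?_
    obtain ⟨i, hi⟩ := Opens.mem_iSup.mp (V.2 hx)
    refine ⟨V.1 ⊓ U i, inf_le_left, ⟨hx, hi⟩, ?_⟩
    have := hG V a i
    simp only at this
    rw [this]
    exact (sf i).2.2 ⟨V.1 ⊓ U i, inf_le_right⟩ d _ fun k => Λ.filtration.res_mem _ _ _ (ha k)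
  · refine Subtype.ext (funext fun V => MultilinearMap.ext fun a => ?_)
    have h1 := key ⟨V.1, V.2.trans (le_iSup U i)⟩ i V.1 le_rfl V.2 a
    rw [vecRes_self] at h1
    refine h1.trans ?_
    simp only [algRes_self]
  · intro f hf
    refine Subtype.ext (funext fun V => MultilinearMap.ext fun a => ?_)
    refine ext' V _ _ fun i => ?_
    rw [hgG, hG]
    refine (f.2.1 V ⟨V.1 ⊓ U i, inf_le_left.trans V.2⟩ inf_le_left a).trans ?_
    exact congrArg (fun φ : filteredCochains Λ A n (U i) => φ.1 ⟨V.1 ⊓ U i, inf_le_right⟩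
      fun k => Λ.res inf_le_left (a k)) (hf i)

/-- The sheaf of filtration preserving Hochschild `n`-cochains of `Λ` with values in `A`. -/
def cochainSheaf (n : ℕ) : TopCat.Sheaf (ModuleCat.{u} ℂ) X :=
  ⟨cochainPresheaf Λ A n, cochainPresheaf_isSheaf Λ A n⟩

/-- The Hochschild differential on filtration preserving cochains over `U`. -/
def cochainD (n : ℕ) (U : Opens X) :
    filteredCochains Λ A n U →ₗ[ℂ] filteredCochains Λ A (n + 1) U where
  toFun f := ⟨fun V => hochschildD n (f.1 V), by
    refine ⟨fun V W h a => ?_, fun V d a ha => ?_⟩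
    · have hc : ∀ i : Fin n, (fun k => Λ.res h (Fin.contractNth i.castSucc (· * ·) a k)) =
          Fin.contractNth i.castSucc (· * ·) fun k => Λ.res h (a k) := by
        intro i
        ext k
        simp only [Fin.contractNth]
        split_ifs <;> simp
      simp only [hochschildD_apply, map_add, map_sum, map_smul, A.res_left, A.res_right,
        f.2.1 V W h, hc]
      rfl
    · rw [hochschildD_apply]
      refine add_mem (add_mem ?_ (sum_mem fun i _ => Submodule.smul_mem _ _ ?_))
        (Submodule.smul_mem _ _ ?_)
      · rw [Fin.sum_univ_succ]
        exact A.left_mem _ _ _ _ _ (ha 0) (f.2.2 V (fun k => d k.succ) _ fun k => ha k.succ)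
      · rw [← sum_contractNth n i d]
        refine f.2.2 V _ _ fun k => ?_
        simp only [Fin.contractNth]
        split_ifs
        · exact ha _
        · exact Λ.mul_mem _ _ _ _ _ (ha _) (ha _)
        · exact ha _
      · rw [Fin.sum_univ_castSucc]
        exact A.right_mem _ _ _ _ _ (ha _) (f.2.2 V (fun k => d k.castSucc) _ fun k => ha _)⟩
  map_add' f g := by
    refine Subtype.ext (funext fun V => MultilinearMap.ext fun a => ?_)
    simp [hochschildD_apply, Finset.sum_add_distrib]
    abel
  map_smul' c f := by
    refine Subtype.ext (funext fun V => MultilinearMap.ext fun a => ?_)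
    change hochschildD n (c • f.1 V) a = c • hochschildD n (f.1 V) a
    rw [hochschildD_apply, hochschildD_apply, smul_add, smul_add, Finset.smul_sum]
    congr 1
    · congr 1
      · exact smul_algebra_smul_comm _ _ _
      · exact Finset.sum_congr rfl fun i _ => smul_comm _ _ _
    · rw [smul_comm c]
      congr 1
      exact smul_algebra_smul_comm _ _ _

/-- The Hochschild differential as a morphism of sheaves. -/
noncomputable def cochainSheafD (n : ℕ) : cochainSheaf Λ A n ⟶ cochainSheaf Λ A (n + 1) :=
  ⟨{ app := fun U => ModuleCat.ofHom (cochainD Λ A n U.unop)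
     naturality := fun _ _ _ => rfl }⟩

/-- The complex `C_f^•(Λ, A)` of sheaves of filtration preserving Hochschild cochains. -/
noncomputable def hochschildComplex : CochainComplex (TopCat.Sheaf (ModuleCat.{u} ℂ) X) ℕ :=
  CochainComplex.of (cochainSheaf Λ A) (cochainSheafD Λ A) fun n => by
    refine CategoryTheory.Sheaf.hom_ext (NatTrans.ext (funext fun U => ModuleCat.hom_ext (LinearMap.ext fun f => ?_)))
    exact Subtype.ext (funext fun V => hochschildD_comp n (f.1 V))

end Cochains

section Extensions

variable {X : TopCat.{u}} {Λ : FilteredAlgebraSheaf X} {A : FilteredBimoduleSheaf Λ}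

variable (Λ A) in
open scoped RightActions in
/-- A filtered square-zero extension `0 ⟶ A ⟶ Γ ⟶ Λ ⟶ 0`: a sheaf `Γ` of filtered algebras with
morphisms `i`, `p` of sheaves of filtered vector spaces forming a short exact sequence, such
that `p` is a homomorphism of sheaves of algebras, `i(A)² = 0`, and the bimodule structure that
`A ≅ ker p` inherits from `Γ` is the given one. The sequence is exact as a sequence of filtered
sheaves; in particular the filtration of `A` is the one induced from `Γ`. -/
structure FilteredExtension where
  Γ : FilteredAlgebraSheaf X
  i : ∀ U : Opens X, A.Sec U →ₗ[ℂ] Γ.Sec U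
  p : ∀ U : Opens X, Γ.Sec U →ₐ[ℂ] Λ.Sec U
  i_res : ∀ ⦃U V : Opens X⦄ (h : V ≤ U) (a : A.Sec U), i V (A.res h a) = Γ.res h (i U a)
  p_res : ∀ ⦃U V : Opens X⦄ (h : V ≤ U) (g : Γ.Sec U), p V (Γ.res h g) = Λ.res h (p U g)
  i_injective : ∀ U : Opens X, Function.Injective (i U)
  exact : ∀ (U : Opens X) (g : Γ.Sec U), p U g = 0 ↔ ∃ a, i U a = g
  p_locally_surjective : ∀ (U : Opens X) (l : Λ.Sec U), ∀ x ∈ U,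
    ∃ (V : Opens X) (h : V ≤ U), x ∈ V ∧ ∃ g, p V g = Λ.res h l
  square_zero : ∀ (U : Opens X) (a b : A.Sec U), i U a * i U b = 0
  left_mul : ∀ (U : Opens X) (g : Γ.Sec U) (a : A.Sec U), g * i U a = i U (p U g • a)
  right_mul : ∀ (U : Opens X) (g : Γ.Sec U) (a : A.Sec U), i U a * g = i U (a <• p U g)
  i_mem_iff : ∀ (n : ℕ) (U : Opens X) (a : A.Sec U), i U a ∈ Γ.fil n U ↔ a ∈ A.fil n U
  p_mem : ∀ (n : ℕ) (U : Opens X) (g : Γ.Sec U), g ∈ Γ.fil n U → p U g ∈ Λ.fil n U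

namespace FilteredExtension

/-- A filtration preserving linear splitting `Λ|_U ⟶ Γ|_U` of `p` over the open set `U`. -/
structure LinearSplitting (ξ : FilteredExtension Λ A) (U : Opens X) where
  j : ∀ V : Opens X, V ≤ U → (Λ.Sec V →ₗ[ℂ] ξ.Γ.Sec V)
  j_res : ∀ (V W : Opens X) (hV : V ≤ U) (h : W ≤ V) (l : Λ.Sec V),
    j W (h.trans hV) (Λ.res h l) = ξ.Γ.res h (j V hV l)
  p_j : ∀ (V : Opens X) (hV : V ≤ U) (l : Λ.Sec V), ξ.p V (j V hV l) = l
  j_mem : ∀ (n : ℕ) (V : Opens X) (hV : V ≤ U) (l : Λ.Sec V),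
    l ∈ Λ.fil n V → j V hV l ∈ ξ.Γ.fil n V

/-- `X` is covered by open sets over which there is a filtration preserving linear splitting. -/
def IsLocallyTrivial (ξ : FilteredExtension Λ A) : Prop :=
  ∀ x : X, ∃ U : Opens X, x ∈ U ∧ Nonempty (ξ.LinearSplitting U)

/-- A filtration preserving homomorphism of sheaves of algebras `Γ_ξ ⟶ Γ_η` that induces the
identity of `Λ` and the multiplication by `c` on `A`. -/
structure HomOver (c : ℂ) (ξ η : FilteredExtension Λ A) where
  φ : ∀ U : Opens X, ξ.Γ.Sec U →ₐ[ℂ] η.Γ.Sec U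
  φ_res : ∀ ⦃U V : Opens X⦄ (h : V ≤ U) (g : ξ.Γ.Sec U), φ V (ξ.Γ.res h g) = η.Γ.res h (φ U g)
  φ_mem : ∀ (n : ℕ) (U : Opens X) (g : ξ.Γ.Sec U), g ∈ ξ.Γ.fil n U → φ U g ∈ η.Γ.fil n U
  φ_i : ∀ (U : Opens X) (a : A.Sec U), φ U (ξ.i U a) = η.i U (c • a)
  p_φ : ∀ (U : Opens X) (g : ξ.Γ.Sec U), η.p U (φ U g) = ξ.p U g

/-- Two filtered extensions are equivalent if there is a filtration preserving homomorphism of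
sheaves of algebras between them that is compatible with `i` and `p`. -/
def Equivalent (ξ η : FilteredExtension Λ A) : Prop :=
  Nonempty (HomOver 1 ξ η)

theorem Equivalent.refl (ξ : FilteredExtension Λ A) : ξ.Equivalent ξ :=
  ⟨⟨fun _ => AlgHom.id ℂ _, fun _ _ _ _ => rfl, fun _ _ _ h => h, fun _ _ => by simp,
    fun _ _ => rfl⟩⟩

theorem Equivalent.trans {ξ η ζ : FilteredExtension Λ A} (h : ξ.Equivalent η)
    (h' : η.Equivalent ζ) : ξ.Equivalent ζ := by
  obtain ⟨κ⟩ := h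
  obtain ⟨κ'⟩ := h'
  exact ⟨⟨fun U => (κ'.φ U).comp (κ.φ U), fun _ _ _ _ => by simp [κ.φ_res, κ'.φ_res],
    fun _ _ _ h => κ'.φ_mem _ _ _ (κ.φ_mem _ _ _ h), fun _ _ => by simp [κ.φ_i, κ'.φ_i],
    fun _ _ => by simp [κ.p_φ, κ'.p_φ]⟩⟩

theorem Equivalent.symm {ξ η : FilteredExtension Λ A} (hξ : ξ.IsLocallyTrivial)
    (h : ξ.Equivalent η) : η.Equivalent ξ := by
  obtain ⟨κ⟩ := h
  have κi : ∀ (U : Opens X) (a : A.Sec U), κ.φ U (ξ.i U a) = η.i U a := fun U a => by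
    rw [κ.φ_i, one_smul]
  have inj : ∀ U, Function.Injective (κ.φ U) := by
    intro U
    rw [injective_iff_map_eq_zero]
    intro g hg
    obtain ⟨a, rfl⟩ := (ξ.exact U g).1 (by rw [← κ.p_φ, hg, map_zero])
    rw [κi] at hg
    rw [η.i_injective U (hg.trans (map_zero _).symm), map_zero]
  have loc : ∀ (U : Opens X) (y : η.Γ.Sec U) (V : Opens X) (h : V ≤ U) (g : ξ.Γ.Sec V),
      ξ.p V g = Λ.res h (η.p U y) → ∃ a, κ.φ V (g + ξ.i V a) = η.Γ.res h y := by
    intro U y V h g hg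
    obtain ⟨a, ha⟩ := (η.exact V (η.Γ.res h y - κ.φ V g)).1 (by
      rw [map_sub, η.p_res, κ.p_φ, hg, sub_self])
    exact ⟨a, by rw [map_add, κi, ha]; abel⟩
  have surj : ∀ U, Function.Surjective (κ.φ U) := by
    intro U y
    have h1 : ∀ x : U, ∃ (V : Opens X) (h : V ≤ U), x.1 ∈ V ∧ ∃ g, κ.φ V g = η.Γ.res h y := by
      intro x
      obtain ⟨V, h, hx, g, hg⟩ := ξ.p_locally_surjective U (η.p U y) x.1 x.2
      obtain ⟨a, ha⟩ := loc U y V h g hg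
      exact ⟨V, h, hx, _, ha⟩
    choose W hW hxW g hg using h1
    have cov : U ≤ iSup W := fun x hx => Opens.mem_iSup.2 ⟨⟨x, hx⟩, hxW ⟨x, hx⟩⟩
    obtain ⟨t, ht, -⟩ := alg_glue ξ.Γ.sheaf W U hW cov g fun a b T ha hb => inj T (by
      rw [κ.φ_res, κ.φ_res, hg, hg, algRes_algRes, algRes_algRes])
    refine ⟨t, ?_⟩
    refine (alg_glue η.Γ.sheaf W U hW cov (fun a => η.Γ.res (hW a) y) fun a b T ha hb => by
      rw [algRes_algRes, algRes_algRes]).unique (fun a => ?_) fun _ => rfl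
    rw [← κ.φ_res, ht, hg]
  have mem : ∀ (n : ℕ) (U : Opens X) (g : ξ.Γ.Sec U), κ.φ U g ∈ η.Γ.fil n U →
      g ∈ ξ.Γ.fil n U := by
    intro n U g hg
    refine ξ.Γ.filtration.mem_of_locally n U g fun x hx => ?_
    obtain ⟨V, hxV, ⟨J⟩⟩ := hξ x
    refine ⟨U ⊓ V, inf_le_left, ⟨hx, hxV⟩, ?_⟩
    set g' := ξ.Γ.res (inf_le_left : U ⊓ V ≤ U) g with hg'
    have h1 : κ.φ _ g' ∈ η.Γ.fil n (U ⊓ V) := by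
      rw [hg', κ.φ_res]
      exact η.Γ.filtration.res_mem n inf_le_left _ hg
    have h2 : J.j (U ⊓ V) inf_le_right (ξ.p _ g') ∈ ξ.Γ.fil n (U ⊓ V) := by
      refine J.j_mem _ _ _ _ ?_
      rw [← κ.p_φ]
      exact η.p_mem _ _ _ h1
    obtain ⟨a, ha⟩ := (ξ.exact _ (g' - J.j (U ⊓ V) inf_le_right (ξ.p _ g'))).1 (by
      rw [map_sub, J.p_j, sub_self])
    have h3 : ξ.i _ a ∈ ξ.Γ.fil n (U ⊓ V) := by
      rw [ξ.i_mem_iff, ← η.i_mem_iff, ← κi, ha, map_sub]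
      exact sub_mem h1 (κ.φ_mem _ _ _ h2)
    have h4 : g' = ξ.i _ a + J.j (U ⊓ V) inf_le_right (ξ.p _ g') := by rw [ha]; abel
    change g' ∈ ξ.Γ.fil n (U ⊓ V)
    rw [h4]
    exact add_mem h3 h2
  let e : ∀ U, ξ.Γ.Sec U ≃ₐ[ℂ] η.Γ.Sec U := fun U =>
    AlgEquiv.ofBijective (κ.φ U) ⟨inj U, surj U⟩
  have he : ∀ U g, κ.φ U ((e U).symm g) = g := fun U g => (e U).apply_symm_apply g
  refine ⟨⟨fun U => (e U).symm.toAlgHom, fun U V h g => inj V ?_, fun n U g hg => mem n U _ ?_,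
    fun U a => inj U ?_, fun U g => ?_⟩⟩
  · rw [κ.φ_res]
    exact (he V _).trans (congrArg (η.Γ.res h) (he U g).symm)
  · exact (he U g).symm ▸ hg
  · rw [one_smul, κi]
    exact he U _
  · rw [← κ.p_φ]
    exact congrArg (η.p U) (he U g)

/-- A filtration preserving splitting `Λ ⟶ Γ` of `p` by a homomorphism of sheaves of algebras. -/
structure AlgebraSplitting (ξ : FilteredExtension Λ A) where
  j : ∀ U : Opens X, Λ.Sec U →ₐ[ℂ] ξ.Γ.Sec U
  j_res : ∀ ⦃U V : Opens X⦄ (h : V ≤ U) (l : Λ.Sec U), j V (Λ.res h l) = ξ.Γ.res h (j U l)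
  p_j : ∀ (U : Opens X) (l : Λ.Sec U), ξ.p U (j U l) = l
  j_mem : ∀ (n : ℕ) (U : Opens X) (l : Λ.Sec U), l ∈ Λ.fil n U → j U l ∈ ξ.Γ.fil n U

/-- The extension splits. -/
def IsSplit (ξ : FilteredExtension Λ A) : Prop :=
  Nonempty ξ.AlgebraSplitting

/-- Sections over `U` of the fibre product `Γ_ξ ×_Λ Γ_η`. -/
abbrev fiberProduct (ξ η : FilteredExtension Λ A) (U : Opens X) :
    Subalgebra ℂ (ξ.Γ.Sec U × η.Γ.Sec U) :=
  AlgHom.equalizer ((ξ.p U).comp (AlgHom.fst ℂ _ _)) ((η.p U).comp (AlgHom.snd ℂ _ _))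

/-- A filtration preserving homomorphism of sheaves of algebras
`Γ_ξ ×_Λ Γ_η ⟶ Γ_ζ` that induces the identity of `Λ` and the addition `A × A ⟶ A`. -/
structure BaerSumHom (ξ η ζ : FilteredExtension Λ A) where
  σ : ∀ U : Opens X, fiberProduct ξ η U →ₐ[ℂ] ζ.Γ.Sec U
  σ_res : ∀ ⦃U V : Opens X⦄ (h : V ≤ U) (z : fiberProduct ξ η U) (w : fiberProduct ξ η V),
    w.1 = (ξ.Γ.res h z.1.1, η.Γ.res h z.1.2) → σ V w = ζ.Γ.res h (σ U z)
  σ_mem : ∀ (n : ℕ) (U : Opens X) (z : fiberProduct ξ η U),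
    z.1.1 ∈ ξ.Γ.fil n U → z.1.2 ∈ η.Γ.fil n U → σ U z ∈ ζ.Γ.fil n U
  σ_i : ∀ (U : Opens X) (a b : A.Sec U) (z : fiberProduct ξ η U),
    z.1 = (ξ.i U a, η.i U b) → σ U z = ζ.i U (a + b)
  p_σ : ∀ (U : Opens X) (z : fiberProduct ξ η U), ζ.p U (σ U z) = ξ.p U z.1.1

/-- `ζ` is (equivalent to) the Baer sum of `ξ` and `η`, i.e. the pushout along the addition
`A × A ⟶ A` of the extension `Γ_ξ ×_Λ Γ_η` of `Λ` by `A × A`. Since a morphism of extensions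
inducing the identities of kernel and quotient is an equivalence, this pushout is characterized,
up to equivalence, by the existence of a morphism of extensions from `Γ_ξ ×_Λ Γ_η` to it which
induces the addition on the kernels and the identity of `Λ`. -/
def IsBaerSum (ξ η ζ : FilteredExtension Λ A) : Prop :=
  Nonempty (BaerSumHom ξ η ζ)

/-- `ζ` is (equivalent to) the multiple `c · ξ`, i.e. the pushout of `ξ` along the multiplication
by `c` on `A`. -/
def IsScalarMultiple (c : ℂ) (ξ ζ : FilteredExtension Λ A) : Prop :=
  Nonempty (HomOver c ξ ζ)

end FilteredExtension

variable (Λ A) in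
/-- The locally trivial filtered square-zero extensions of `Λ` by `A`. -/
abbrev LocallyTrivialExtension :=
  {ξ : FilteredExtension Λ A // ξ.IsLocallyTrivial}

/-- Equivalence of locally trivial filtered square-zero extensions. -/
instance extensionSetoid : Setoid (LocallyTrivialExtension Λ A) where
  r ξ η := ξ.1.Equivalent η.1
  iseqv := ⟨fun ξ => .refl ξ.1, fun {ξ _} h => h.symm ξ.2, fun h h' => h.trans h'⟩

variable (Λ A) in
/-- The set `Exal_f(Λ, A)` of equivalence classes of locally trivial filtered square-zero
extensions of `Λ` by `A`. -/
def Exal : Type (u + 1) :=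
  Quotient (extensionSetoid (Λ := Λ) (A := A))

/-- The class of an extension in `Exal_f(Λ, A)`. -/
def Exal.mk (ξ : LocallyTrivialExtension Λ A) : Exal Λ A :=
  Quotient.mk _ ξ

end Extensions

section Hypercohomology

variable (X : TopCat.{u})

/-- The functor of global sections `Γ(X, -)` on sheaves of complex vector spaces. -/
abbrev globalSections : TopCat.Sheaf (ModuleCat.{u} ℂ) X ⥤ ModuleCat.{u} ℂ :=
  (sheafSections (Opens.grothendieckTopology X) (ModuleCat.{u} ℂ)).obj (op ⊤)

instance : (globalSections X).Additive where
  map_add := rfl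

noncomputable instance : HasDerivedCategory (TopCat.Sheaf (ModuleCat.{u} ℂ) X) :=
  HasDerivedCategory.standard _

noncomputable instance : HasDerivedCategory (ModuleCat.{u} ℂ) :=
  HasDerivedCategory.standard _

variable {X}

/-- The hypercohomology `ℍⁿ(X, K) = Hⁿ(RΓ(X, K))` of a bounded below complex `K` of sheaves of
complex vector spaces. -/
noncomputable def hypercohomology (K : CochainComplex.Plus (TopCat.Sheaf (ModuleCat.{u} ℂ) X))
    (n : ℤ) : ModuleCat.{u} ℂ :=
  (DerivedCategory.Plus.homologyFunctor (ModuleCat.{u} ℂ) n).obj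
    ((globalSections X).rightDerivedFunctorPlus.obj
      (DerivedCategory.Plus.Qh.obj ((HomotopyCategory.Plus.quotient _).obj K)))

/-- The brutal truncation `σ_{≥1} K` of a complex `K⁰ ⟶ K¹ ⟶ ⋯`: the complex with `Kⁿ` in
degree `n` for `n ≥ 1` and `0` in the other degrees. -/
noncomputable def brutalTruncation (K : CochainComplex (TopCat.Sheaf (ModuleCat.{u} ℂ) X) ℕ) :
    CochainComplex.Plus (TopCat.Sheaf (ModuleCat.{u} ℂ) X) :=
  ⟨HomologicalComplex.stupidTrunc (K.extend ComplexShape.embeddingUpNat)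
    (ComplexShape.embeddingUpIntGE 1), 1, inferInstance⟩

end Hypercohomology

end FilteredDeformation

/-!
# Locally trivial filtered square-zero extensions and hypercohomology

Let `φ : σ_{≥1} C_f^•(Λ, A) ⟶ I^•` be a quasi-isomorphism to a complex of injective sheaves with
`I^n = 0` for `n ≤ 0`, so that `ℍ²` is the quotient of the closed sections `z ∈ I²(X)` by `d I¹(X)`
(`exists_hochschildResolution`). As both complexes start in degree 1 and sections are left exact,
the mapping cone of `φ` shows (`quasiIso_sections`) that over every open set a 1-cochain `t` is
determined by the pair `(d t, φ t)`, that every pair `(c, b)` of a 2-cocycle and a section of `I¹`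
with `φ c = d b` is of this form, and that every closed section of `I²` is locally `φ c + d b` with
a 2-cocycle `c`.

A filtered linear splitting `j` of an extension over `U` has a curvature, the Hochschild 2-cocycle
`c_j(l, l') = j(l) j(l') - j(l l')`, and `c_{j + i t} = c_j + d t`. A *potential* (`Potential`) for
a closed `z ∈ I²(X)` assigns to each `j` a section `b_j` of `I¹` with `z|_U = φ c_j + d b_j` and
`b_{j + i t} = b_j - φ t`. Three facts give the theorem.

* Every locally trivial extension `ξ` has a potential, for some closed `z` (`exists_potential`).
  The retraction `r_j = 1 - j p` of `i` is a 1-cochain of `Γ` with values in `A`, and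
  `r_{j + i t} = r_j - t p`. Since `I¹` is injective, `φ` extends along `t ↦ t p` from the
  1-cochains of `Λ` to those of `Γ`, and `b_j` is the value of this extension on `r_j`. No choice of
  a cover is involved.
* If `ξ`, `η`, `ζ` have potentials for `z`, `w`, `y`, then there is a morphism
  `Γ_ξ ×_Λ Γ_η ⟶ Γ_ζ` inducing `(a, b) ↦ c a + d b` on the kernels if and only if
  `y - (c z + d w)` is in `d I¹(X)` (`nonempty_combinationHom_iff`). For `y = c z + d w`
  the morphism is glued from `(j l + i a, j' l + i a') ↦ k l + i (c a + d a')`, where the splitting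
  `k` of `ζ` is the unique one whose curvature and potential are the linear combinations of
  those of `j` and `j'`. Equivalences, multiples and Baer sums are all morphisms of this kind, and
  an extension splits if and only if it is its own multiple by `0` (`isSplit_iff`).
* Every closed `z` has a potential for some extension (`nonempty_potential_twisted`). The local
  representations `q = (c, b)` of `z` as `φ c + d b` form a torsor under the 1-cochains, and they
  have to become the linear splittings `j_q`. So a section of the extension is a section `l` of `Λ`
  with a family `m_q` of sections of `A` such that `m_{q + t} = m_q - t(l)`, thought of as
  `j_q(l) + i(m_q)`; this dictates the product (`twisted`).

Hence mapping an extension with a potential for `z` to the class of `z` is a bijection from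
equivalence classes to `ℍ²`, and it turns Baer sums and pushouts along scalars into the operations
of the vector space `ℍ²`.
-/

/-! ### Sections of sheaves of vector spaces -/

namespace FilteredDeformation

section SheafSections

variable {X : TopCat.{u}}

/-- The map on sections over `U` induced by a morphism of sheaves of vector spaces. -/
abbrev secMap {F G : TopCat.Sheaf (ModuleCat.{u} ℂ) X} (f : F ⟶ G) (U : Opens X) :
    VecSec F U →ₗ[ℂ] VecSec G U :=
  (f.hom.app (op U)).hom

variable {F G H : TopCat.Sheaf (ModuleCat.{u} ℂ) X}

theorem secMap_res (f : F ⟶ G) {U V : Opens X} (h : V ≤ U) (s : VecSec F U) :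
    secMap f V (vecRes F h s) = vecRes G h (secMap f U s) :=
  ConcreteCategory.congr_hom (f.hom.naturality (homOfLE h).op) s

theorem secMap_comp (f : F ⟶ G) (g : G ⟶ H) (U : Opens X) (s : VecSec F U) :
    secMap (f ≫ g) U s = secMap g U (secMap f U s) := rfl

theorem secMap_zero (U : Opens X) (s : VecSec F U) : secMap (0 : F ⟶ G) U s = 0 := rfl

/-- The functor of sections over `U`. -/
noncomputable abbrev sectionsFunctor (U : Opens X) :
    TopCat.Sheaf (ModuleCat.{u} ℂ) X ⥤ ModuleCat.{u} ℂ :=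
  sheafToPresheaf (Opens.grothendieckTopology X) (ModuleCat.{u} ℂ) ⋙
    (evaluation (Opens X)ᵒᵖ (ModuleCat.{u} ℂ)).obj (op U)

instance (U : Opens X) : (sectionsFunctor U).Additive where
  map_add := rfl

instance (U : Opens X) : PreservesFiniteLimits (sectionsFunctor U) := by
  have : (sheafToPresheaf (Opens.grothendieckTopology X) (ModuleCat.{u} ℂ)).IsRightAdjoint :=
    (sheafificationAdjunction _ _).isRightAdjoint
  exact comp_preservesFiniteLimits (sheafToPresheaf _ _) ((evaluation _ _).obj (op U))

theorem secMap_injective (f : F ⟶ G) [Mono f] (U : Opens X) : Function.Injective (secMap f U) :=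
  (ModuleCat.mono_iff_injective _).1 (inferInstanceAs (Mono ((sectionsFunctor U).map f)))

theorem mono_of_secMap_injective (f : F ⟶ G) (hf : ∀ U, Function.Injective (secMap f U)) :
    Mono f :=
  ⟨fun g h e => CategoryTheory.Sheaf.hom_ext (NatTrans.ext (funext fun U =>
    ModuleCat.hom_ext (LinearMap.ext fun s => hf U.unop (by
      have := congrArg (fun k => secMap k U.unop s) e
      simpa only [secMap_comp] using this))))⟩

theorem exists_locally_secMap_eq (f : F ⟶ G) [Epi f] (U : Opens X) (s : VecSec G U) :
    ∀ x ∈ U, ∃ (V : Opens X) (h : V ≤ U), x ∈ V ∧ ∃ t, secMap f V t = vecRes G h s := by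
  intro x hx
  obtain ⟨V, i, ⟨t, ht⟩, hxV⟩ := (TopCat.Presheaf.isLocallySurjective_iff f.hom).1
    ((TopCat.Sheaf.isLocallySurjective_iff_epi f).2 inferInstance) U s x hx
  exact ⟨V, i, hxV, t, ht⟩

theorem exists_secMap_eq_of_exact (S : ShortComplex (TopCat.Sheaf (ModuleCat.{u} ℂ) X))
    (hS : S.Exact) [Mono S.f] (U : Opens X) (s : VecSec S.X₂ U) (hs : secMap S.g U s = 0) :
    ∃ t, secMap S.f U t = s :=
  (ShortComplex.moduleCat_exact_iff _).1 (hS.map_of_mono_of_preservesKernel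
    (sectionsFunctor U) inferInstance inferInstance) s hs

theorem exists_locally_secMap_eq_of_exact (S : ShortComplex (TopCat.Sheaf (ModuleCat.{u} ℂ) X))
    (hS : S.Exact) (U : Opens X) (s : VecSec S.X₂ U) (hs : secMap S.g U s = 0) :
    ∀ x ∈ U, ∃ (V : Opens X) (h : V ≤ U), x ∈ V ∧ ∃ t, secMap S.f V t = vecRes S.X₂ h s := by
  obtain ⟨k, hk⟩ := exists_secMap_eq_of_exact (ShortComplex.mk (kernel.ι S.g) S.g
    (kernel.condition _)) (ShortComplex.exact_kernel _) U s hs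
  have := hS.epi_kernelLift
  intro x hx
  obtain ⟨V, h, hxV, t, ht⟩ := exists_locally_secMap_eq (kernel.lift S.g S.f S.zero) U k x hx
  refine ⟨V, h, hxV, t, ?_⟩
  have h2 : secMap S.f V t = secMap (kernel.lift S.g S.f S.zero ≫ kernel.ι S.g) V t := by
    rw [kernel.lift_ι]
  refine h2.trans ((congrArg (secMap (kernel.ι S.g) V) ht).trans ?_)
  exact (secMap_res _ h k).trans (congrArg _ hk)

end SheafSections

end FilteredDeformation

/-! ### Hypercohomology and sections of an injective resolution -/

namespace FilteredDeformation
variable {X : TopCat.{u}}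

/-- The homology of a short complex of vector spaces, given only up to isomorphism, as a quotient of
the cycles by the boundaries. -/
theorem exists_linearMap_homology (S : ShortComplex (ModuleCat.{u} ℂ)) (H : ModuleCat.{u} ℂ)
    (e : H ≅ S.homology) :
    ∃ π : LinearMap.ker S.g.hom →ₗ[ℂ] H, Function.Surjective π ∧
      ∀ z, π z = 0 ↔ ∃ β, S.f.hom β = z.1 := by
  let e' : H ≅ ModuleCat.of ℂ (LinearMap.ker S.g.hom ⧸ LinearMap.range S.moduleCatToCycles) :=
    e ≪≫ S.moduleCatHomologyIso
  let E := e'.toLinearEquiv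
  refine ⟨E.symm.toLinearMap ∘ₗ (LinearMap.range S.moduleCatToCycles).mkQ,
    E.symm.surjective.comp (Submodule.mkQ_surjective _), fun z => ?_⟩
  change E.symm _ = 0 ↔ _
  rw [LinearEquiv.map_eq_zero_iff]
  refine (Submodule.Quotient.mk_eq_zero _).trans ⟨?_, ?_⟩
  · rintro ⟨β, hβ⟩
    exact ⟨β, congrArg Subtype.val hβ⟩
  · rintro ⟨β, hβ⟩
    exact ⟨β, Subtype.ext hβ⟩

theorem acyclic_mappingCone {C : Type*} [Category* C] [Abelian C] {K L : CochainComplex C ℤ}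
    (φ : K ⟶ L) [QuasiIso φ] : (CochainComplex.mappingCone φ).Acyclic := by
  rw [← HomotopyCategory.quotient_obj_mem_subcategoryAcyclic_iff_acyclic]
  have h := (HomotopyCategory.subcategoryAcyclic C).trW_iff_of_distinguished _
    (HomotopyCategory.mappingCone_triangleh_distinguished φ)
  rw [← HomotopyCategory.quasiIso_eq_trW_subcategoryAcyclic] at h
  refine h.1 ?_
  change HomotopyCategory.quasiIso C _ ((HomotopyCategory.quotient _ _).map φ)
  rw [HomotopyCategory.quotient_map_mem_quasiIso_iff]
  assumption

set_option maxHeartbeats 1000000 in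
open CochainComplex in
/-- What a quasi-isomorphism of complexes of sheaves starting in degree 1 means for sections in
degrees 1 and 2. The mapping cone is acyclic and starts in degree 0; its sections over `U` are
therefore exact in degrees 0 and 1, and locally exact in degree 2. -/
theorem quasiIso_sections {K M : CochainComplex (TopCat.Sheaf (ModuleCat.{u} ℂ) X) ℤ}
    (φ : K ⟶ M) [QuasiIso φ] (hK : IsZero (K.X 0)) (hM : IsZero (M.X 0))
    (hM' : IsZero (M.X (-1))) :
    (∀ (U : Opens X) (t : VecSec (K.X 1) U), secMap (K.d 1 2) U t = 0 →
      secMap (φ.f 1) U t = 0 → t = 0) ∧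
    (∀ (U : Opens X) (c : VecSec (K.X 2) U) (b : VecSec (M.X 1) U), secMap (K.d 2 3) U c = 0 →
      secMap (φ.f 2) U c + secMap (M.d 1 2) U b = 0 →
      ∃ t : VecSec (K.X 1) U, secMap (K.d 1 2) U t = c ∧ secMap (φ.f 1) U t = -b) ∧
    (∀ (U : Opens X) (z : VecSec (M.X 2) U), secMap (M.d 2 3) U z = 0 → ∀ x ∈ U,
      ∃ (V : Opens X) (h : V ≤ U), x ∈ V ∧ ∃ (c : VecSec (K.X 2) V) (b : VecSec (M.X 1) V),
        secMap (K.d 2 3) V c = 0 ∧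
        vecRes (M.X 2) h z = secMap (φ.f 2) V c + secMap (M.d 1 2) V b) := by
  let E := mappingCone φ
  have hE : ∀ n, E.ExactAt n := acyclic_mappingCone φ
  -- The components of the structure morphisms of the cone, and their relations on sections.
  let l (p q : ℤ) (h : p + (-1) = q) : K.X p ⟶ E.X q := (mappingCone.inl φ).v p q h
  let r (p : ℤ) : M.X p ⟶ E.X p := (mappingCone.inr φ).f p
  let f (p q : ℤ) (h : p + 1 = q) : E.X p ⟶ K.X q := (mappingCone.fst φ).1.v p q h
  let s (p : ℤ) : E.X p ⟶ M.X p := (mappingCone.snd φ).v p p (add_zero p)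
  have app : ∀ {A B : TopCat.Sheaf (ModuleCat.{u} ℂ) X} {f g : A ⟶ B} (_ : f = g) (U : Opens X)
      (x : VecSec A U), secMap f U x = secMap g U x := fun h U x => by rw [h]
  have fl (U : Opens X) (p q : ℤ) (h : p + (-1) = q) (h' : q + 1 = p) (x : VecSec (K.X p) U) :
      secMap (f q p h') U (secMap (l p q h) U x) = x :=
    app (mappingCone.inl_v_fst_v φ _ _ _) U x
  have sl (U : Opens X) (p q : ℤ) (h : p + (-1) = q) (x : VecSec (K.X p) U) :
      secMap (s q) U (secMap (l p q h) U x) = 0 :=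
    (app (mappingCone.inl_v_snd_v φ p q h) U x).trans (secMap_zero U x)
  have fr (U : Opens X) (p q : ℤ) (h : p + 1 = q) (x : VecSec (M.X p) U) :
      secMap (f p q h) U (secMap (r p) U x) = 0 := app (mappingCone.inr_f_fst_v φ _ _ _) U x
  have sr (U : Opens X) (p : ℤ) (x : VecSec (M.X p) U) :
      secMap (s p) U (secMap (r p) U x) = x := app (mappingCone.inr_f_snd_v φ _) U x
  have tot (U : Opens X) (p q : ℤ) (h : p + 1 = q) (h' : q + (-1) = p) (x : VecSec (E.X p) U) :
      secMap (l q p h') U (secMap (f p q h) U x) + secMap (r p) U (secMap (s p) U x) = x :=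
    app (mappingCone.id_X φ _ _ _) U x
  have dl (U : Opens X) (i j k : ℤ) (hij : i + (-1) = j) (hik : k + (-1) = i)
      (x : VecSec (K.X i) U) : secMap (E.d j i) U (secMap (l i j hij) U x) =
      secMap (r i) U (secMap (φ.f i) U x) - secMap (l k i hik) U (secMap (K.d i k) U x) :=
    app (mappingCone.inl_v_d φ _ _ _ hij hik) U x
  have dr (U : Opens X) (p q : ℤ) (x : VecSec (M.X p) U) : secMap (E.d p q) U (secMap (r p) U x) =
      secMap (r q) U (secMap (M.d p q) U x) := app (mappingCone.inr_f_d φ _ _) U x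
  have zeroSec : ∀ {A : TopCat.Sheaf (ModuleCat.{u} ℂ) X} (_ : IsZero A) (U : Opens X)
      (x : VecSec A U), x = 0 := fun h U x => app (h.eq_of_src (𝟙 _) 0) U x
  have hEm : IsZero (E.X (-1)) :=
    (mappingCone.isZero_X_iff φ (-1)).2 ⟨hK, hM'⟩
  have mono01 : Mono (E.d 0 1) := by
    have h0 := (E.exactAt_iff' (-1) 0 1 (by simp) (by simp)).1 (hE 0)
    exact (ShortComplex.exact_iff_mono _ (hEm.eq_of_src _ _)).1 h0
  refine ⟨fun U t h1 h2 => ?_, fun U c b h1 h2 => ?_, fun U z hz x hx => ?_⟩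
  · have h3 : secMap (E.d 0 1) U (secMap (l 1 0 rfl) U t) = 0 := by
      rw [dl U 1 0 2 rfl rfl, h1, h2, map_zero, map_zero, sub_zero]
    have h4 := secMap_injective (E.d 0 1) U (h3.trans (map_zero _).symm)
    rw [← fl U 1 0 rfl rfl t, h4, map_zero]
  · have h3 : secMap (E.d 1 2) U (secMap (l 2 1 rfl) U c + secMap (r 1) U b) = 0 := by
      rw [map_add, dl U 2 1 3 rfl rfl, dr, h1, map_zero, sub_zero, ← map_add, h2, map_zero]
    have : Mono (E.sc' 0 1 2).f := mono01
    obtain ⟨y, hy⟩ : ∃ y : VecSec (E.X 0) U, secMap (E.d 0 1) U y =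
        secMap (l 2 1 rfl) U c + secMap (r 1) U b :=
      exists_secMap_eq_of_exact (E.sc' 0 1 2)
        ((E.exactAt_iff' 0 1 2 (by simp) (by simp)).1 (hE 1)) U _ h3
    have hy1 := tot U 0 1 rfl rfl y
    rw [zeroSec hM U (secMap (s 0) U y), map_zero, add_zero] at hy1
    rw [← hy1, dl U 1 0 2 rfl rfl] at hy
    have hf := congrArg (secMap (f 1 2 rfl) U) hy
    have hs := congrArg (secMap (s 1) U) hy
    rw [map_sub, map_add, fr, fr, fl, fl, add_zero, zero_sub] at hf
    rw [map_sub, map_add, sl, sl, sr, sr] at hs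
    refine ⟨-secMap (f 0 1 rfl) U y, by rw [map_neg, hf], ?_⟩
    rw [map_neg, ← sub_zero (secMap (φ.f 1) U _), hs, zero_add]
  · have h3 : secMap (E.d 2 3) U (secMap (r 2) U z) = 0 := by
      rw [dr, hz, map_zero]
    obtain ⟨V, h, hxV, y, hy⟩ : ∃ (V : Opens X) (h : V ≤ U), x ∈ V ∧
        ∃ y : VecSec (E.X 1) V, secMap (E.d 1 2) V y = vecRes (E.X 2) h (secMap (r 2) U z) :=
      exists_locally_secMap_eq_of_exact (E.sc' 1 2 3)
        ((E.exactAt_iff' 1 2 3 (by simp) (by simp)).1 (hE 2)) U _ h3 x hx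
    rw [← secMap_res, ← tot V 1 2 rfl rfl y, map_add, dl V 2 1 3 rfl rfl, dr] at hy
    have hf := congrArg (secMap (f 2 3 rfl) V) hy
    have hs := congrArg (secMap (s 2) V) hy
    rw [map_add, map_sub, fr, fr, fr, fl, add_zero, zero_sub, neg_eq_zero] at hf
    rw [map_add, map_sub, sl, sr, sr, sr, sub_zero] at hs
    exact ⟨V, h, hxV, secMap (f 1 2 rfl) V y, secMap (s 1) V y, hf, hs.symm⟩

/-- The hypercohomology of a complex is the cohomology of the global sections of an injective
resolution. -/
noncomputable def hypercohomologyIso (K : CochainComplex.Plus (TopCat.Sheaf (ModuleCat.{u} ℂ) X))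
    (L : CochainComplex.Plus (InjectiveObject (TopCat.Sheaf (ModuleCat.{u} ℂ) X)))
    (i : K ⟶ (InjectiveObject.ι _).mapCochainComplexPlus.obj L)
    (hi : CochainComplex.Plus.quasiIso _ i) (n : ℤ) :
    hypercohomology K n ≅ (((globalSections X).mapHomologicalComplex (.up ℤ)).obj
      ((InjectiveObject.ι _).mapCochainComplexPlus.obj L).obj).homology n := by
  have h1 : IsIso (DerivedCategory.Plus.Qh.map ((HomotopyCategory.Plus.quotient _).map i)) := by
    refine Localization.inverts DerivedCategory.Plus.Qh (HomotopyCategory.Plus.quasiIso _) _ ?_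
    change HomotopyCategory.quasiIso _ _ ((HomotopyCategory.quotient _ _).map i.hom)
    rw [HomotopyCategory.quotient_map_mem_quasiIso_iff]
    exact hi
  let e1 := (DerivedCategory.Plus.homologyFunctor (ModuleCat.{u} ℂ) n).mapIso
    ((globalSections X).rightDerivedFunctorPlus.mapIso
      (asIso (DerivedCategory.Plus.Qh.map ((HomotopyCategory.Plus.quotient _).map i))))
  have h2 : IsIso ((globalSections X).rightDerivedFunctorPlusUnit.app
      ((HomotopyCategory.Plus.quotient _).obj
        ((InjectiveObject.ι _).mapCochainComplexPlus.obj L))) := by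
    infer_instance
  let e2 := (DerivedCategory.Plus.homologyFunctor (ModuleCat.{u} ℂ) n).mapIso
    (asIso ((globalSections X).rightDerivedFunctorPlusUnit.app
      ((HomotopyCategory.Plus.quotient _).obj
        ((InjectiveObject.ι _).mapCochainComplexPlus.obj L))))
  let e3 : (DerivedCategory.Plus.homologyFunctor (ModuleCat.{u} ℂ) n).obj
      (((globalSections X).mapHomotopyCategoryPlus ⋙ DerivedCategory.Plus.Qh).obj
      ((HomotopyCategory.Plus.quotient _).obj
        ((InjectiveObject.ι _).mapCochainComplexPlus.obj L))) ≅ _ :=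
    (DerivedCategory.homologyFunctorFactorsh (ModuleCat.{u} ℂ) n).app
      ((HomotopyCategory.quotient _ _).obj (((globalSections X).mapHomologicalComplex (.up ℤ)).obj
      ((InjectiveObject.ι _).mapCochainComplexPlus.obj L).obj))
  let e4 := (HomotopyCategory.homologyFunctorFactors (ModuleCat.{u} ℂ) (.up ℤ) n).app
    (((globalSections X).mapHomologicalComplex (.up ℤ)).obj
      ((InjectiveObject.ι _).mapCochainComplexPlus.obj L).obj)
  exact e1 ≪≫ e2.symm ≪≫ e3 ≪≫ e4

end FilteredDeformation

/-! ### The resolution of the Hochschild complex in degrees 1, 2, 3 -/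

namespace FilteredDeformation
variable {X : TopCat.{u}}

section Trunc
variable (K : CochainComplex (TopCat.Sheaf (ModuleCat.{u} ℂ) X) ℕ)

/-- The brutal truncation agrees with `K` in the degrees `m ≥ 1`. The index `k = m - 1` is the one
of the embedding of the naturals onto the integers `≥ 1`. -/
noncomputable def brutalTruncationXIso (k m : ℕ) (n : ℤ) (hm : k + 1 = m) (hn : 1 + (k : ℤ) = n) :
    (brutalTruncation K).obj.X n ≅ K.X m :=
  HomologicalComplex.extendXIso _ (ComplexShape.embeddingUpIntGE 1) (i := k) hn ≪≫
    K.extendXIso ComplexShape.embeddingUpNat (i := m) (by simp [← hm, add_comm])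

theorem brutalTruncation_d (k m : ℕ) (n n' : ℤ) (hm : k + 1 = m) (hn : 1 + (k : ℤ) = n)
    (hn' : 1 + ((k + 1 : ℕ) : ℤ) = n') :
    (brutalTruncation K).obj.d n n' = (brutalTruncationXIso K k m n hm hn).hom ≫ K.d m (m + 1) ≫
      (brutalTruncationXIso K (k + 1) (m + 1) n' (by omega) hn').inv := by
  refine (HomologicalComplex.extend_d_eq _ (ComplexShape.embeddingUpIntGE 1) (i := k)
    (j := k + 1) hn hn').trans ?_
  have := HomologicalComplex.extend_d_eq K ComplexShape.embeddingUpNat (i := m)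
    (j := m + 1) (i' := (ComplexShape.embeddingUpIntGE 1).f k)
      (j' := (ComplexShape.embeddingUpIntGE 1).f (k + 1)) (by simp [← hm, add_comm])
      (by simp [← hm]; omega)
  rw [HomologicalComplex.restriction_d, this]
  simp [brutalTruncationXIso]
  rfl
end Trunc

/-- The part in the degrees 1, 2, 3 of a quasi-isomorphism `φ` from `σ_{≥1} C_f^•(Λ, A)` to a
complex `I` of injective sheaves starting in degree 1. Instead of the quasi-isomorphism property,
the structure records its consequences in degrees 1 and 2 for the sections of the mapping cone of `φ`,
and of the injectivity only that of `I¹`. -/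
structure HochschildResolution (Λ : FilteredAlgebraSheaf X) (A : FilteredBimoduleSheaf Λ) where
  {I₁ I₂ I₃ : TopCat.Sheaf (ModuleCat.{u} ℂ) X}
  d₁ : I₁ ⟶ I₂
  d₂ : I₂ ⟶ I₃
  φ₁ : cochainSheaf Λ A 1 ⟶ I₁
  φ₂ : cochainSheaf Λ A 2 ⟶ I₂
  φ₃ : cochainSheaf Λ A 3 ⟶ I₃
  injective : Injective I₁
  d₁_d₂ : d₁ ≫ d₂ = 0
  φ₁_d₁ : φ₁ ≫ d₁ = cochainSheafD Λ A 1 ≫ φ₂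
  φ₂_d₂ : φ₂ ≫ d₂ = cochainSheafD Λ A 2 ≫ φ₃
  /-- the sections of the cone are exact in degree 0 -/
  eq_zero : ∀ (U : Opens X) (t : filteredCochains Λ A 1 U), cochainD Λ A 1 U t = 0 →
    secMap φ₁ U t = 0 → t = 0
  /-- the sections of the cone are exact in degree 1 -/
  exists_cochain : ∀ (U : Opens X) (c : filteredCochains Λ A 2 U) (b : VecSec I₁ U),
    cochainD Λ A 2 U c = 0 → secMap φ₂ U c + secMap d₁ U b = 0 →
    ∃ t : filteredCochains Λ A 1 U, cochainD Λ A 1 U t = c ∧ secMap φ₁ U t = -b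
  /-- the sections of the cone are locally exact in degree 2, for cocycles coming from `I²` -/
  exists_locally : ∀ (U : Opens X) (z : VecSec I₂ U), secMap d₂ U z = 0 → ∀ x ∈ U,
    ∃ (V : Opens X) (h : V ≤ U), x ∈ V ∧ ∃ (c : filteredCochains Λ A 2 V) (b : VecSec I₁ V),
      cochainD Λ A 2 V c = 0 ∧ vecRes I₂ h z = secMap φ₂ V c + secMap d₁ V b

/-- A resolution by injective sheaves exists, and `ℍ²` is the space of closed global sections of
`I²` modulo the differentials of global sections of `I¹`. -/
theorem exists_hochschildResolution (Λ : FilteredAlgebraSheaf X) (A : FilteredBimoduleSheaf Λ) :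
    ∃ (R : HochschildResolution Λ A) (π : LinearMap.ker (secMap R.d₂ ⊤) →ₗ[ℂ]
      hypercohomology (brutalTruncation (hochschildComplex Λ A)) 2), Function.Surjective π ∧
      ∀ z, π z = 0 ↔ ∃ β, secMap R.d₁ ⊤ β = z.1 := by
  let K := brutalTruncation (hochschildComplex Λ A)
  have : K.obj.IsStrictlyGE 1 := inferInstanceAs (HomologicalComplex.IsStrictlySupported
    (HomologicalComplex.stupidTrunc _ _) (ComplexShape.embeddingUpIntGE 1))
  obtain ⟨L, hL, i, hi⟩ := CochainComplex.Plus.exists_quasiIso_injective K 1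
  let M := ((InjectiveObject.ι _).mapCochainComplexPlus.obj L).obj
  have hM : M.IsStrictlyGE 1 :=
    (CochainComplex.isStrictlyGE_mapHomologicalComplex_obj_iff _ _ _).2 hL
  let φ : K.obj ⟶ M := i.hom
  have hφ : QuasiIso φ := hi
  obtain ⟨H1, H2, H3⟩ := quasiIso_sections φ (K.obj.isZero_of_isStrictlyGE 1 0)
    (M.isZero_of_isStrictlyGE 1 0) (M.isZero_of_isStrictlyGE 1 (-1))
  let e₁ : cochainSheaf Λ A 1 ≅ K.obj.X 1 :=
    (brutalTruncationXIso (hochschildComplex Λ A) 0 1 1 rfl rfl).symm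
  let e₂ : cochainSheaf Λ A 2 ≅ K.obj.X 2 :=
    (brutalTruncationXIso (hochschildComplex Λ A) 1 2 2 rfl rfl).symm
  let e₃ : cochainSheaf Λ A 3 ≅ K.obj.X 3 :=
    (brutalTruncationXIso (hochschildComplex Λ A) 2 3 3 rfl rfl).symm
  have D₁ : e₁.hom ≫ K.obj.d 1 2 = cochainSheafD Λ A 1 ≫ e₂.hom := by
    have h1 : (hochschildComplex Λ A).d 1 2 = cochainSheafD Λ A 1 :=
      CochainComplex.of_d (cochainSheaf Λ A) (cochainSheafD Λ A) 1
    have := brutalTruncation_d (hochschildComplex Λ A) 0 1 1 2 rfl rfl rfl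
    rw [h1] at this
    exact (congrArg (e₁.hom ≫ ·) this).trans (e₁.symm.inv_hom_id_assoc _)
  have D₂ : e₂.hom ≫ K.obj.d 2 3 = cochainSheafD Λ A 2 ≫ e₃.hom := by
    have h1 : (hochschildComplex Λ A).d 2 3 = cochainSheafD Λ A 2 :=
      CochainComplex.of_d (cochainSheaf Λ A) (cochainSheafD Λ A) 2
    have := brutalTruncation_d (hochschildComplex Λ A) 1 2 2 3 rfl rfl rfl
    rw [h1] at this
    exact (congrArg (e₂.hom ≫ ·) this).trans (e₂.symm.inv_hom_id_assoc _)
  have app : ∀ {A B : TopCat.Sheaf (ModuleCat.{u} ℂ) X} {f g : A ⟶ B} (_ : f = g) (U : Opens X)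
      (x : VecSec A U), secMap f U x = secMap g U x := fun h U x => by rw [h]
  have D₁' (U : Opens X) (t : filteredCochains Λ A 1 U) : secMap (K.obj.d 1 2) U
      (secMap e₁.hom U t) = secMap e₂.hom U (cochainD Λ A 1 U t) := app D₁ U t
  have D₂' (U : Opens X) (t : filteredCochains Λ A 2 U) : secMap (K.obj.d 2 3) U
      (secMap e₂.hom U t) = secMap e₃.hom U (cochainD Λ A 2 U t) := app D₂ U t
  let R : HochschildResolution Λ A :=
    { I₁ := M.X 1
      I₂ := M.X 2
      I₃ := M.X 3
      d₁ := M.d 1 2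
      d₂ := M.d 2 3
      φ₁ := e₁.hom ≫ φ.f 1
      φ₂ := e₂.hom ≫ φ.f 2
      φ₃ := e₃.hom ≫ φ.f 3
      injective := (L.obj.X 1).property
      d₁_d₂ := M.d_comp_d 1 2 3
      φ₁_d₁ := by
        rw [Category.assoc, φ.comm, ← Category.assoc, D₁, Category.assoc]
      φ₂_d₂ := by
        rw [Category.assoc, φ.comm, ← Category.assoc, D₂, Category.assoc]
      eq_zero := fun U t h h' => secMap_injective e₁.hom U ((H1 U (secMap e₁.hom U t)
        ((D₁' U t).trans ((congrArg _ h).trans (map_zero (secMap e₂.hom U)))) h').trans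
          (map_zero _).symm)
      exists_cochain := fun U c b h h' => by
        obtain ⟨t, ht, ht'⟩ := H2 U (secMap e₂.hom U c) b
          ((D₂' U c).trans ((congrArg _ h).trans (map_zero (secMap e₃.hom U)))) h'
        have ht1 : secMap e₁.hom U (secMap e₁.inv U t) = t := app e₁.inv_hom_id U t
        refine ⟨secMap e₁.inv U t, secMap_injective e₂.hom U ((D₁' U _).symm.trans ?_), ?_⟩
        · exact (congrArg _ ht1).trans ht
        · exact (congrArg (secMap (φ.f 1) U) ht1).trans ht'
      exists_locally := fun U z hz x hx => by
        obtain ⟨V, h, hxV, c, b, hc, hz'⟩ := H3 U z hz x hx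
        have hc1 : secMap e₂.hom V (secMap e₂.inv V c) = c := app e₂.inv_hom_id V c
        refine ⟨V, h, hxV, secMap e₂.inv V c, b,
          secMap_injective e₃.hom V ((D₂' V _).symm.trans ?_), ?_⟩
        · exact (congrArg _ hc1).trans (hc.trans (map_zero (secMap e₃.hom V)).symm)
        · exact hz'.trans (congrArg (fun y => secMap (φ.f 2) V y + _) hc1.symm) }
  obtain ⟨π, h1, h2⟩ := exists_linearMap_homology
    ((((globalSections X).mapHomologicalComplex (.up ℤ)).obj M).sc' 1 2 3)
    (hypercohomology K 2) (hypercohomologyIso K L i hi 2 ≪≫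
      HomologicalComplex.homologyIsoSc' _ 1 2 3 (by simp) (by simp))
  exact ⟨R, π, h1, h2⟩

end FilteredDeformation

namespace FilteredDeformation
variable {X : TopCat.{u}}

/-! ### Gluing of sections -/

section Gluing

theorem vec_ext_locally (F : TopCat.Sheaf (ModuleCat.{u} ℂ) X) (V : Opens X) (s t : VecSec F V)
    (h : ∀ x ∈ V, ∃ (W : Opens X) (hW : W ≤ V), x ∈ W ∧ vecRes F hW s = vecRes F hW t) :
    s = t := by
  choose W hW hx hst using fun x : V => h x.1 x.2
  exact vec_ext F W V hW (fun x hxV => Opens.mem_iSup.2 ⟨⟨x, hxV⟩, hx ⟨x, hxV⟩⟩) s t hst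

theorem alg_ext_locally (F : TopCat.Sheaf (AlgCat.{u} ℂ) X) (V : Opens X) (s t : AlgSec F V)
    (h : ∀ x ∈ V, ∃ (W : Opens X) (hW : W ≤ V), x ∈ W ∧ algRes F hW s = algRes F hW t) :
    s = t := by
  choose W hW hx hst using fun x : V => h x.1 x.2
  refine (alg_glue F W V hW (fun x hxV => Opens.mem_iSup.2 ⟨⟨x, hxV⟩, hx ⟨x, hxV⟩⟩)
    (fun i => algRes F (hW i) t) fun i j T hi hj => ?_).unique hst fun _ => rfl
  rw [algRes_algRes, algRes_algRes]

/-- A section that is characterized by a local property `P`, and exists locally, exists globally. -/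
theorem vec_exists_of_locally (F : TopCat.Sheaf (ModuleCat.{u} ℂ) X) (V : Opens X)
    (P : ∀ W : Opens X, W ≤ V → VecSec F W → Prop)
    (hres : ∀ (W W' : Opens X) (hW : W ≤ V) (h : W' ≤ W) (s : VecSec F W), P W hW s →
      P W' (h.trans hW) (vecRes F h s))
    (huniq : ∀ (W : Opens X) (hW : W ≤ V) (s s' : VecSec F W), P W hW s → P W hW s' → s = s')
    (hloc : ∀ x ∈ V, ∃ (W : Opens X) (hW : W ≤ V), x ∈ W ∧ ∃ s, P W hW s) :
    ∃ t : VecSec F V, ∀ (W : Opens X) (hW : W ≤ V) (s : VecSec F W), P W hW s →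
      vecRes F hW t = s := by
  choose W hW hx s hs using fun x : V => hloc x.1 x.2
  obtain ⟨t, ht, -⟩ := vec_glue F W V hW
    (fun x hxV => Opens.mem_iSup.2 ⟨⟨x, hxV⟩, hx ⟨x, hxV⟩⟩) s
    fun i j T hi hj => huniq T (hi.trans (hW i)) _ _ (hres _ _ _ hi _ (hs i))
      (hres _ _ _ hj _ (hs j))
  refine ⟨t, fun W' hW' s' hs' => vec_ext_locally F _ _ _ fun x hxW => ?_⟩
  refine ⟨W' ⊓ W ⟨x, hW' hxW⟩, inf_le_left, ⟨hxW, hx _⟩, ?_⟩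
  have h1 := congrArg (vecRes F (inf_le_right : W' ⊓ W ⟨x, hW' hxW⟩ ≤ _)) (ht ⟨x, hW' hxW⟩)
  rw [vecRes_vecRes] at h1 ⊢
  rw [h1]
  exact huniq _ (inf_le_left.trans hW') _ _ (hres _ _ _ inf_le_right _ (hs _))
    (hres _ _ _ inf_le_left _ hs')

/-- A section that is characterized by a local property `P`, and exists locally, exists globally. -/
theorem alg_exists_of_locally (F : TopCat.Sheaf (AlgCat.{u} ℂ) X) (V : Opens X)
    (P : ∀ W : Opens X, W ≤ V → AlgSec F W → Prop)
    (hres : ∀ (W W' : Opens X) (hW : W ≤ V) (h : W' ≤ W) (s : AlgSec F W), P W hW s →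
      P W' (h.trans hW) (algRes F h s))
    (huniq : ∀ (W : Opens X) (hW : W ≤ V) (s s' : AlgSec F W), P W hW s → P W hW s' → s = s')
    (hloc : ∀ x ∈ V, ∃ (W : Opens X) (hW : W ≤ V), x ∈ W ∧ ∃ s, P W hW s) :
    ∃ t : AlgSec F V, ∀ (W : Opens X) (hW : W ≤ V) (s : AlgSec F W), P W hW s →
      algRes F hW t = s := by
  choose W hW hx s hs using fun x : V => hloc x.1 x.2
  obtain ⟨t, ht, -⟩ := alg_glue F W V hW
    (fun x hxV => Opens.mem_iSup.2 ⟨⟨x, hxV⟩, hx ⟨x, hxV⟩⟩) s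
    fun i j T hi hj => huniq T (hi.trans (hW i)) _ _ (hres _ _ _ hi _ (hs i))
      (hres _ _ _ hj _ (hs j))
  refine ⟨t, fun W' hW' s' hs' => alg_ext_locally F _ _ _ fun x hxW => ?_⟩
  refine ⟨W' ⊓ W ⟨x, hW' hxW⟩, inf_le_left, ⟨hxW, hx _⟩, ?_⟩
  have h1 := congrArg (algRes F (inf_le_right : W' ⊓ W ⟨x, hW' hxW⟩ ≤ _)) (ht ⟨x, hW' hxW⟩)
  rw [algRes_algRes] at h1 ⊢
  rw [h1]
  exact huniq _ (inf_le_left.trans hW') _ _ (hres _ _ _ inf_le_right _ (hs _))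
    (hres _ _ _ inf_le_left _ hs')

end Gluing

/-! ### Cochains of degree 1 and 2 -/

section LowDegree

open scoped RightActions

variable {Λ : FilteredAlgebraSheaf X} {A : FilteredBimoduleSheaf Λ} {U : Opens X}

/-- The linear map `Λ(V) → A(V)` given by a 1-cochain. -/
def ev₁ (t : filteredCochains Λ A 1 U) (V : Opens X) (hV : V ≤ U) : Λ.Sec V →ₗ[ℂ] A.Sec V :=
  (MultilinearMap.ofSubsingleton ℂ (Λ.Sec V) (A.Sec V) (0 : Fin 1)).symm (t.1 ⟨V, hV⟩)

theorem ev₁_apply (t : filteredCochains Λ A 1 U) (V : Opens X) (hV : V ≤ U) (l : Λ.Sec V) :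
    ev₁ t V hV l = t.1 ⟨V, hV⟩ fun _ => l := rfl

theorem ev₁_ext {t t' : filteredCochains Λ A 1 U}
    (h : ∀ (V : Opens X) (hV : V ≤ U) (l : Λ.Sec V), ev₁ t V hV l = ev₁ t' V hV l) : t = t' := by
  refine Subtype.ext (funext fun V => MultilinearMap.ext fun a => ?_)
  have := h V.1 V.2 (a 0)
  have e : (fun _ : Fin 1 => a 0) = a := by ext k; rw [Subsingleton.elim k 0]
  rwa [ev₁_apply, ev₁_apply, e] at this

theorem ev₁_add (t t' : filteredCochains Λ A 1 U) (V : Opens X) (hV : V ≤ U) (l : Λ.Sec V) :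
    ev₁ (t + t') V hV l = ev₁ t V hV l + ev₁ t' V hV l := rfl

theorem ev₁_zero (V : Opens X) (hV : V ≤ U) (l : Λ.Sec V) :
    ev₁ (0 : filteredCochains Λ A 1 U) V hV l = 0 := rfl

theorem ev₁_smul (c : ℂ) (t : filteredCochains Λ A 1 U) (V : Opens X) (hV : V ≤ U)
    (l : Λ.Sec V) : ev₁ (c • t) V hV l = c • ev₁ t V hV l := rfl

theorem ev₁_restrict (t : filteredCochains Λ A 1 U) {W : Opens X} (h : W ≤ U) (V : Opens X)
    (hV : V ≤ W) (l : Λ.Sec V) :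
    ev₁ (restrictCochain Λ A 1 h t) V hV l = ev₁ t V (hV.trans h) l := rfl

theorem res_ev₁ (t : filteredCochains Λ A 1 U) {V W : Opens X} (hV : V ≤ U) (h : W ≤ V)
    (l : Λ.Sec V) : A.res h (ev₁ t V hV l) = ev₁ t W (h.trans hV) (Λ.res h l) :=
  t.2.1 ⟨V, hV⟩ ⟨W, h.trans hV⟩ h fun _ => l

theorem ev₁_mem (t : filteredCochains Λ A 1 U) {V : Opens X} (hV : V ≤ U) (n : ℕ)
    (l : Λ.Sec V) (hl : l ∈ Λ.fil n V) : ev₁ t V hV l ∈ A.fil n V := by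
  have := t.2.2 ⟨V, hV⟩ (fun _ => n) (fun _ => l) fun _ => hl
  rw [Fin.sum_univ_one] at this
  exact this

/-- The 1-cochain given by linear maps `Λ(V) → A(V)`. -/
def mkCochain₁ (τ : ∀ V : Opens X, V ≤ U → (Λ.Sec V →ₗ[ℂ] A.Sec V))
    (hres : ∀ (V W : Opens X) (hV : V ≤ U) (h : W ≤ V) (l : Λ.Sec V),
      A.res h (τ V hV l) = τ W (h.trans hV) (Λ.res h l))
    (hmem : ∀ (n : ℕ) (V : Opens X) (hV : V ≤ U) (l : Λ.Sec V), l ∈ Λ.fil n V →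
      τ V hV l ∈ A.fil n V) : filteredCochains Λ A 1 U :=
  ⟨fun V => MultilinearMap.ofSubsingleton ℂ (Λ.Sec V) (A.Sec V) (0 : Fin 1) (τ V.1 V.2),
    fun V W h a => hres V.1 W.1 V.2 h (a 0),
    fun V d a ha => by simpa using hmem (d 0) V.1 V.2 (a 0) (ha 0)⟩

theorem ev₁_mkCochain₁ (τ : ∀ V : Opens X, V ≤ U → (Λ.Sec V →ₗ[ℂ] A.Sec V)) (hres) (hmem)
    (V : Opens X) (hV : V ≤ U) (l : Λ.Sec V) :
    ev₁ (mkCochain₁ τ hres hmem) V hV l = τ V hV l := rfl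

theorem update_pair_zero {R : Type*} (a b x : R) :
    Function.update (![a, b] : Fin 2 → R) 0 x = ![x, b] := by
  ext k; fin_cases k <;> simp

theorem update_pair_one {R : Type*} (a b x : R) :
    Function.update (![a, b] : Fin 2 → R) 1 x = ![a, x] := by
  ext k; fin_cases k <;> simp

/-- The bilinear map `Λ(V) × Λ(V) → A(V)` given by a 2-cochain. -/
def ev₂ (c : filteredCochains Λ A 2 U) (V : Opens X) (hV : V ≤ U) :
    Λ.Sec V →ₗ[ℂ] Λ.Sec V →ₗ[ℂ] A.Sec V :=
  LinearMap.mk₂ ℂ (fun l l' => c.1 ⟨V, hV⟩ ![l, l'])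
    (fun x y l => by
      simpa only [update_pair_zero] using (c.1 ⟨V, hV⟩).map_update_add ![x, l] 0 x y)
    (fun r x l => by
      simpa only [update_pair_zero] using (c.1 ⟨V, hV⟩).map_update_smul ![x, l] 0 r x)
    (fun l x y => by
      simpa only [update_pair_one] using (c.1 ⟨V, hV⟩).map_update_add ![l, x] 1 x y)
    (fun r l x => by
      simpa only [update_pair_one] using (c.1 ⟨V, hV⟩).map_update_smul ![l, x] 1 r x)

theorem ev₂_apply (c : filteredCochains Λ A 2 U) (V : Opens X) (hV : V ≤ U) (l l' : Λ.Sec V) :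
    ev₂ c V hV l l' = c.1 ⟨V, hV⟩ ![l, l'] := rfl

theorem ev₂_ext {c c' : filteredCochains Λ A 2 U}
    (h : ∀ (V : Opens X) (hV : V ≤ U) (l l' : Λ.Sec V), ev₂ c V hV l l' = ev₂ c' V hV l l') :
    c = c' := by
  refine Subtype.ext (funext fun V => MultilinearMap.ext fun a => ?_)
  have := h V.1 V.2 (a 0) (a 1)
  have e : ![a 0, a 1] = a := by ext k; fin_cases k <;> rfl
  rwa [ev₂_apply, ev₂_apply, e] at this

theorem ev₂_add (t t' : filteredCochains Λ A 2 U) (V : Opens X) (hV : V ≤ U) (l l' : Λ.Sec V) :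
    ev₂ (t + t') V hV l l' = ev₂ t V hV l l' + ev₂ t' V hV l l' := rfl

theorem ev₂_smul (c : ℂ) (t : filteredCochains Λ A 2 U) (V : Opens X) (hV : V ≤ U)
    (l l' : Λ.Sec V) : ev₂ (c • t) V hV l l' = c • ev₂ t V hV l l' := rfl

theorem ev₂_restrict (t : filteredCochains Λ A 2 U) {W : Opens X} (h : W ≤ U) (V : Opens X)
    (hV : V ≤ W) (l l' : Λ.Sec V) :
    ev₂ (restrictCochain Λ A 2 h t) V hV l l' = ev₂ t V (hV.trans h) l l' := rfl

theorem res_ev₂ (c : filteredCochains Λ A 2 U) {V W : Opens X} (hV : V ≤ U) (h : W ≤ V)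
    (l l' : Λ.Sec V) :
    A.res h (ev₂ c V hV l l') = ev₂ c W (h.trans hV) (Λ.res h l) (Λ.res h l') := by
  refine (c.2.1 ⟨V, hV⟩ ⟨W, h.trans hV⟩ h ![l, l']).trans ?_
  rw [ev₂_apply]
  congr 1
  ext k
  fin_cases k <;> rfl

theorem ev₂_mem (c : filteredCochains Λ A 2 U) {V : Opens X} (hV : V ≤ U) (m n : ℕ)
    (l l' : Λ.Sec V) (hl : l ∈ Λ.fil m V) (hl' : l' ∈ Λ.fil n V) :
    ev₂ c V hV l l' ∈ A.fil (m + n) V := by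
  have := c.2.2 ⟨V, hV⟩ ![m, n] ![l, l'] fun k => by fin_cases k <;> assumption
  rw [Fin.sum_univ_two] at this
  exact this

/-- The 2-cochain given by bilinear maps `Λ(V) × Λ(V) → A(V)`. -/
def mkCochain₂ (τ : ∀ V : Opens X, V ≤ U → (Λ.Sec V →ₗ[ℂ] Λ.Sec V →ₗ[ℂ] A.Sec V))
    (hres : ∀ (V W : Opens X) (hV : V ≤ U) (h : W ≤ V) (l l' : Λ.Sec V),
      A.res h (τ V hV l l') = τ W (h.trans hV) (Λ.res h l) (Λ.res h l'))
    (hmem : ∀ (m n : ℕ) (V : Opens X) (hV : V ≤ U) (l l' : Λ.Sec V), l ∈ Λ.fil m V →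
      l' ∈ Λ.fil n V → τ V hV l l' ∈ A.fil (m + n) V) : filteredCochains Λ A 2 U :=
  ⟨fun V => MultilinearMap.mk' (fun a => τ V.1 V.2 (a 0) (a 1))
      (fun a k x y => by fin_cases k <;> simp)
      (fun a k c x => by fin_cases k <;> simp),
    fun V W h a => hres V.1 W.1 V.2 h (a 0) (a 1),
    fun V d a ha => by
      rw [Fin.sum_univ_two]
      exact hmem _ _ V.1 V.2 _ _ (ha 0) (ha 1)⟩

/-- The differential of a 1-cochain: `(d t)(l, l') = l t(l') - t(l l') + t(l) l'`. -/
theorem ev₂_cochainD (t : filteredCochains Λ A 1 U) (V : Opens X) (hV : V ≤ U)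
    (l l' : Λ.Sec V) : ev₂ (cochainD Λ A 1 U t) V hV l l' =
      l • ev₁ t V hV l' - ev₁ t V hV (l * l') + ev₁ t V hV l <• l' := by
  have h1 := hochschildD_apply 1 (t.1 ⟨V, hV⟩) ![l, l']
  refine h1.trans ?_
  have e1 : (Fin.tail ![l, l'] : Fin 1 → Λ.Sec V) = fun _ => l' := by
    ext k; rw [Subsingleton.elim k 0]; rfl
  have e2 : (Fin.init ![l, l'] : Fin 1 → Λ.Sec V) = fun _ => l := by
    ext k; rw [Subsingleton.elim k 0]; rfl
  have e3 : (Fin.contractNth (Fin.castSucc (0 : Fin 1)) (· * ·) ![l, l'] : Fin 1 → Λ.Sec V) =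
      fun _ => l * l' := by
    ext k; rw [Subsingleton.elim k 0]; rfl
  rw [Fin.sum_univ_one, e1, e2, e3]
  simp only [ev₁_apply]
  simp [sub_eq_add_neg]

/-- The cocycle condition in degree 2, as an associativity law. -/
theorem cochainD_two_eq_zero_iff (c : filteredCochains Λ A 2 U) :
    cochainD Λ A 2 U c = 0 ↔ ∀ (V : Opens X) (hV : V ≤ U) (a b e : Λ.Sec V),
      a • ev₂ c V hV b e + ev₂ c V hV a (b * e) =
        ev₂ c V hV (a * b) e + ev₂ c V hV a b <• e := by
  have key : ∀ (V : Opens X) (hV : V ≤ U) (a b e : Λ.Sec V),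
      (cochainD Λ A 2 U c).1 ⟨V, hV⟩ ![a, b, e] = a • ev₂ c V hV b e + ev₂ c V hV a (b * e) -
        (ev₂ c V hV (a * b) e + ev₂ c V hV a b <• e) := by
    intro V hV a b e
    refine (hochschildD_apply 2 (c.1 ⟨V, hV⟩) ![a, b, e]).trans ?_
    have e1 : (Fin.tail ![a, b, e] : Fin 2 → Λ.Sec V) = ![b, e] := rfl
    have e2 : (Fin.init ![a, b, e] : Fin 2 → Λ.Sec V) = ![a, b] := by
      ext k; fin_cases k <;> rfl
    have e3 : (Fin.contractNth (Fin.castSucc (0 : Fin 2)) (· * ·) ![a, b, e] : Fin 2 → Λ.Sec V) =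
        ![a * b, e] := by
      ext k; fin_cases k <;> rfl
    have e4 : (Fin.contractNth (Fin.castSucc (1 : Fin 2)) (· * ·) ![a, b, e] : Fin 2 → Λ.Sec V) =
        ![a, b * e] := by
      ext k; fin_cases k <;> rfl
    have e5 : (![a, b, e] : Fin 3 → Λ.Sec V) (Fin.last 2) = e := rfl
    have e6 : (![a, b, e] : Fin 3 → Λ.Sec V) 0 = a := rfl
    rw [Fin.sum_univ_two, e1, e2, e3, e4, e5, e6]
    simp only [ev₂_apply]
    simp [show (-1 : ℂ) ^ 3 = -1 by norm_num]
    abel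
  constructor
  · intro h V hV a b e
    rw [← sub_eq_zero, ← key, h]
    rfl
  · intro h
    refine Subtype.ext (funext fun V => MultilinearMap.ext fun a => ?_)
    have e : ![a 0, a 1, a 2] = a := by ext k; fin_cases k <;> rfl
    have := key V.1 V.2 (a 0) (a 1) (a 2)
    rw [e] at this
    refine this.trans (sub_eq_zero.2 (h _ _ _ _ _))

theorem restrictCochain_cochainD (n : ℕ) {V : Opens X} (h : V ≤ U)
    (f : filteredCochains Λ A n U) : restrictCochain Λ A (n + 1) h (cochainD Λ A n U f) =
      cochainD Λ A n V (restrictCochain Λ A n h f) := rfl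

end LowDegree

end FilteredDeformation

/-! ### Linear splittings of an extension -/

namespace FilteredDeformation
variable {X : TopCat.{u}}

namespace FilteredExtension

open scoped RightActions

variable {Λ : FilteredAlgebraSheaf X} {A : FilteredBimoduleSheaf Λ} (ξ : FilteredExtension Λ A)

theorem p_i (U : Opens X) (a : A.Sec U) : ξ.p U (ξ.i U a) = 0 :=
  (ξ.exact U _).2 ⟨a, rfl⟩

/-- The factorization through `i` of a linear map with values in `ker p`. -/
noncomputable def liftKer {M : Type*} [AddCommGroup M] [Module ℂ M] (U : Opens X)
    (f : M →ₗ[ℂ] ξ.Γ.Sec U) (hf : ∀ x, ξ.p U (f x) = 0) : M →ₗ[ℂ] A.Sec U :=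
  (LinearEquiv.ofInjective (ξ.i U) (ξ.i_injective U)).symm.toLinearMap ∘ₗ
    f.codRestrict (LinearMap.range (ξ.i U)) fun x => (ξ.exact U _).1 (hf x)

theorem i_liftKer {M : Type*} [AddCommGroup M] [Module ℂ M] (U : Opens X)
    (f : M →ₗ[ℂ] ξ.Γ.Sec U) (hf : ∀ x, ξ.p U (f x) = 0) (x : M) :
    ξ.i U (ξ.liftKer U f hf x) = f x :=
  congrArg Subtype.val ((LinearEquiv.ofInjective (ξ.i U) (ξ.i_injective U)).apply_symm_apply
    (f.codRestrict (LinearMap.range (ξ.i U)) (fun x => (ξ.exact U _).1 (hf x)) x))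

namespace LinearSplitting

variable {ξ} {U : Opens X}

@[ext]
theorem ext' {J J' : ξ.LinearSplitting U}
    (h : ∀ (V : Opens X) (hV : V ≤ U) (l : Λ.Sec V), J.j V hV l = J'.j V hV l) : J = J' := by
  cases J
  cases J'
  congr
  exact funext fun V => funext fun hV => LinearMap.ext (h V hV)

/-- Restriction of a linear splitting to a smaller open set. -/
def restrict (J : ξ.LinearSplitting U) {V : Opens X} (h : V ≤ U) : ξ.LinearSplitting V where
  j W hW := J.j W (hW.trans h)
  j_res W W' hW h' l := J.j_res W W' (hW.trans h) h' l
  p_j W hW l := J.p_j W (hW.trans h) l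
  j_mem n W hW l hl := J.j_mem n W (hW.trans h) l hl

/-- The splitting `j + i t`, for a 1-cochain `t`. -/
def add (J : ξ.LinearSplitting U) (t : filteredCochains Λ A 1 U) : ξ.LinearSplitting U where
  j V hV := J.j V hV + ξ.i V ∘ₗ ev₁ t V hV
  j_res V W hV h l := by
    simp only [LinearMap.add_apply, LinearMap.comp_apply, map_add]
    rw [J.j_res V W hV h, ← res_ev₁ t hV h, ξ.i_res]
  p_j V hV l := by
    simp only [LinearMap.add_apply, LinearMap.comp_apply, map_add]
    rw [J.p_j, ξ.p_i, add_zero]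
  j_mem n V hV l hl :=
    add_mem (J.j_mem n V hV l hl) ((ξ.i_mem_iff _ _ _).2 (ev₁_mem t hV n l hl))

theorem add_j (J : ξ.LinearSplitting U) (t : filteredCochains Λ A 1 U) (V : Opens X) (hV : V ≤ U)
    (l : Λ.Sec V) : (J.add t).j V hV l = J.j V hV l + ξ.i V (ev₁ t V hV l) := rfl

/-- The 1-cochain `t` with `j' = j + i t`. -/
noncomputable def diff (J J' : ξ.LinearSplitting U) : filteredCochains Λ A 1 U :=
  have hp : ∀ (V : Opens X) (hV : V ≤ U) (l : Λ.Sec V),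
      ξ.p V ((J'.j V hV - J.j V hV) l) = 0 := fun V hV l => by
    rw [LinearMap.sub_apply, map_sub, J.p_j, J'.p_j, sub_self]
  mkCochain₁ (fun V hV => ξ.liftKer V (J'.j V hV - J.j V hV) (hp V hV))
    (fun V W hV h l => ξ.i_injective W (by
      rw [ξ.i_res, i_liftKer, i_liftKer, LinearMap.sub_apply, LinearMap.sub_apply, map_sub,
        J.j_res V W hV h, J'.j_res V W hV h]))
    (fun n V hV l hl => by
      rw [← ξ.i_mem_iff, i_liftKer]
      exact sub_mem (J'.j_mem n V hV l hl) (J.j_mem n V hV l hl))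

theorem i_diff (J J' : ξ.LinearSplitting U) (V : Opens X) (hV : V ≤ U) (l : Λ.Sec V) :
    ξ.i V (ev₁ (J.diff J') V hV l) = J'.j V hV l - J.j V hV l := by
  rw [diff, ev₁_mkCochain₁, i_liftKer, LinearMap.sub_apply]

theorem add_diff (J J' : ξ.LinearSplitting U) : J.add (J.diff J') = J' :=
  ext' fun V hV l => by rw [add_j, i_diff, add_sub_cancel]

theorem exists_eq_add (J J' : ξ.LinearSplitting U) : ∃ t, J' = J.add t :=
  ⟨J.diff J', (add_diff J J').symm⟩

/-- The retraction `r : Γ → A` of `i` corresponding to a splitting, i.e. `i r = 1 - j p`. -/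
noncomputable def retr (J : ξ.LinearSplitting U) (V : Opens X) (hV : V ≤ U) :
    ξ.Γ.Sec V →ₗ[ℂ] A.Sec V :=
  ξ.liftKer V (LinearMap.id - J.j V hV ∘ₗ (ξ.p V).toLinearMap) fun g => by
    simp only [LinearMap.sub_apply, LinearMap.comp_apply, map_sub, LinearMap.id_apply,
      AlgHom.toLinearMap_apply]
    rw [J.p_j, sub_self]

theorem i_retr (J : ξ.LinearSplitting U) (V : Opens X) (hV : V ≤ U) (g : ξ.Γ.Sec V) :
    ξ.i V (J.retr V hV g) = g - J.j V hV (ξ.p V g) := by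
  rw [retr, i_liftKer]
  rfl

theorem retr_i (J : ξ.LinearSplitting U) (V : Opens X) (hV : V ≤ U) (a : A.Sec V) :
    J.retr V hV (ξ.i V a) = a :=
  ξ.i_injective V (by rw [i_retr, ξ.p_i, map_zero, sub_zero])

theorem res_retr (J : ξ.LinearSplitting U) {V W : Opens X} (hV : V ≤ U) (h : W ≤ V)
    (g : ξ.Γ.Sec V) : A.res h (J.retr V hV g) = J.retr W (h.trans hV) (ξ.Γ.res h g) :=
  ξ.i_injective W (by
    rw [ξ.i_res, i_retr, i_retr, map_sub, ξ.p_res, J.j_res V W hV h])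

theorem retr_mem (J : ξ.LinearSplitting U) (n : ℕ) (V : Opens X) (hV : V ≤ U) (g : ξ.Γ.Sec V)
    (hg : g ∈ ξ.Γ.fil n V) : J.retr V hV g ∈ A.fil n V := by
  rw [← ξ.i_mem_iff, i_retr]
  exact sub_mem hg (J.j_mem n V hV _ (ξ.p_mem _ _ _ hg))

theorem retr_add (J : ξ.LinearSplitting U) (t : filteredCochains Λ A 1 U) (V : Opens X)
    (hV : V ≤ U) (g : ξ.Γ.Sec V) :
    (J.add t).retr V hV g = J.retr V hV g - ev₁ t V hV (ξ.p V g) :=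
  ξ.i_injective V (by rw [i_retr, map_sub, i_retr, add_j]; abel)

theorem exists_curv (J : ξ.LinearSplitting U) (V : Opens X) (hV : V ≤ U) (l l' : Λ.Sec V) :
    ∃ a, ξ.i V a = J.j V hV l * J.j V hV l' - J.j V hV (l * l') :=
  (ξ.exact V _).1 (by rw [map_sub, map_mul, J.p_j, J.p_j, J.p_j, sub_self])

/-- The values of the curvature of a linear splitting. -/
noncomputable def curvFun (J : ξ.LinearSplitting U) (V : Opens X) (hV : V ≤ U)
    (l l' : Λ.Sec V) : A.Sec V :=
  (J.exists_curv V hV l l').choose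

theorem i_curvFun (J : ξ.LinearSplitting U) (V : Opens X) (hV : V ≤ U) (l l' : Λ.Sec V) :
    ξ.i V (J.curvFun V hV l l') = J.j V hV l * J.j V hV l' - J.j V hV (l * l') :=
  (J.exists_curv V hV l l').choose_spec

/-- The curvature of a linear splitting `j`: the 2-cochain `c` with
`i c(l, l') = j(l) j(l') - j(l l')`. -/
noncomputable def curv (J : ξ.LinearSplitting U) : filteredCochains Λ A 2 U :=
  have h0 := J.i_curvFun
  mkCochain₂ (fun V hV => LinearMap.mk₂ ℂ (J.curvFun V hV)
      (fun x y l => ξ.i_injective V (by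
        rw [map_add, h0, h0, h0, map_add, add_mul, add_mul, map_add]; abel))
      (fun r x l => ξ.i_injective V (by
        rw [map_smul, h0, h0, map_smul, smul_mul_assoc, smul_mul_assoc, map_smul, smul_sub]))
      (fun l x y => ξ.i_injective V (by
        rw [map_add, h0, h0, h0, map_add, mul_add, mul_add, map_add]; abel))
      (fun r l x => ξ.i_injective V (by
        rw [map_smul, h0, h0, map_smul, mul_smul_comm, mul_smul_comm, map_smul, smul_sub])))
    (fun V W hV h l l' => ξ.i_injective W (by
      simp only [LinearMap.mk₂_apply]
      rw [ξ.i_res, h0, h0, map_sub, ← J.j_res V W hV h (l * l'), map_mul (ξ.Γ.res h),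
        ← J.j_res V W hV h l, ← J.j_res V W hV h l', map_mul (Λ.res h)]))
    (fun m n V hV l l' hl hl' => by
      simp only [LinearMap.mk₂_apply]
      rw [← ξ.i_mem_iff, h0]
      exact sub_mem (ξ.Γ.mul_mem _ _ _ _ _ (J.j_mem _ _ _ _ hl) (J.j_mem _ _ _ _ hl'))
        (J.j_mem _ _ _ _ (Λ.mul_mem _ _ _ _ _ hl hl')))

theorem i_curv (J : ξ.LinearSplitting U) (V : Opens X) (hV : V ≤ U) (l l' : Λ.Sec V) :
    ξ.i V (ev₂ J.curv V hV l l') = J.j V hV l * J.j V hV l' - J.j V hV (l * l') :=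
  J.i_curvFun V hV l l'

theorem curv_eq (J : ξ.LinearSplitting U) (c : filteredCochains Λ A 2 U)
    (h : ∀ (V : Opens X) (hV : V ≤ U) (l l' : Λ.Sec V),
      ξ.i V (ev₂ c V hV l l') = J.j V hV l * J.j V hV l' - J.j V hV (l * l')) : J.curv = c :=
  ev₂_ext fun V hV l l' => ξ.i_injective V (by rw [i_curv, h])

theorem curv_restrict (J : ξ.LinearSplitting U) {V : Opens X} (h : V ≤ U) :
    (J.restrict h).curv = restrictCochain Λ A 2 h J.curv :=
  curv_eq _ _ fun W hW l l' => by
    rw [ev₂_restrict, i_curv]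
    rfl

theorem j_mul_i (J : ξ.LinearSplitting U) (V : Opens X) (hV : V ≤ U) (l : Λ.Sec V)
    (a : A.Sec V) : J.j V hV l * ξ.i V a = ξ.i V (l • a) := by
  rw [ξ.left_mul, J.p_j]

theorem i_mul_j (J : ξ.LinearSplitting U) (V : Opens X) (hV : V ≤ U) (l : Λ.Sec V)
    (a : A.Sec V) : ξ.i V a * J.j V hV l = ξ.i V (a <• l) := by
  rw [ξ.right_mul, J.p_j]

/-- The Bianchi identity: the curvature is a Hochschild cocycle. -/
theorem cochainD_curv (J : ξ.LinearSplitting U) : cochainD Λ A 2 U J.curv = 0 := by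
  rw [cochainD_two_eq_zero_iff]
  intro V hV a b e
  apply ξ.i_injective V
  rw [map_add, map_add, ← J.j_mul_i V hV, ← J.i_mul_j V hV, i_curv, i_curv, i_curv, i_curv,
    mul_assoc a b e]
  noncomm_ring

theorem curv_add (J : ξ.LinearSplitting U) (t : filteredCochains Λ A 1 U) :
    (J.add t).curv = J.curv + cochainD Λ A 1 U t :=
  curv_eq _ _ fun V hV l l' => by
    rw [ev₂_add, ev₂_cochainD, map_add, map_add, map_sub, i_curv, add_j, add_j, add_j, add_mul,
      mul_add, mul_add, ξ.square_zero, J.j_mul_i, J.i_mul_j]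
    abel

/-- In the coordinates `(p g, r g)` the product of `Γ` is twisted by the curvature. -/
theorem retr_mul (J : ξ.LinearSplitting U) (V : Opens X) (hV : V ≤ U) (g g' : ξ.Γ.Sec V) :
    J.retr V hV (g * g') = ev₂ J.curv V hV (ξ.p V g) (ξ.p V g') + ξ.p V g • J.retr V hV g' +
      J.retr V hV g <• ξ.p V g' := by
  apply ξ.i_injective V
  have h : (g - J.j V hV (ξ.p V g)) * (g' - J.j V hV (ξ.p V g')) = 0 := by
    rw [← i_retr, ← i_retr, ξ.square_zero]
  rw [i_retr, map_add, map_add, i_curv, ← J.j_mul_i V hV, ← J.i_mul_j V hV, i_retr, i_retr,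
    map_mul]
  rw [sub_mul, mul_sub, mul_sub] at h
  rw [mul_sub, sub_mul]
  refine sub_eq_zero.1 (Eq.trans ?_ h)
  abel

end LinearSplitting

end FilteredExtension

end FilteredDeformation

/-! ### Potentials of extensions -/

namespace FilteredDeformation
variable {X : TopCat.{u}}

namespace HochschildResolution

variable {Λ : FilteredAlgebraSheaf X} {A : FilteredBimoduleSheaf Λ} (R : HochschildResolution Λ A)

/-- The map on sections induced by `φ₁`. -/
noncomputable def f₁ (U : Opens X) : filteredCochains Λ A 1 U →ₗ[ℂ] VecSec R.I₁ U :=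
  secMap R.φ₁ U

/-- The map on sections induced by `φ₂`. -/
noncomputable def f₂ (U : Opens X) : filteredCochains Λ A 2 U →ₗ[ℂ] VecSec R.I₂ U :=
  secMap R.φ₂ U

theorem res_f₁ {U V : Opens X} (h : V ≤ U) (t : filteredCochains Λ A 1 U) :
    vecRes R.I₁ h (R.f₁ U t) = R.f₁ V (restrictCochain Λ A 1 h t) :=
  (secMap_res R.φ₁ h t).symm

theorem res_f₂ {U V : Opens X} (h : V ≤ U) (t : filteredCochains Λ A 2 U) :
    vecRes R.I₂ h (R.f₂ U t) = R.f₂ V (restrictCochain Λ A 2 h t) :=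
  (secMap_res R.φ₂ h t).symm

theorem d₁_f₁ (U : Opens X) (t : filteredCochains Λ A 1 U) :
    secMap R.d₁ U (R.f₁ U t) = R.f₂ U (cochainD Λ A 1 U t) :=
  congrArg (fun k => secMap k U t) R.φ₁_d₁

theorem d₂_f₂ (U : Opens X) (c : filteredCochains Λ A 2 U) (hc : cochainD Λ A 2 U c = 0) :
    secMap R.d₂ U (R.f₂ U c) = 0 :=
  (congrArg (fun k => secMap k U c) R.φ₂_d₂).trans
    ((congrArg (secMap R.φ₃ U) hc).trans (map_zero (secMap R.φ₃ U)))

theorem d₂_d₁_apply (U : Opens X) (b : VecSec R.I₁ U) : secMap R.d₂ U (secMap R.d₁ U b) = 0 :=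
  congrArg (fun k => secMap k U b) R.d₁_d₂

/-- A 1-cochain is determined by its differential and its image in `I¹`. -/
theorem f₁_eq {U : Opens X} {t t' : filteredCochains Λ A 1 U}
    (h : cochainD Λ A 1 U t = cochainD Λ A 1 U t') (h' : R.f₁ U t = R.f₁ U t') : t = t' :=
  sub_eq_zero.1 (R.eq_zero U (t - t') (by rw [map_sub, h, sub_self])
    ((map_sub (R.f₁ U) t t').trans (by rw [h', sub_self])))

end HochschildResolution

variable {Λ : FilteredAlgebraSheaf X} {A : FilteredBimoduleSheaf Λ}

/-- A potential exhibits the section `z` of `I²` as a representative of the class of the extension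
`ξ`: it assigns to each linear splitting `j` over `U` a section `b_j` of `I¹` over `U` with
`z|_U = c_j + d b_j`, where `c_j` is the curvature, compatibly with restrictions and such that
`b_{j + i t} = b_j - t`. -/
structure Potential (R : HochschildResolution Λ A) (ξ : FilteredExtension Λ A)
    (z : VecSec R.I₂ ⊤) where
  b : ∀ U : Opens X, ξ.LinearSplitting U → VecSec R.I₁ U
  res_b : ∀ ⦃U V : Opens X⦄ (h : V ≤ U) (J : ξ.LinearSplitting U),
    vecRes R.I₁ h (b U J) = b V (J.restrict h)
  b_add : ∀ (U : Opens X) (J : ξ.LinearSplitting U) (t : filteredCochains Λ A 1 U),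
    b U (J.add t) = b U J - R.f₁ U t
  res_eq : ∀ (U : Opens X) (J : ξ.LinearSplitting U),
    vecRes R.I₂ le_top z = R.f₂ U J.curv + secMap R.d₁ U (b U J)

/-- A potential for `z` yields one for `z + d β`, where `β` is a global section of `I¹`. -/
def Potential.shift {R : HochschildResolution Λ A} {ξ : FilteredExtension Λ A}
    {z : VecSec R.I₂ ⊤} (P : Potential R ξ z) (β : VecSec R.I₁ ⊤) :
    Potential R ξ (z + secMap R.d₁ ⊤ β) where
  b U J := P.b U J + vecRes R.I₁ le_top β
  res_b U V h J := by rw [map_add, P.res_b, vecRes_vecRes]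
  b_add U J t := by rw [P.b_add]; abel
  res_eq U J := by rw [map_add, P.res_eq U J, map_add, ← secMap_res, add_assoc]

namespace FilteredExtension

open scoped RightActions

/-- `A` as a bimodule over the algebra `Γ` of an extension. -/
def bimodule (ξ : FilteredExtension Λ A) : FilteredBimoduleSheaf ξ.Γ :=
  letI left : ∀ U : Opens X, Module (ξ.Γ.Sec U) (VecSec A.sheaf U) := fun U =>
    Module.compHom _ (ξ.p U).toRingHom
  letI right : ∀ U : Opens X, Module (ξ.Γ.Sec U)ᵐᵒᵖ (VecSec A.sheaf U) := fun U =>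
    Module.compHom _ (RingHom.op (ξ.p U).toRingHom)
  have hl : ∀ (U : Opens X) (g : ξ.Γ.Sec U) (a : VecSec A.sheaf U), g • a = ξ.p U g • a :=
    fun _ _ _ => rfl
  have hr : ∀ (U : Opens X) (g : ξ.Γ.Sec U) (a : VecSec A.sheaf U), a <• g = a <• ξ.p U g :=
    fun _ _ _ => rfl
  { sheaf := A.sheaf
    left := left
    right := right
    comm := fun U => ⟨fun g g' a => smul_comm (ξ.p U g) (MulOpposite.op (ξ.p U g'.unop)) a⟩
    left_tower := fun U => ⟨fun c g a => by rw [hl, hl, map_smul, smul_assoc]⟩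
    right_tower := fun U => ⟨fun c g a => by
      have h1 := hr U (c • g.unop) a
      have h2 := hr U g.unop a
      rw [MulOpposite.op_smul, MulOpposite.op_unop] at h1
      rw [MulOpposite.op_unop] at h2
      rw [h1, h2, map_smul, MulOpposite.op_smul, smul_assoc]⟩
    res_left := fun U V h g a => by rw [hl, hl, A.res_left, ξ.p_res]
    res_right := fun U V h g a => by rw [hr, hr, A.res_right, ξ.p_res]
    filtration := A.filtration
    left_mem := fun m n U g a hg ha => A.left_mem m n U _ _ (ξ.p_mem _ _ _ hg) ha
    right_mem := fun m n U g a hg ha => A.right_mem m n U _ _ (ξ.p_mem _ _ _ hg) ha }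

/-- Composition of a 1-cochain of `Λ` with `p : Γ → Λ`. -/
def pullbackCochain (ξ : FilteredExtension Λ A) (U : Opens X) :
    filteredCochains Λ A 1 U →ₗ[ℂ] filteredCochains ξ.Γ ξ.bimodule 1 U where
  toFun t := mkCochain₁ (A := ξ.bimodule) (fun V hV => ev₁ t V hV ∘ₗ (ξ.p V).toLinearMap)
    (fun _ _ hV h l => (res_ev₁ t hV h _).trans (congrArg _ (ξ.p_res h l).symm))
    (fun n _ hV _ hl => ev₁_mem t hV n _ (ξ.p_mem _ _ _ hl))
  map_add' _ _ := rfl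
  map_smul' _ _ := rfl

/-- The pullback of 1-cochains along `p` as a morphism of sheaves. -/
noncomputable def pullbackCochainSheaf (ξ : FilteredExtension Λ A) :
    cochainSheaf Λ A 1 ⟶ cochainSheaf ξ.Γ ξ.bimodule 1 :=
  ⟨{ app := fun U => ModuleCat.ofHom (ξ.pullbackCochain U.unop)
     naturality := fun _ _ _ => rfl }⟩

/-- Injectivity holds because `p` is locally surjective. -/
theorem pullbackCochain_injective (ξ : FilteredExtension Λ A) (U : Opens X) :
    Function.Injective (ξ.pullbackCochain U) := by
  refine (injective_iff_map_eq_zero _).2 fun t ht => ev₁_ext fun V hV l => ?_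
  refine vec_ext_locally A.sheaf V _ _ fun x hx => ?_
  obtain ⟨W, hW, hxW, g, hg⟩ := ξ.p_locally_surjective V l x hx
  refine ⟨W, hW, hxW, ?_⟩
  have h1 : ev₁ t W (hW.trans hV) (ξ.p W g) = 0 :=
    congrArg (fun s => ev₁ s W (hW.trans hV) g) ht
  refine (res_ev₁ t hV hW l).trans ?_
  rw [← hg, h1, ev₁_zero, map_zero]

instance (ξ : FilteredExtension Λ A) : Mono ξ.pullbackCochainSheaf :=
  mono_of_secMap_injective _ ξ.pullbackCochain_injective

/-- The retraction of a linear splitting as a 1-cochain. -/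
noncomputable def LinearSplitting.retrCochain {ξ : FilteredExtension Λ A} {U : Opens X}
    (J : ξ.LinearSplitting U) : filteredCochains ξ.Γ ξ.bimodule 1 U :=
  mkCochain₁ (A := ξ.bimodule) J.retr (fun _ _ hV h g => J.res_retr hV h g)
    (fun n V hV g hg => J.retr_mem n V hV g hg)

theorem LinearSplitting.retrCochain_add {ξ : FilteredExtension Λ A} {U : Opens X}
    (J : ξ.LinearSplitting U) (t : filteredCochains Λ A 1 U) :
    (J.add t).retrCochain = J.retrCochain - ξ.pullbackCochain U t :=
  ev₁_ext fun V hV g => J.retr_add t V hV g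

/-- Every locally trivial extension has a potential. Since `I¹` is injective, the morphism from the
1-cochains of `Λ` to `I¹` extends to the 1-cochains of `Γ` with values in `A`; the potential of a
splitting is the value of this extension on its retraction. -/
theorem exists_potential (R : HochschildResolution Λ A) (ξ : FilteredExtension Λ A)
    (hξ : ξ.IsLocallyTrivial) :
    ∃ z : VecSec R.I₂ ⊤, secMap R.d₂ ⊤ z = 0 ∧ Nonempty (Potential R ξ z) := by
  have := R.injective
  let Φ : cochainSheaf ξ.Γ ξ.bimodule 1 ⟶ R.I₁ := Injective.factorThru R.φ₁ ξ.pullbackCochainSheaf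
  have hΦ : ξ.pullbackCochainSheaf ≫ Φ = R.φ₁ := Injective.comp_factorThru _ _
  let F (U : Opens X) : filteredCochains ξ.Γ ξ.bimodule 1 U →ₗ[ℂ] VecSec R.I₁ U := secMap Φ U
  have hF : ∀ U t, F U (ξ.pullbackCochain U t) = R.f₁ U t := fun U t =>
    congrArg (fun k => secMap k U t) hΦ
  let b (U : Opens X) (J : ξ.LinearSplitting U) : VecSec R.I₁ U := F U J.retrCochain
  have res_b : ∀ ⦃U V : Opens X⦄ (h : V ≤ U) (J : ξ.LinearSplitting U),
      vecRes R.I₁ h (b U J) = b V (J.restrict h) := fun U V h J =>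
    (secMap_res Φ h J.retrCochain).symm
  have b_add : ∀ (U : Opens X) (J : ξ.LinearSplitting U) (t : filteredCochains Λ A 1 U),
      b U (J.add t) = b U J - R.f₁ U t := fun U J t => by
    simp only [b]
    rw [J.retrCochain_add, map_sub, hF]
  -- The local sections `c_j + d b_j` do not depend on `j`, and glue to a global one.
  obtain ⟨z, hz⟩ := vec_exists_of_locally R.I₂ ⊤
    (fun U _ s => ∃ J : ξ.LinearSplitting U, s = R.f₂ U J.curv + secMap R.d₁ U (b U J))
    (fun W W' hW h s ⟨J, hJ⟩ => ⟨J.restrict h, by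
      rw [hJ, map_add, R.res_f₂, J.curv_restrict, ← secMap_res, res_b]⟩)
    (fun W hW s s' ⟨J, hJ⟩ ⟨J', hJ'⟩ => by
      obtain ⟨t, rfl⟩ := J.exists_eq_add J'
      rw [hJ, hJ', J.curv_add, b_add, map_add, map_sub, R.d₁_f₁]
      abel)
    (fun x _ => by
      obtain ⟨U, hxU, ⟨J⟩⟩ := hξ x
      exact ⟨U, le_top, hxU, _, J, rfl⟩)
  have hz' : ∀ (U : Opens X) (J : ξ.LinearSplitting U),
      vecRes R.I₂ le_top z = R.f₂ U J.curv + secMap R.d₁ U (b U J) := fun U J =>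
    hz U le_top _ ⟨J, rfl⟩
  refine ⟨z, vec_ext_locally R.I₃ ⊤ _ _ fun x _ => ?_, ⟨⟨b, res_b, b_add, hz'⟩⟩⟩
  obtain ⟨U, hxU, ⟨J⟩⟩ := hξ x
  refine ⟨U, le_top, hxU, ?_⟩
  rw [← secMap_res, hz', map_add, R.d₂_f₂ _ _ J.cochainD_curv, R.d₂_d₁_apply, add_zero, map_zero]

end FilteredExtension

end FilteredDeformation

/-! ### Linear combinations of extensions -/

namespace FilteredDeformation
variable {X : TopCat.{u}} {Λ : FilteredAlgebraSheaf X} {A : FilteredBimoduleSheaf Λ}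

namespace FilteredExtension

open scoped RightActions

/-- A filtration preserving homomorphism of sheaves of algebras `Γ_ξ ×_Λ Γ_η ⟶ Γ_ζ` that induces
the identity of `Λ` and the map `(a, b) ↦ c a + d b` from `A × A` to `A`. Its existence means that
`ζ` is equivalent to the linear combination `c ξ + d η`. -/
structure CombinationHom (c d : ℂ) (ξ η ζ : FilteredExtension Λ A) where
  σ : ∀ U : Opens X, fiberProduct ξ η U →ₐ[ℂ] ζ.Γ.Sec U
  σ_res : ∀ ⦃U V : Opens X⦄ (h : V ≤ U) (z : fiberProduct ξ η U) (w : fiberProduct ξ η V),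
    w.1 = (ξ.Γ.res h z.1.1, η.Γ.res h z.1.2) → σ V w = ζ.Γ.res h (σ U z)
  σ_mem : ∀ (n : ℕ) (U : Opens X) (z : fiberProduct ξ η U),
    z.1.1 ∈ ξ.Γ.fil n U → z.1.2 ∈ η.Γ.fil n U → σ U z ∈ ζ.Γ.fil n U
  σ_i : ∀ (U : Opens X) (a b : A.Sec U) (z : fiberProduct ξ η U),
    z.1 = (ξ.i U a, η.i U b) → σ U z = ζ.i U (c • a + d • b)
  p_σ : ∀ (U : Opens X) (z : fiberProduct ξ η U), ζ.p U (σ U z) = ξ.p U z.1.1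

variable {ξ η ζ : FilteredExtension Λ A} {c d : ℂ}

theorem mem_fiberProduct {U : Opens X} {g : ξ.Γ.Sec U} {h : η.Γ.Sec U}
    (e : ξ.p U g = η.p U h) : (g, h) ∈ fiberProduct ξ η U := e

theorem fiberProduct_p {U : Opens X} (z : fiberProduct ξ η U) : ξ.p U z.1.1 = η.p U z.1.2 := z.2

/-- The splitting of `ζ` induced by splittings of `ξ` and `η`. -/
def CombinationHom.splitting (σ : CombinationHom c d ξ η ζ) {U : Opens X}
    (J : ξ.LinearSplitting U) (J' : η.LinearSplitting U) : ζ.LinearSplitting U where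
  j V hV := (σ.σ V).toLinearMap ∘ₗ LinearMap.codRestrict (Subalgebra.toSubmodule
    (fiberProduct ξ η V)) ((J.j V hV).prod (J'.j V hV))
      (fun l => mem_fiberProduct ((J.p_j V hV l).trans (J'.p_j V hV l).symm))
  j_res V W hV h l := σ.σ_res h _ _ (Prod.ext (J.j_res V W hV h l) (J'.j_res V W hV h l))
  p_j V hV l := (σ.p_σ _ _).trans (J.p_j V hV l)
  j_mem n V hV l hl := σ.σ_mem n V _ (J.j_mem n V hV l hl) (J'.j_mem n V hV l hl)

theorem CombinationHom.splitting_j (σ : CombinationHom c d ξ η ζ) {U : Opens X}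
    (J : ξ.LinearSplitting U) (J' : η.LinearSplitting U) (V : Opens X) (hV : V ≤ U)
    (l : Λ.Sec V) : (σ.splitting J J').j V hV l = σ.σ V ⟨(J.j V hV l, J'.j V hV l),
      mem_fiberProduct ((J.p_j V hV l).trans (J'.p_j V hV l).symm)⟩ := rfl

theorem CombinationHom.splitting_add (σ : CombinationHom c d ξ η ζ) {U : Opens X}
    (J : ξ.LinearSplitting U) (J' : η.LinearSplitting U) (t t' : filteredCochains Λ A 1 U) :
    σ.splitting (J.add t) (J'.add t') = (σ.splitting J J').add (c • t + d • t') :=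
  LinearSplitting.ext' fun V hV l => by
    have h1 := σ.σ_i V (ev₁ t V hV l) (ev₁ t' V hV l)
      ⟨_, mem_fiberProduct ((ξ.p_i V (ev₁ t V hV l)).trans (η.p_i V (ev₁ t' V hV l)).symm)⟩ rfl
    rw [LinearSplitting.add_j, σ.splitting_j, σ.splitting_j, ev₁_add, ev₁_smul, ev₁_smul, ← h1,
      ← map_add]
    rfl

theorem CombinationHom.curv_splitting (σ : CombinationHom c d ξ η ζ) {U : Opens X}
    (J : ξ.LinearSplitting U) (J' : η.LinearSplitting U) :
    (σ.splitting J J').curv = c • J.curv + d • J'.curv :=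
  LinearSplitting.curv_eq _ _ fun V hV l l' => by
    have h1 := σ.σ_i V (ev₂ J.curv V hV l l') (ev₂ J'.curv V hV l l')
      ⟨_, mem_fiberProduct ((ξ.p_i V (ev₂ J.curv V hV l l')).trans
        (η.p_i V (ev₂ J'.curv V hV l l')).symm)⟩ rfl
    rw [ev₂_add, ev₂_smul, ev₂_smul, ← h1, σ.splitting_j, σ.splitting_j, σ.splitting_j, ← map_mul,
      ← map_sub]
    congr 1
    exact Subtype.ext (Prod.ext (J.i_curv V hV l l') (J'.i_curv V hV l l'))

theorem exists_common_splitting (hξ : ξ.IsLocallyTrivial) (hη : η.IsLocallyTrivial) (x : X) :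
    ∃ U : Opens X, x ∈ U ∧ Nonempty (ξ.LinearSplitting U) ∧ Nonempty (η.LinearSplitting U) := by
  obtain ⟨U, hU, ⟨J⟩⟩ := hξ x
  obtain ⟨V, hV, ⟨J'⟩⟩ := hη x
  exact ⟨U ⊓ V, ⟨hU, hV⟩, ⟨J.restrict inf_le_left⟩, ⟨J'.restrict inf_le_right⟩⟩

/-- A morphism exhibiting `ζ` as `c ξ + d η` forces the same relation between the classes. The local
differences of the potentials of `ζ` and of `c ξ + d η` at corresponding splittings are
independent of the splittings, and glue to `β`. -/
theorem exists_d₁_eq_of_combinationHom {R : HochschildResolution Λ A}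
    (hξ : ξ.IsLocallyTrivial) (hη : η.IsLocallyTrivial) (σ : CombinationHom c d ξ η ζ)
    {z w y : VecSec R.I₂ ⊤} (P : Potential R ξ z) (Q : Potential R η w) (S : Potential R ζ y) :
    ∃ β, secMap R.d₁ ⊤ β = y - (c • z + d • w) := by
  obtain ⟨β, hβ⟩ := vec_exists_of_locally R.I₁ ⊤
    (fun U _ s => ∃ (J : ξ.LinearSplitting U) (J' : η.LinearSplitting U),
      s = S.b U (σ.splitting J J') - (c • P.b U J + d • Q.b U J'))
    (fun W W' hW h s ⟨J, J', hJ⟩ => ⟨J.restrict h, J'.restrict h, by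
      rw [hJ, map_sub, map_add, map_smul, map_smul, S.res_b, P.res_b, Q.res_b]
      rfl⟩)
    (fun W hW s s' ⟨J, J', hJ⟩ ⟨K, K', hK⟩ => by
      obtain ⟨t, rfl⟩ := J.exists_eq_add K
      obtain ⟨t', rfl⟩ := J'.exists_eq_add K'
      rw [hJ, hK, σ.splitting_add, S.b_add, P.b_add, Q.b_add, map_add, map_smul, map_smul,
        smul_sub, smul_sub]
      abel)
    (fun x _ => by
      obtain ⟨U, hxU, ⟨J⟩, ⟨J'⟩⟩ := exists_common_splitting hξ hη x
      exact ⟨U, le_top, hxU, _, J, J', rfl⟩)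
  refine ⟨β, vec_ext_locally R.I₂ ⊤ _ _ fun x _ => ?_⟩
  obtain ⟨U, hxU, ⟨J⟩, ⟨J'⟩⟩ := exists_common_splitting hξ hη x
  refine ⟨U, le_top, hxU, ?_⟩
  rw [← secMap_res, hβ U le_top _ ⟨J, J', rfl⟩, map_sub, map_sub, map_add, map_add, map_smul,
    map_smul, map_smul, map_smul, S.res_eq U (σ.splitting J J'), P.res_eq U J, Q.res_eq U J',
    σ.curv_splitting, map_add, map_smul, map_smul, smul_add, smul_add]
  abel

/-- Splittings `J`, `J'`, `K` of `ξ`, `η`, `ζ` over `U` are adapted to the linear combination with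
coefficients `c`, `d` if curvature and potential of `K` are the linear combinations of those of
`J` and `J'`. -/
structure IsAdapted {R : HochschildResolution Λ A} {z w y : VecSec R.I₂ ⊤} (c d : ℂ)
    (P : Potential R ξ z) (Q : Potential R η w) (S : Potential R ζ y) {U : Opens X}
    (J : ξ.LinearSplitting U) (J' : η.LinearSplitting U) (K : ζ.LinearSplitting U) : Prop where
  curv : K.curv = c • J.curv + d • J'.curv
  b : S.b U K = c • P.b U J + d • Q.b U J'

section Adapted

variable {R : HochschildResolution Λ A} {z w : VecSec R.I₂ ⊤}
  {P : Potential R ξ z} {Q : Potential R η w} {S : Potential R ζ (c • z + d • w)}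

theorem IsAdapted.restrict {U V : Opens X} {J : ξ.LinearSplitting U} {J' : η.LinearSplitting U}
    {K : ζ.LinearSplitting U} (h : IsAdapted c d P Q S J J' K) (hV : V ≤ U) :
    IsAdapted c d P Q S (J.restrict hV) (J'.restrict hV) (K.restrict hV) where
  curv := by
    rw [K.curv_restrict, J.curv_restrict, J'.curv_restrict, h.curv, map_add, map_smul, map_smul]
  b := by rw [← S.res_b, ← P.res_b, ← Q.res_b, h.b, map_add, map_smul, map_smul]

/-- For given `J` and `J'`, adapted splittings of `ζ` exist as soon as `ζ` has some splitting. -/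
theorem exists_isAdapted {U : Opens X} (J : ξ.LinearSplitting U) (J' : η.LinearSplitting U)
    (K : ζ.LinearSplitting U) : ∃ K', IsAdapted c d P Q S J J' K' := by
  obtain ⟨t, ht, ht'⟩ := R.exists_cochain U (K.curv - (c • J.curv + d • J'.curv))
    (S.b U K - (c • P.b U J + d • Q.b U J'))
    (by rw [map_sub, map_add, map_smul, map_smul, K.cochainD_curv, J.cochainD_curv,
      J'.cochainD_curv, smul_zero, smul_zero, add_zero, sub_zero])
    (by
      have h1 := S.res_eq U K
      rw [map_add, map_smul, map_smul, P.res_eq U J, Q.res_eq U J'] at h1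
      change R.f₂ U _ + _ = 0
      rw [map_sub, map_add, map_smul, map_smul, map_sub, map_add, map_smul, map_smul,
        sub_add_sub_comm, ← h1, smul_add, smul_add]
      abel)
  change R.f₁ U t = _ at ht'
  refine ⟨K.add (-t), ?_, ?_⟩
  · rw [K.curv_add, map_neg, ht]; abel
  · rw [S.b_add, map_neg, ht']; abel

/-- The adapted splitting of `ζ` is unique, and depends affinely on those of `ξ` and `η`. -/
theorem IsAdapted.diff_eq {U : Opens X} {J : ξ.LinearSplitting U} {J' : η.LinearSplitting U}
    {K : ζ.LinearSplitting U} (h : IsAdapted c d P Q S J J' K) {t t' s : filteredCochains Λ A 1 U}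
    (h' : IsAdapted c d P Q S (J.add t) (J'.add t') (K.add s)) : s = c • t + d • t' := by
  have h1 := h'.curv
  have h2 := h'.b
  rw [K.curv_add, J.curv_add, J'.curv_add, h.curv, smul_add, smul_add, add_add_add_comm,
    add_right_inj] at h1
  rw [S.b_add, P.b_add, Q.b_add, h.b, smul_sub, smul_sub, sub_add_sub_comm, sub_right_inj] at h2
  refine R.f₁_eq ?_ ?_
  · rw [h1, map_add, map_smul, map_smul]
  · rw [h2, map_add, map_smul, map_smul]

/-- The linear map `(g, h) ↦ K (p g) + i (c r(g) + d r'(h))`, where `r` and `r'` are the retractions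
of the splittings `J` of `ξ` and `J'` of `η`, and `K` is a splitting of `ζ`. -/
noncomputable def adaptedValue (c d : ℂ) {U : Opens X} (J : ξ.LinearSplitting U)
    (J' : η.LinearSplitting U) (K : ζ.LinearSplitting U) : ξ.Γ.Sec U × η.Γ.Sec U →ₗ[ℂ] ζ.Γ.Sec U :=
  K.j U le_rfl ∘ₗ (ξ.p U).toLinearMap ∘ₗ LinearMap.fst ℂ _ _ +
    ζ.i U ∘ₗ (c • J.retr U le_rfl ∘ₗ LinearMap.fst ℂ _ _ +
      d • J'.retr U le_rfl ∘ₗ LinearMap.snd ℂ _ _)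

theorem adaptedValue_apply {U : Opens X} (J : ξ.LinearSplitting U)
    (J' : η.LinearSplitting U) (K : ζ.LinearSplitting U) (z : ξ.Γ.Sec U × η.Γ.Sec U) :
    adaptedValue c d J J' K z = K.j U le_rfl (ξ.p U z.1) +
      ζ.i U (c • J.retr U le_rfl z.1 + d • J'.retr U le_rfl z.2) := rfl

theorem adaptedValue_mul {U : Opens X} {J : ξ.LinearSplitting U} {J' : η.LinearSplitting U}
    {K : ζ.LinearSplitting U} (h : K.curv = c • J.curv + d • J'.curv)
    (z w : fiberProduct ξ η U) : adaptedValue c d J J' K (z.1 * w.1) =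
      adaptedValue c d J J' K z.1 * adaptedValue c d J J' K w.1 := by
  have hc := K.i_curv U le_rfl (ξ.p U z.1.1) (ξ.p U w.1.1)
  rw [h, ev₂_add, ev₂_smul, ev₂_smul] at hc
  rw [adaptedValue_apply, adaptedValue_apply, adaptedValue_apply, Prod.fst_mul, Prod.snd_mul,
    J.retr_mul, J'.retr_mul, ← fiberProduct_p z, ← fiberProduct_p w, add_mul, mul_add, mul_add,
    ζ.square_zero, K.j_mul_i, K.i_mul_j, map_mul (ξ.p U), ← eq_sub_iff_add_eq.1 hc]
  simp only [map_add, map_smul, smul_add, smul_comm _ c, smul_comm _ d]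
  abel

theorem res_adaptedValue {U V : Opens X} (h : V ≤ U) (J : ξ.LinearSplitting U)
    (J' : η.LinearSplitting U) (K : ζ.LinearSplitting U) (z : ξ.Γ.Sec U × η.Γ.Sec U) :
    ζ.Γ.res h (adaptedValue c d J J' K z) = adaptedValue c d (J.restrict h) (J'.restrict h)
      (K.restrict h) (ξ.Γ.res h z.1, η.Γ.res h z.2) := by
  rw [adaptedValue_apply, adaptedValue_apply, map_add, ← ζ.i_res, map_add, map_smul, map_smul,
    J.res_retr le_rfl h, J'.res_retr le_rfl h, ← K.j_res U V le_rfl h, ← ξ.p_res]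
  rfl

theorem p_adaptedValue {U : Opens X} (J : ξ.LinearSplitting U)
    (J' : η.LinearSplitting U) (K : ζ.LinearSplitting U) (z : ξ.Γ.Sec U × η.Γ.Sec U) :
    ζ.p U (adaptedValue c d J J' K z) = ξ.p U z.1 := by
  rw [adaptedValue_apply, map_add, K.p_j, ζ.p_i, add_zero]

theorem adaptedValue_mem {U : Opens X} (J : ξ.LinearSplitting U)
    (J' : η.LinearSplitting U) (K : ζ.LinearSplitting U) (n : ℕ) (z : ξ.Γ.Sec U × η.Γ.Sec U)
    (h₁ : z.1 ∈ ξ.Γ.fil n U) (h₂ : z.2 ∈ η.Γ.fil n U) :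
    adaptedValue c d J J' K z ∈ ζ.Γ.fil n U :=
  add_mem (K.j_mem _ _ _ _ (ξ.p_mem _ _ _ h₁)) ((ζ.i_mem_iff _ _ _).2
    (add_mem (Submodule.smul_mem _ _ (J.retr_mem _ _ _ _ h₁))
      (Submodule.smul_mem _ _ (J'.retr_mem _ _ _ _ h₂))))

/-- On the fibre product, the map `adaptedValue` is the same for all adapted splittings. -/
theorem adaptedValue_eq {U : Opens X} {J L : ξ.LinearSplitting U} {J' L' : η.LinearSplitting U}
    {K M : ζ.LinearSplitting U} (h : IsAdapted c d P Q S J J' K)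
    (h' : IsAdapted c d P Q S L L' M) (z : fiberProduct ξ η U) :
    adaptedValue c d L L' M z.1 = adaptedValue c d J J' K z.1 := by
  obtain ⟨t, rfl⟩ := J.exists_eq_add L
  obtain ⟨t', rfl⟩ := J'.exists_eq_add L'
  obtain ⟨s, rfl⟩ := K.exists_eq_add M
  rw [adaptedValue_apply, adaptedValue_apply, K.add_j, J.retr_add, J'.retr_add,
    ← fiberProduct_p z, h.diff_eq h', ev₁_add, ev₁_smul, ev₁_smul, add_assoc, ← map_add]
  congr 2
  rw [smul_sub, smul_sub]
  abel

/-- An idempotent lift of `1` is `1`; hence multiplicative maps over `Λ` between extensions are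
unital. -/
theorem eq_one_of_mul_self {U : Opens X} (e : ζ.Γ.Sec U) (he : e * e = e) (hp : ζ.p U e = 1) :
    e = 1 := by
  obtain ⟨a, ha⟩ := (ζ.exact U (e - 1)).1 (by rw [map_sub, hp, map_one, sub_self])
  have h1 : e = 1 + ζ.i U a := by rw [ha]; abel
  have h2 := ζ.square_zero U a a
  rw [h1, mul_add, add_mul, add_mul, h2, one_mul, one_mul, mul_one, add_zero, add_assoc,
    add_right_inj, add_eq_left] at he
  rw [h1, he, add_zero]

/-- The maps `adaptedValue` glue to a morphism exhibiting `ζ` as `c ξ + d η`. -/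
theorem nonempty_combinationHom (hξ : ξ.IsLocallyTrivial) (hη : η.IsLocallyTrivial)
    (hζ : ζ.IsLocallyTrivial) (P : Potential R ξ z) (Q : Potential R η w)
    (S : Potential R ζ (c • z + d • w)) : Nonempty (CombinationHom c d ξ η ζ) := by
  have loc : ∀ x : X, ∃ U : Opens X, x ∈ U ∧ ∃ (J : ξ.LinearSplitting U)
      (J' : η.LinearSplitting U) (K : ζ.LinearSplitting U), IsAdapted c d P Q S J J' K := by
    intro x
    obtain ⟨U, hU, ⟨J⟩, ⟨J'⟩⟩ := exists_common_splitting hξ hη x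
    obtain ⟨V, hV, ⟨K⟩⟩ := hζ x
    obtain ⟨K', hK'⟩ := exists_isAdapted (P := P) (Q := Q) (S := S)
      (J.restrict (inf_le_left : U ⊓ V ≤ U)) (J'.restrict (inf_le_left : U ⊓ V ≤ U))
      (K.restrict inf_le_right)
    exact ⟨U ⊓ V, ⟨hU, hV⟩, _, _, K', hK'⟩
  have resF : ∀ {U V : Opens X} (h : V ≤ U) (z : fiberProduct ξ η U),
      (ξ.Γ.res h z.1.1, η.Γ.res h z.1.2) ∈ fiberProduct ξ η V := fun {U V} h z =>
    mem_fiberProduct (by rw [ξ.p_res, η.p_res, fiberProduct_p z])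
  have glue : ∀ (U : Opens X) (z : fiberProduct ξ η U), ∃ t : ζ.Γ.Sec U, ∀ (W : Opens X)
      (hW : W ≤ U) (J : ξ.LinearSplitting W) (J' : η.LinearSplitting W) (K : ζ.LinearSplitting W),
      IsAdapted c d P Q S J J' K → ζ.Γ.res hW t =
        adaptedValue c d J J' K (ξ.Γ.res hW z.1.1, η.Γ.res hW z.1.2) := by
    intro U z
    obtain ⟨t, ht⟩ := alg_exists_of_locally ζ.Γ.sheaf U
      (fun W hW s => ∃ (J : ξ.LinearSplitting W) (J' : η.LinearSplitting W)
        (K : ζ.LinearSplitting W), IsAdapted c d P Q S J J' K ∧ s =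
        adaptedValue c d J J' K (ξ.Γ.res hW z.1.1, η.Γ.res hW z.1.2))
      (fun W W' hW h s ⟨J, J', K, hJ, hs⟩ => ⟨_, _, _, hJ.restrict h, by
        refine (congrArg _ hs).trans ((res_adaptedValue h J J' K _).trans ?_)
        rw [algRes_algRes, algRes_algRes]⟩)
      (fun W hW s s' ⟨J, J', K, hJ, hs⟩ ⟨L, L', M, hL, hs'⟩ => by
        rw [hs, hs']
        exact (adaptedValue_eq hJ hL ⟨_, resF hW z⟩).symm)
      (fun x hx => by
        obtain ⟨W, hxW, J, J', K, hJ⟩ := loc x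
        exact ⟨U ⊓ W, inf_le_left, ⟨hx, hxW⟩, _, _, _, _, hJ.restrict inf_le_right, rfl⟩)
    exact ⟨t, fun W hW J J' K h => ht W hW _ ⟨J, J', K, h, rfl⟩⟩
  -- The underlying maps of the morphism; its properties are checked locally, on adapted splittings.
  choose s hs using glue
  have loc' : ∀ (U : Opens X), ∀ x ∈ U, ∃ (W : Opens X) (hW : W ≤ U), x ∈ W ∧
      ∃ (J : ξ.LinearSplitting W) (J' : η.LinearSplitting W) (K : ζ.LinearSplitting W),
        IsAdapted c d P Q S J J' K := by
    intro U x hx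
    obtain ⟨W, hxW, J, J', K, hJ⟩ := loc x
    exact ⟨U ⊓ W, inf_le_left, ⟨hx, hxW⟩, _, _, _, hJ.restrict inf_le_right⟩
  have s_add : ∀ U z w, s U (z + w) = s U z + s U w := by
    intro U z w
    refine alg_ext_locally ζ.Γ.sheaf U _ _ fun x hx => ?_
    obtain ⟨W, hW, hxW, J, J', K, hJ⟩ := loc' U x hx
    refine ⟨W, hW, hxW, ?_⟩
    refine (hs U (z + w) W hW J J' K hJ).trans (Eq.trans ?_ (map_add (ζ.Γ.res hW) _ _).symm)
    rw [hs U z W hW J J' K hJ, hs U w W hW J J' K hJ, ← map_add]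
    refine congrArg _ (Prod.ext ?_ ?_)
    · exact map_add (ξ.Γ.res hW) _ _
    · exact map_add (η.Γ.res hW) _ _
  have s_smul : ∀ U (r : ℂ) z, s U (r • z) = r • s U z := by
    intro U r z
    refine alg_ext_locally ζ.Γ.sheaf U _ _ fun x hx => ?_
    obtain ⟨W, hW, hxW, J, J', K, hJ⟩ := loc' U x hx
    refine ⟨W, hW, hxW, ?_⟩
    refine (hs U (r • z) W hW J J' K hJ).trans (Eq.trans ?_ (map_smul (ζ.Γ.res hW) _ _).symm)
    rw [hs U z W hW J J' K hJ, ← map_smul]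
    refine congrArg _ (Prod.ext ?_ ?_)
    · exact map_smul (ξ.Γ.res hW) _ _
    · exact map_smul (η.Γ.res hW) _ _
  have s_mul : ∀ U z w, s U (z * w) = s U z * s U w := by
    intro U z w
    refine alg_ext_locally ζ.Γ.sheaf U _ _ fun x hx => ?_
    obtain ⟨W, hW, hxW, J, J', K, hJ⟩ := loc' U x hx
    refine ⟨W, hW, hxW, ?_⟩
    refine (hs U (z * w) W hW J J' K hJ).trans (Eq.trans ?_ (map_mul (ζ.Γ.res hW) _ _).symm)
    rw [hs U z W hW J J' K hJ, hs U w W hW J J' K hJ]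
    refine Eq.trans ?_ (adaptedValue_mul hJ.curv ⟨_, resF hW z⟩ ⟨_, resF hW w⟩)
    refine congrArg _ (Prod.ext ?_ ?_)
    · exact map_mul (ξ.Γ.res hW) _ _
    · exact map_mul (η.Γ.res hW) _ _
  have p_s : ∀ U z, ζ.p U (s U z) = ξ.p U z.1.1 := by
    intro U z
    refine alg_ext_locally Λ.sheaf U _ _ fun x hx => ?_
    obtain ⟨W, hW, hxW, J, J', K, hJ⟩ := loc' U x hx
    refine ⟨W, hW, hxW, ?_⟩
    refine (ζ.p_res hW _).symm.trans (Eq.trans ?_ (ξ.p_res hW _))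
    rw [hs U z W hW J J' K hJ, p_adaptedValue]
  have s_one : ∀ U, s U 1 = 1 := fun U => eq_one_of_mul_self _ (by rw [← s_mul, mul_one]) (by
    rw [p_s]
    exact map_one (ξ.p U))
  refine ⟨⟨fun U => AlgHom.ofLinearMap ⟨⟨s U, s_add U⟩, s_smul U⟩ (s_one U) (s_mul U), ?_, ?_, ?_,
    p_s⟩⟩
  · intro U V h z w hw
    change s V w = ζ.Γ.res h (s U z)
    refine alg_ext_locally ζ.Γ.sheaf V _ _ fun x hx => ?_
    obtain ⟨W, hW, hxW, J, J', K, hJ⟩ := loc' V x hx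
    refine ⟨W, hW, hxW, ?_⟩
    rw [algRes_algRes]
    refine (hs V w W hW J J' K hJ).trans (Eq.trans ?_ (hs U z W (hW.trans h) J J' K hJ).symm)
    rw [hw]
    simp only [algRes_algRes]
  · intro n U z h₁ h₂
    change s U z ∈ _
    refine ζ.Γ.filtration.mem_of_locally n U _ fun x hx => ?_
    obtain ⟨W, hW, hxW, J, J', K, hJ⟩ := loc' U x hx
    refine ⟨W, hW, hxW, ?_⟩
    change ζ.Γ.res hW (s U z) ∈ ζ.Γ.fil n W
    rw [hs U z W hW J J' K hJ]
    exact adaptedValue_mem J J' K n _ (ξ.Γ.filtration.res_mem n hW _ h₁)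
      (η.Γ.filtration.res_mem n hW _ h₂)
  · intro U a b z hz
    change s U z = _
    refine alg_ext_locally ζ.Γ.sheaf U _ _ fun x hx => ?_
    obtain ⟨W, hW, hxW, J, J', K, hJ⟩ := loc' U x hx
    refine ⟨W, hW, hxW, ?_⟩
    refine (hs U z W hW J J' K hJ).trans (Eq.trans ?_ (ζ.i_res hW _))
    rw [hz, adaptedValue_apply]
    dsimp only
    rw [← ξ.i_res, ← η.i_res, ξ.p_i, map_zero, zero_add, J.retr_i, J'.retr_i,
      map_add (A.res hW), map_smul (A.res hW), map_smul (A.res hW)]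

end Adapted

end FilteredExtension

end FilteredDeformation

/-! ### The extension attached to a closed section: sections -/

namespace FilteredDeformation
variable {X : TopCat.{u}} {Λ : FilteredAlgebraSheaf X} {A : FilteredBimoduleSheaf Λ}

open scoped RightActions

/-- A representation `z|_U = c + d b` of a global section `z` of `I²` by a Hochschild
2-cocycle `c` over `U` and a section `b` of `I¹`. In the extension that `z` classifies, these
correspond to the filtered linear splittings over `U`. -/
@[ext]
structure CocycleRep (R : HochschildResolution Λ A) (z : VecSec R.I₂ ⊤) (U : Opens X) where
  /-- the cocycle -/
  c : filteredCochains Λ A 2 U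
  /-- the section of `I¹` -/
  b : VecSec R.I₁ U
  cochainD_c : cochainD Λ A 2 U c = 0
  res_eq : vecRes R.I₂ le_top z = R.f₂ U c + secMap R.d₁ U b

namespace CocycleRep

variable {R : HochschildResolution Λ A} {z : VecSec R.I₂ ⊤} {U : Opens X}

/-- Restriction to a smaller open set. -/
def restrict (q : CocycleRep R z U) {V : Opens X} (h : V ≤ U) : CocycleRep R z V where
  c := restrictCochain Λ A 2 h q.c
  b := vecRes R.I₁ h q.b
  cochainD_c := by rw [← restrictCochain_cochainD, q.cochainD_c, map_zero]
  res_eq := by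
    have := congrArg (vecRes R.I₂ h) q.res_eq
    rwa [vecRes_vecRes, map_add, R.res_f₂, ← secMap_res] at this

/-- The 1-cochains act on the representations of `z` by `(c, b) ↦ (c + d t, b - t)`. -/
noncomputable def shift (q : CocycleRep R z U) (t : filteredCochains Λ A 1 U) :
    CocycleRep R z U where
  c := q.c + cochainD Λ A 1 U t
  b := q.b - R.f₁ U t
  cochainD_c := by
    have h : cochainD Λ A 2 U (cochainD Λ A 1 U t) = 0 :=
      Subtype.ext (funext fun V => hochschildD_comp 1 (t.1 V))
    rw [map_add, q.cochainD_c, h, add_zero]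
  res_eq := by rw [map_add, map_sub, R.d₁_f₁, q.res_eq]; abel

theorem shift_c (q : CocycleRep R z U) (t : filteredCochains Λ A 1 U) :
    (q.shift t).c = q.c + cochainD Λ A 1 U t := rfl

theorem restrict_restrict (q : CocycleRep R z U) {V W : Opens X} (h : V ≤ U) (h' : W ≤ V) :
    (q.restrict h).restrict h' = q.restrict (h'.trans h) :=
  CocycleRep.ext rfl (vecRes_vecRes _ h h' _)

theorem restrict_shift (q : CocycleRep R z U) (t : filteredCochains Λ A 1 U) {V : Opens X}
    (h : V ≤ U) : (q.shift t).restrict h = (q.restrict h).shift (restrictCochain Λ A 1 h t) :=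
  CocycleRep.ext rfl ((map_sub (vecRes R.I₁ h) _ _).trans (congrArg _ (R.res_f₁ h t)))

theorem shift_shift (q : CocycleRep R z U) (t t' : filteredCochains Λ A 1 U) :
    (q.shift t).shift t' = q.shift (t + t') :=
  CocycleRep.ext ((add_assoc _ _ _).trans (congrArg _ (map_add _ _ _).symm))
    ((sub_sub _ _ _).trans (congrArg _ (map_add (R.f₁ U) _ _).symm))

theorem shift_injective (q : CocycleRep R z U) {t t' : filteredCochains Λ A 1 U}
    (h : q.shift t = q.shift t') : t = t' :=
  R.f₁_eq (add_right_injective _ (congrArg c h)) (sub_right_injective (congrArg b h))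

/-- The action of the 1-cochains on the representations of `z` is transitive. -/
theorem exists_eq_shift (q q' : CocycleRep R z U) : ∃ t, q' = q.shift t := by
  obtain ⟨t, ht, ht'⟩ := R.exists_cochain U (q'.c - q.c) (q'.b - q.b)
    (by rw [map_sub, q.cochainD_c, q'.cochainD_c, sub_zero])
    (by
      change R.f₂ U _ + _ = 0
      have := q.res_eq.symm.trans q'.res_eq
      rw [map_sub, map_sub, sub_add_sub_comm, ← this, sub_self])
  change R.f₁ U t = _ at ht'
  refine ⟨t, CocycleRep.ext ?_ ?_⟩
  · change _ = q.c + cochainD Λ A 1 U t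
    rw [ht, add_sub_cancel]
  · change _ = q.b - R.f₁ U t
    rw [ht', sub_neg_eq_add, add_sub_cancel]

/-- The 1-cochain `t` with `q' = q.shift t`. -/
noncomputable def diff (q q' : CocycleRep R z U) : filteredCochains Λ A 1 U :=
  (q.exists_eq_shift q').choose

theorem shift_diff (q q' : CocycleRep R z U) : q.shift (q.diff q') = q' :=
  (q.exists_eq_shift q').choose_spec.symm

theorem diff_shift (q q' : CocycleRep R z U) (t : filteredCochains Λ A 1 U) :
    q.diff (q'.shift t) = q.diff q' + t :=
  q.shift_injective (by rw [shift_diff, ← shift_shift, shift_diff])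

theorem diff_self (q : CocycleRep R z U) : q.diff q = 0 :=
  q.shift_injective ((q.shift_diff q).trans (CocycleRep.ext
    (by rw [shift_c, map_zero, add_zero])
    ((congrArg (q.b - ·) (map_zero (R.f₁ U))).trans (sub_zero _)).symm))

theorem restrict_diff (q q' : CocycleRep R z U) {V : Opens X} (h : V ≤ U) :
    restrictCochain Λ A 1 h (q.diff q') = (q.restrict h).diff (q'.restrict h) :=
  (q.restrict h).shift_injective (by rw [shift_diff, ← restrict_shift, shift_diff])

theorem exists_locally (hz : secMap R.d₂ ⊤ z = 0) (x : X) :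
    ∃ U : Opens X, x ∈ U ∧ Nonempty (CocycleRep R z U) := by
  obtain ⟨V, h, hxV, c, b, hc, hz⟩ := R.exists_locally ⊤ z hz x trivial
  exact ⟨V, hxV, ⟨⟨c, b, hc, hz⟩⟩⟩

end CocycleRep

/-- Sections over `U` of the extension classified by `z`, as a subspace of a product: a section `l`
of `Λ` and, for each representation `q` of `z` over `W ⊆ U`, a section `m_q` of `A` over `W`. They
stand for the section that is `j_q(l) + i(m_q)` over `W`, where `j_q` is the splitting
corresponding to `q`; as `j_{q + t} = j_q + i t`, this requires `m_{q + t} = m_q - t(l)`. -/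
def twistedSections (R : HochschildResolution Λ A) (z : VecSec R.I₂ ⊤) (U : Opens X) :
    Submodule ℂ (Λ.Sec U × (∀ W : {W : Opens X // W ≤ U}, CocycleRep R z W.1 → A.Sec W.1)) where
  carrier := {g |
    (∀ (V W : {W : Opens X // W ≤ U}) (h : W.1 ≤ V.1) (q : CocycleRep R z V.1),
      A.res h (g.2 V q) = g.2 W (q.restrict h)) ∧
    ∀ (V : {W : Opens X // W ≤ U}) (q : CocycleRep R z V.1) (t : filteredCochains Λ A 1 V.1),
      g.2 V (q.shift t) = g.2 V q - ev₁ t V.1 le_rfl (Λ.res V.2 g.1)}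
  add_mem' {g g'} hg hg' :=
    ⟨fun V W h q => (map_add (A.res h) _ _).trans (congrArg₂ _ (hg.1 V W h q) (hg'.1 V W h q)),
      fun V q t => by
        change g.2 V _ + g'.2 V _ = g.2 V q + g'.2 V q - ev₁ t V.1 le_rfl (Λ.res V.2 (g.1 + g'.1))
        rw [hg.2, hg'.2, map_add, map_add, add_sub_add_comm]⟩
  zero_mem' := ⟨fun V W h q => map_zero (A.res h), fun V q t => by
    change (0 : A.Sec V.1) = 0 - ev₁ t V.1 le_rfl (Λ.res V.2 0)
    rw [map_zero, map_zero, sub_zero]⟩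
  smul_mem' r g hg :=
    ⟨fun V W h q => (map_smul (A.res h) r _).trans (congrArg _ (hg.1 V W h q)),
      fun V q t => by
        change r • g.2 V _ = r • g.2 V q - ev₁ t V.1 le_rfl (Λ.res V.2 (r • g.1))
        rw [hg.2, map_smul, map_smul, smul_sub]⟩

/-- The sections over `U` of the extension classified by `z`. Unlike `twistedSections R z U`, this
is a type of its own, to carry the multiplication twisted by the cocycles. -/
def TwistedSec (R : HochschildResolution Λ A) (z : VecSec R.I₂ ⊤) (U : Opens X) : Type u :=
  twistedSections R z U

namespace TwistedSec

variable {R : HochschildResolution Λ A} {z : VecSec R.I₂ ⊤} {U : Opens X}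

instance : AddCommGroup (TwistedSec R z U) :=
  inferInstanceAs (AddCommGroup (twistedSections R z U))

instance : Module ℂ (TwistedSec R z U) :=
  inferInstanceAs (Module ℂ (twistedSections R z U))

/-- The underlying section of `Λ`. -/
def fst (g : TwistedSec R z U) : Λ.Sec U := g.1.1

/-- The component in `A` with respect to a representation `q` of `z`. -/
def comp (g : TwistedSec R z U) (W : Opens X) (hW : W ≤ U) (q : CocycleRep R z W) :
    A.Sec W := g.1.2 ⟨W, hW⟩ q

theorem res_comp (g : TwistedSec R z U) {V W : Opens X} (hV : V ≤ U) (h : W ≤ V)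
    (q : CocycleRep R z V) : A.res h (g.comp V hV q) = g.comp W (h.trans hV) (q.restrict h) :=
  g.2.1 ⟨V, hV⟩ ⟨W, h.trans hV⟩ h q

theorem comp_shift (g : TwistedSec R z U) {V : Opens X} (hV : V ≤ U)
    (q : CocycleRep R z V) (t : filteredCochains Λ A 1 V) :
    g.comp V hV (q.shift t) = g.comp V hV q - ev₁ t V le_rfl (Λ.res hV g.fst) :=
  g.2.2 ⟨V, hV⟩ q t

theorem ext' {g g' : TwistedSec R z U} (h : g.fst = g'.fst)
    (h' : ∀ (W : Opens X) (hW : W ≤ U) (q : CocycleRep R z W), g.comp W hW q = g'.comp W hW q) :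
    g = g' :=
  Subtype.ext (Prod.ext h (funext fun W => funext fun q => h' W.1 W.2 q))

/-- The section with image `l` in `Λ` and components `m`. -/
def mk (l : Λ.Sec U) (m : ∀ (W : Opens X), W ≤ U → CocycleRep R z W → A.Sec W)
    (hres : ∀ (V W : Opens X) (hV : V ≤ U) (h : W ≤ V) (q : CocycleRep R z V),
      A.res h (m V hV q) = m W (h.trans hV) (q.restrict h))
    (hshift : ∀ (V : Opens X) (hV : V ≤ U) (q : CocycleRep R z V) (t : filteredCochains Λ A 1 V),
      m V hV (q.shift t) = m V hV q - ev₁ t V le_rfl (Λ.res hV l)) : TwistedSec R z U :=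
  ⟨(l, fun W q => m W.1 W.2 q), fun V W h q => hres V.1 W.1 V.2 h q,
    fun V q t => hshift V.1 V.2 q t⟩

/-- The product is dictated by `(j l + i m) (j l' + i m') = j(l l') + i (c(l, l') + l m' + m l')`
for a splitting `j` with curvature `c`. -/
instance : Mul (TwistedSec R z U) where
  mul g g' := mk (g.fst * g'.fst)
    (fun W hW q => ev₂ q.c W le_rfl (Λ.res hW g.fst) (Λ.res hW g'.fst) +
      Λ.res hW g.fst • g'.comp W hW q + g.comp W hW q <• Λ.res hW g'.fst)
    (fun V W hV h q => by
      rw [map_add, map_add, A.res_left, A.res_right, res_comp, res_comp, res_ev₂, algRes_algRes,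
        algRes_algRes]
      rfl)
    (fun V hV q t => by
      rw [comp_shift, comp_shift, map_mul, smul_sub, smul_sub, CocycleRep.shift_c, ev₂_add,
        ev₂_cochainD]
      abel)

theorem mul_fst (g g' : TwistedSec R z U) : (g * g').fst = g.fst * g'.fst := rfl

theorem mul_comp (g g' : TwistedSec R z U) (W : Opens X) (hW : W ≤ U)
    (q : CocycleRep R z W) : (g * g').comp W hW q =
      ev₂ q.c W le_rfl (Λ.res hW g.fst) (Λ.res hW g'.fst) +
        Λ.res hW g.fst • g'.comp W hW q + g.comp W hW q <• Λ.res hW g'.fst := rfl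

/-- The splittings `j_q` need not preserve `1`: the unit has the component `-c(1, 1)`. -/
instance : One (TwistedSec R z U) where
  one := mk 1 (fun W _ q => - ev₂ q.c W le_rfl 1 1)
    (fun V W hV h q => by
      rw [map_neg, res_ev₂, map_one]
      rfl)
    (fun V hV q t => by
      rw [map_one (Λ.res hV), CocycleRep.shift_c, ev₂_add, ev₂_cochainD, mul_one,
        one_smul, MulOpposite.op_one, one_smul]
      abel)

theorem one_fst : (1 : TwistedSec R z U).fst = 1 := rfl

theorem one_comp (W : Opens X) (hW : W ≤ U) (q : CocycleRep R z W) :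
    (1 : TwistedSec R z U).comp W hW q = - ev₂ q.c W le_rfl 1 1 := rfl

theorem add_comp (g g' : TwistedSec R z U) (W : Opens X) (hW : W ≤ U)
    (q : CocycleRep R z W) : (g + g').comp W hW q = g.comp W hW q + g'.comp W hW q := rfl

theorem smul_comp (r : ℂ) (g : TwistedSec R z U) (W : Opens X) (hW : W ≤ U)
    (q : CocycleRep R z W) : (r • g).comp W hW q = r • g.comp W hW q := rfl

theorem zero_comp (W : Opens X) (hW : W ≤ U)
    (q : CocycleRep R z W) : (0 : TwistedSec R z U).comp W hW q = 0 := rfl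

theorem add_fst (g g' : TwistedSec R z U) : (g + g').fst = g.fst + g'.fst := rfl

theorem smul_fst (r : ℂ) (g : TwistedSec R z U) : (r • g).fst = r • g.fst := rfl

theorem zero_fst : (0 : TwistedSec R z U).fst = 0 := rfl

theorem cocycle (q : CocycleRep R z U) (a b e : Λ.Sec U) :
    a • ev₂ q.c U le_rfl b e + ev₂ q.c U le_rfl a (b * e) =
      ev₂ q.c U le_rfl (a * b) e + ev₂ q.c U le_rfl a b <• e :=
  (cochainD_two_eq_zero_iff q.c).1 q.cochainD_c U le_rfl a b e

instance : Ring (TwistedSec R z U) :=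
  { (inferInstance : AddCommGroup (TwistedSec R z U)) with
    left_distrib := fun a b c => ext' (mul_add _ _ _) fun W hW q => by
      simp only [mul_comp, add_comp, add_fst, map_add, smul_add, MulOpposite.op_add, add_smul]
      abel
    right_distrib := fun a b c => ext' (add_mul _ _ _) fun W hW q => by
      simp only [mul_comp, add_comp, add_fst, map_add, smul_add, add_smul, LinearMap.add_apply]
      abel
    zero_mul := fun a => ext' (zero_mul _) fun W hW q => by
      simp only [mul_comp, zero_comp, zero_fst, map_zero, smul_zero, zero_smul,
        LinearMap.zero_apply, add_zero]
    mul_zero := fun a => ext' (mul_zero _) fun W hW q => by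
      simp only [mul_comp, zero_comp, zero_fst, map_zero, smul_zero, zero_smul,
        MulOpposite.op_zero, add_zero]
    mul_assoc := fun a b c => ext' (mul_assoc _ _ _) fun W hW q => by
      have h := cocycle q (Λ.res hW a.fst) (Λ.res hW b.fst) (Λ.res hW c.fst)
      rw [← eq_sub_iff_add_eq] at h
      simp only [mul_comp, mul_fst, map_mul, smul_add, h, mul_smul, MulOpposite.op_mul]
      rw [smul_comm (Λ.res hW a.fst) (MulOpposite.op (Λ.res hW c.fst))]
      abel
    one_mul := fun a => ext' (one_mul _) fun W hW q => by
      have h := cocycle q 1 1 (Λ.res hW a.fst)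
      rw [one_smul, one_mul, one_mul, add_right_inj] at h
      rw [mul_comp, one_fst, one_comp, map_one, h, one_smul, smul_neg]
      abel
    mul_one := fun a => ext' (mul_one _) fun W hW q => by
      have h := cocycle q (Λ.res hW a.fst) 1 1
      rw [mul_one, mul_one, MulOpposite.op_one, one_smul, add_comm, add_right_inj] at h
      rw [mul_comp, one_fst, one_comp, map_one, ← h, MulOpposite.op_one, one_smul, smul_neg]
      abel }

instance : Algebra ℂ (TwistedSec R z U) :=
  Algebra.ofModule
    (fun r a b => ext' (smul_mul_assoc _ _ _) fun W hW q => by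
      simp only [mul_comp, smul_comp, smul_fst, map_smul, LinearMap.smul_apply, smul_add,
        smul_assoc]
      rw [smul_comm r (Λ.res hW a.fst), smul_comm r (MulOpposite.op (Λ.res hW b.fst))])
    (fun r a b => ext' (mul_smul_comm _ _ _) fun W hW q => by
      simp only [mul_comp, smul_comp, smul_fst, map_smul, smul_add, MulOpposite.op_smul,
        smul_assoc]
      rw [smul_comm r (Λ.res hW a.fst), smul_comm r (MulOpposite.op (Λ.res hW b.fst))])

/-- Restriction to a smaller open set. -/
def res {U V : Opens X} (h : V ≤ U) : TwistedSec R z U →ₐ[ℂ] TwistedSec R z V :=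
  AlgHom.ofLinearMap
    { toFun := fun g => mk (Λ.res h g.fst) (fun W hW q => g.comp W (hW.trans h) q)
        (fun _ _ hV h' q => g.res_comp (hV.trans h) h' q)
        (fun V hV q t => by rw [comp_shift, algRes_algRes])
      map_add' := fun g g' => ext' (map_add (Λ.res h) _ _) fun _ _ _ => rfl
      map_smul' := fun r g => ext' (map_smul (Λ.res h) _ _) fun _ _ _ => rfl }
    (ext' (map_one (Λ.res h)) fun _ _ _ => rfl)
    (fun g g' => ext' (map_mul (Λ.res h) _ _) fun W hW q => by
      refine (g.mul_comp g' W (hW.trans h) q).trans ?_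
      rw [mul_comp]
      change _ = ev₂ q.c W le_rfl (Λ.res hW (Λ.res h g.fst)) (Λ.res hW (Λ.res h g'.fst)) +
        Λ.res hW (Λ.res h g.fst) • g'.comp W (hW.trans h) q +
          g.comp W (hW.trans h) q <• Λ.res hW (Λ.res h g'.fst)
      rw [algRes_algRes, algRes_algRes])

theorem res_fst {V : Opens X} (h : V ≤ U) (g : TwistedSec R z U) :
    (res h g).fst = Λ.res h g.fst := rfl

theorem comp_res {V : Opens X} (h : V ≤ U) (g : TwistedSec R z U) (W : Opens X)
    (hW : W ≤ V) (q : CocycleRep R z W) : (res h g).comp W hW q = g.comp W (hW.trans h) q := rfl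

end TwistedSec

/-- The presheaf of algebras `U ↦ TwistedSec R z U`. -/
noncomputable def twistedPresheaf (R : HochschildResolution Λ A) (z : VecSec R.I₂ ⊤) :
    TopCat.Presheaf (AlgCat.{u} ℂ) X where
  obj U := AlgCat.of ℂ (TwistedSec R z U.unop)
  map h := AlgCat.ofHom (TwistedSec.res h.unop.le)
  map_id _ := AlgCat.hom_ext _ (AlgHom.ext fun (_ : TwistedSec R z _) =>
    TwistedSec.ext' (algRes_self Λ.sheaf le_rfl _) fun _ _ _ => rfl)
  map_comp h h' := AlgCat.hom_ext _ (AlgHom.ext fun (g : TwistedSec R z _) =>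
    TwistedSec.ext' (algRes_algRes Λ.sheaf h.unop.le h'.unop.le g.fst).symm fun _ _ _ => rfl)

theorem twistedPresheaf_isSheaf (R : HochschildResolution Λ A) (z : VecSec R.I₂ ⊤) :
    (twistedPresheaf R z).IsSheaf := by
  rw [TopCat.Presheaf.isSheaf_iff_isSheafUniqueGluing]
  intro ι U sf hsf
  let s : ∀ i, TwistedSec R z (U i) := sf
  have hs : ∀ i j, TwistedSec.res (inf_le_left : U i ⊓ U j ≤ U i) (s i) =
      TwistedSec.res inf_le_right (s j) := hsf
  have comp_eq : ∀ i j (T : Opens X) (hi : T ≤ U i) (hj : T ≤ U j) (q : CocycleRep R z T),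
      (s i).comp T hi q = (s j).comp T hj q := fun i j T hi hj q =>
    congrArg (fun g => TwistedSec.comp g T (le_inf hi hj) q) (hs i j)
  have fst_eq : ∀ i j (T : Opens X) (hi : T ≤ U i) (hj : T ≤ U j),
      Λ.res hi (s i).fst = Λ.res hj (s j).fst := fun i j T hi hj => by
    have h1 := congrArg (fun g => Λ.res (le_inf hi hj) g.fst) (hs i j)
    rwa [TwistedSec.res_fst, TwistedSec.res_fst, algRes_algRes, algRes_algRes] at h1
  obtain ⟨l, hl, hl'⟩ := alg_glue Λ.sheaf U (iSup U) (le_iSup U) le_rfl (fun i => (s i).fst) fst_eq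
  have cov : ∀ V : Opens X, V ≤ iSup U → V ≤ iSup fun i => V ⊓ U i := fun V hV => by
    rw [← inf_iSup_eq]; exact le_inf le_rfl hV
  have glue : ∀ (W : Opens X) (hW : W ≤ iSup U) (q : CocycleRep R z W), ∃ m : A.Sec W,
      ∀ i, A.res inf_le_left m = (s i).comp (W ⊓ U i) inf_le_right (q.restrict inf_le_left) := by
    intro W hW q
    refine (vec_glue A.sheaf (fun i => W ⊓ U i) W (fun i => inf_le_left) (cov W hW) _
      fun i j T hi hj => ?_).exists
    rw [TwistedSec.res_comp, TwistedSec.res_comp, CocycleRep.restrict_restrict,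
      CocycleRep.restrict_restrict]
    exact comp_eq i j T _ _ _
  choose m hm using glue
  have m_res : ∀ (W : Opens X) (hW : W ≤ iSup U) (q : CocycleRep R z W) (i : ι) (T : Opens X)
      (hT : T ≤ W) (hi : T ≤ U i), A.res hT (m W hW q) = (s i).comp T hi (q.restrict hT) := by
    intro W hW q i T hT hi
    have h1 := congrArg (A.res (le_inf hT hi)) (hm W hW q i)
    rwa [vecRes_vecRes, TwistedSec.res_comp, CocycleRep.restrict_restrict] at h1
  have ext' : ∀ (W : Opens X) (_ : W ≤ iSup U) (a b : A.Sec W),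
      (∀ i, A.res (inf_le_left : W ⊓ U i ≤ W) a = A.res inf_le_left b) → a = b :=
    fun W hW a b => vec_ext A.sheaf (fun i => W ⊓ U i) W (fun i => inf_le_left) (cov W hW) a b
  have restrict_self : ∀ {W : Opens X} (q : CocycleRep R z W), q.restrict le_rfl = q :=
    fun q => CocycleRep.ext rfl (vecRes_self _ _ _)
  refine ⟨TwistedSec.mk l m ?_ ?_, fun i => ?_, fun g hg => ?_⟩
  · intro V W hV h q
    refine ext' W (h.trans hV) _ _ fun i => ?_
    rw [vecRes_vecRes, m_res _ _ _ i _ _ inf_le_right, m_res _ _ _ i _ _ inf_le_right,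
      CocycleRep.restrict_restrict]
  · intro V hV q t
    refine ext' V hV _ _ fun i => ?_
    rw [map_sub, m_res _ _ _ i _ _ inf_le_right, m_res _ _ _ i _ _ inf_le_right,
      CocycleRep.restrict_shift, TwistedSec.comp_shift, res_ev₁, algRes_algRes, ← hl i,
      algRes_algRes]
    rfl
  · refine TwistedSec.ext' (hl i) fun W hW q => ?_
    refine (vecRes_self A.sheaf le_rfl _).symm.trans ?_
    refine (m_res W _ q i W le_rfl hW).trans ?_
    rw [restrict_self]
  · have hg' : ∀ i, TwistedSec.res (le_iSup U i) g = s i := hg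
    refine TwistedSec.ext' (hl' _ fun i => congrArg (fun g => g.fst) (hg' i))
      fun W hW q => ?_
    refine ext' W hW _ _ fun i => ?_
    refine (TwistedSec.res_comp g hW inf_le_left q).trans ?_
    refine Eq.trans ?_ (m_res W hW q i _ inf_le_left inf_le_right).symm
    rw [← hg' i]
    rfl

end FilteredDeformation

/-! ### The extension attached to a closed section: filtration and splittings -/

namespace FilteredDeformation
variable {X : TopCat.{u}} {Λ : FilteredAlgebraSheaf X} {A : FilteredBimoduleSheaf Λ}

open scoped RightActions

theorem SheafFiltration.step_mono {F : Opens X → Type u}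
    [∀ U, AddCommGroup (F U)] [∀ U, Module ℂ (F U)]
    {res : ∀ ⦃U V : Opens X⦄, V ≤ U → F U →ₗ[ℂ] F V} (f : SheafFiltration F res) (U : Opens X) :
    Monotone fun n => f.step n U :=
  monotone_nat_of_le_succ fun n => f.mono n U

namespace TwistedSec

variable {R : HochschildResolution Λ A} {z : VecSec R.I₂ ⊤} {U : Opens X}

/-- The inclusion of `A`. -/
def incl (R : HochschildResolution Λ A) (z : VecSec R.I₂ ⊤) (U : Opens X) :
    A.Sec U →ₗ[ℂ] TwistedSec R z U where
  toFun a := mk 0 (fun _ hW _ => A.res hW a) (fun _ _ _ _ _ => vecRes_vecRes _ _ _ _)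
    (fun _ _ _ _ => by rw [map_zero, map_zero, sub_zero])
  map_add' a a' := ext' (add_zero _).symm fun _ hW _ => map_add (A.res hW) _ _
  map_smul' r a := ext' (smul_zero _).symm fun _ hW _ => map_smul (A.res hW) _ _

theorem incl_fst (a : A.Sec U) : (incl R z U a).fst = 0 := rfl

theorem incl_comp (a : A.Sec U) (W : Opens X) (hW : W ≤ U) (q : CocycleRep R z W) :
    (incl R z U a).comp W hW q = A.res hW a := rfl

theorem incl_mul (a : A.Sec U) (g : TwistedSec R z U) :
    incl R z U a * g = incl R z U (a <• g.fst) :=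
  ext' (zero_mul _) fun W hW q => by
    rw [mul_comp, incl_fst, incl_comp, incl_comp, map_zero, map_zero, LinearMap.zero_apply,
      zero_smul, zero_add, zero_add, A.res_right]

theorem mul_incl (a : A.Sec U) (g : TwistedSec R z U) :
    g * incl R z U a = incl R z U (g.fst • a) :=
  ext' (mul_zero _) fun W hW q => by
    rw [mul_comp, incl_fst, incl_comp, incl_comp, map_zero, map_zero, MulOpposite.op_zero,
      zero_smul, zero_add, add_zero, A.res_left]

/-- The projection to `Λ`. -/
def proj (R : HochschildResolution Λ A) (z : VecSec R.I₂ ⊤) (U : Opens X) :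
    TwistedSec R z U →ₐ[ℂ] Λ.Sec U :=
  AlgHom.ofLinearMap ⟨⟨fst, fun _ _ => rfl⟩, fun _ _ => rfl⟩ rfl fun _ _ => rfl

/-- The filtration: the sections all of whose components have degree at most `n`. -/
def fil (R : HochschildResolution Λ A) (z : VecSec R.I₂ ⊤) (n : ℕ) (U : Opens X) :
    Submodule ℂ (TwistedSec R z U) where
  carrier := {g | g.fst ∈ Λ.fil n U ∧ ∀ (W : Opens X) (hW : W ≤ U) (q : CocycleRep R z W),
    g.comp W hW q ∈ A.fil n W}
  add_mem' hg hg' := ⟨add_mem hg.1 hg'.1, fun W hW q => add_mem (hg.2 W hW q) (hg'.2 W hW q)⟩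
  zero_mem' := ⟨zero_mem _, fun _ _ _ => zero_mem _⟩
  smul_mem' r _ hg := ⟨Submodule.smul_mem _ r hg.1,
    fun W hW q => Submodule.smul_mem _ r (hg.2 W hW q)⟩

theorem mul_mem_fil {m n : ℕ} {g g' : TwistedSec R z U} (hg : g ∈ fil R z m U)
    (hg' : g' ∈ fil R z n U) : g * g' ∈ fil R z (m + n) U :=
  ⟨Λ.mul_mem _ _ _ _ _ hg.1 hg'.1, fun W hW q => by
    have h := Λ.filtration.res_mem m hW _ hg.1
    have h' := Λ.filtration.res_mem n hW _ hg'.1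
    exact add_mem (add_mem (ev₂_mem _ _ _ _ _ _ h h') (A.left_mem _ _ _ _ _ h (hg'.2 W hW q)))
      (A.right_mem _ _ _ _ _ h' (hg.2 W hW q))⟩

theorem res_mem_fil {n : ℕ} {g : TwistedSec R z U} (hg : g ∈ fil R z n U) {V : Opens X}
    (h : V ≤ U) : res h g ∈ fil R z n V :=
  ⟨Λ.filtration.res_mem n h _ hg.1, fun W hW q => hg.2 W (hW.trans h) q⟩

theorem mem_fil_of_locally (n : ℕ) (g : TwistedSec R z U)
    (h : ∀ x ∈ U, ∃ (V : Opens X) (h : V ≤ U), x ∈ V ∧ res h g ∈ fil R z n V) :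
    g ∈ fil R z n U := by
  refine ⟨Λ.filtration.mem_of_locally n U _ fun x hx => ?_,
    fun W hW q => A.filtration.mem_of_locally n W _ fun x hx => ?_⟩
  · obtain ⟨V, h, hxV, hg⟩ := h x hx
    exact ⟨V, h, hxV, hg.1⟩
  · obtain ⟨V, h, hxV, hg⟩ := h x (hW hx)
    refine ⟨W ⊓ V, inf_le_left, ⟨hx, hxV⟩, ?_⟩
    have h1 := hg.2 (W ⊓ V) inf_le_right (q.restrict inf_le_left)
    rw [comp_res] at h1
    change A.res inf_le_left (g.comp W hW q) ∈ A.fil n (W ⊓ V)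
    rwa [res_comp]

/-- The filtration can be tested on the components with respect to a single representation, since
the 1-cochains preserve filtrations. -/
theorem mem_fil_of_comp_mem {n : ℕ} {g : TwistedSec R z U} (q : CocycleRep R z U)
    (h : g.fst ∈ Λ.fil n U) (h' : g.comp U le_rfl q ∈ A.fil n U) : g ∈ fil R z n U := by
  refine ⟨h, fun W hW q' => ?_⟩
  obtain ⟨t, rfl⟩ := (q.restrict hW).exists_eq_shift q'
  rw [comp_shift, ← res_comp g le_rfl hW]
  exact sub_mem (A.filtration.res_mem n hW _ h')
    (ev₁_mem t le_rfl n _ (Λ.filtration.res_mem n hW _ h))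

theorem exists_res_mem_fil (hz : secMap R.d₂ ⊤ z = 0) (g : TwistedSec R z U) (x : X)
    (hx : x ∈ U) : ∃ (V : Opens X) (h : V ≤ U), x ∈ V ∧ ∃ n, res h g ∈ fil R z n V := by
  obtain ⟨V, hxV, ⟨q⟩⟩ := CocycleRep.exists_locally hz x
  obtain ⟨W, hW, hxW, m, hm⟩ := Λ.filtration.exhaustive U g.fst x hx
  obtain ⟨W', hW', hxW', n, hn⟩ := A.filtration.exhaustive (U ⊓ V)
    (g.comp (U ⊓ V) inf_le_left (q.restrict inf_le_right)) x ⟨hx, hxV⟩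
  have hT : W ⊓ W' ≤ U := inf_le_left.trans hW
  refine ⟨W ⊓ W', hT, ⟨hxW, hxW'⟩, max m n, mem_fil_of_comp_mem
    (q.restrict (inf_le_right.trans (hW'.trans inf_le_right))) ?_ ?_⟩
  · have h1 := Λ.filtration.res_mem m (inf_le_left : W ⊓ W' ≤ W) _ hm
    have h2 : Λ.res inf_le_left (Λ.res hW g.fst) ∈ Λ.fil m (W ⊓ W') := h1
    rw [algRes_algRes] at h2
    exact Λ.filtration.step_mono _ (le_max_left m n) h2
  · have h1 := A.filtration.res_mem n (inf_le_right : W ⊓ W' ≤ W') _ hn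
    rw [vecRes_vecRes, res_comp, CocycleRep.restrict_restrict] at h1
    exact A.filtration.step_mono _ (le_max_right m n) h1

/-- The section `j_q l` with component `0` with respect to `q`. -/
noncomputable def lift {U : Opens X} (q : CocycleRep R z U) {V : Opens X} (hV : V ≤ U) :
    Λ.Sec V →ₗ[ℂ] TwistedSec R z V where
  toFun l := mk l (fun W hW q' => - ev₁ ((q.restrict (hW.trans hV)).diff q') W le_rfl (Λ.res hW l))
    (fun V' W hV' h q' => by
      rw [map_neg, res_ev₁, algRes_algRes, ← CocycleRep.restrict_restrict q (hV'.trans hV) h,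
        ← CocycleRep.restrict_diff]
      rfl)
    (fun V' hV' q' t => by
      rw [CocycleRep.diff_shift, ev₁_add]
      abel)
  map_add' l l' := ext' rfl fun W hW q' => by
    let t := (q.restrict (hW.trans hV)).diff q'
    change - ev₁ t W le_rfl (Λ.res hW (l + l')) =
      - ev₁ t W le_rfl (Λ.res hW l) + - ev₁ t W le_rfl (Λ.res hW l')
    rw [map_add, map_add, neg_add]
  map_smul' r l := ext' rfl fun W hW q' => by
    let t := (q.restrict (hW.trans hV)).diff q'
    change - ev₁ t W le_rfl (Λ.res hW (r • l)) = r • (- ev₁ t W le_rfl (Λ.res hW l))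
    rw [map_smul, map_smul, smul_neg]

theorem lift_fst (q : CocycleRep R z U) {V : Opens X} (hV : V ≤ U) (l : Λ.Sec V) :
    (lift q hV l).fst = l := rfl

theorem lift_comp (q : CocycleRep R z U) {V : Opens X} (hV : V ≤ U) (l : Λ.Sec V) (W : Opens X)
    (hW : W ≤ V) (q' : CocycleRep R z W) : (lift q hV l).comp W hW q' =
      - ev₁ ((q.restrict (hW.trans hV)).diff q') W le_rfl (Λ.res hW l) := rfl

theorem lift_comp_self (q : CocycleRep R z U) {V : Opens X} (hV : V ≤ U) (l : Λ.Sec V)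
    (W : Opens X) (hW : W ≤ V) :
    (lift q hV l).comp W hW (q.restrict (hW.trans hV)) = 0 := by
  rw [lift_comp, CocycleRep.diff_self, ev₁_zero, neg_zero]

/-- Sections over an open set with a representation `q` are determined by their images in `Λ`
and their components with respect to `q`. -/
theorem ext_of_comp {q : CocycleRep R z U} {g g' : TwistedSec R z U} (h : g.fst = g'.fst)
    (h' : g.comp U le_rfl q = g'.comp U le_rfl q) : g = g' := by
  refine ext' h fun W hW q' => ?_
  obtain ⟨t, rfl⟩ := (q.restrict hW).exists_eq_shift q'
  rw [comp_shift, comp_shift, ← res_comp g le_rfl hW, ← res_comp g' le_rfl hW, h, h']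

end TwistedSec

/-- The sheaf of algebras of the extension classified by a closed section `z` of `I²`. -/
noncomputable def twistedAlgebra (R : HochschildResolution Λ A) (z : VecSec R.I₂ ⊤)
    (hz : secMap R.d₂ ⊤ z = 0) : FilteredAlgebraSheaf X where
  sheaf := ⟨twistedPresheaf R z, twistedPresheaf_isSheaf R z⟩
  filtration :=
    { step := TwistedSec.fil R z
      mono := fun n U _ hg => ⟨Λ.filtration.mono n U hg.1,
        fun W hW q => A.filtration.mono n W (hg.2 W hW q)⟩
      res_mem := fun _ _ _ h _ hg => TwistedSec.res_mem_fil hg h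
      mem_of_locally := fun n _ => TwistedSec.mem_fil_of_locally n
      exhaustive := fun _ g x hx => TwistedSec.exists_res_mem_fil hz g x hx }
  mul_mem _ _ _ _ _ hg hg' := TwistedSec.mul_mem_fil hg hg'

namespace FilteredExtension

variable {R : HochschildResolution Λ A} {z : VecSec R.I₂ ⊤}

/-- The extension classified by a closed section `z` of `I²`. -/
noncomputable def twisted (hz : secMap R.d₂ ⊤ z = 0) : FilteredExtension Λ A where
  Γ := twistedAlgebra R z hz
  i U := TwistedSec.incl R z U
  p U := TwistedSec.proj R z U
  i_res U V h a := TwistedSec.ext' (U := V) (map_zero (Λ.res h)).symm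
    fun W hW q => vecRes_vecRes A.sheaf h hW a
  p_res _ _ _ _ := rfl
  i_injective U := by
    refine (injective_iff_map_eq_zero (TwistedSec.incl R z U)).2 fun a ha => ?_
    refine vec_ext_locally A.sheaf U _ _ fun x hx => ?_
    obtain ⟨V, hxV, ⟨q⟩⟩ := CocycleRep.exists_locally hz x
    refine ⟨U ⊓ V, inf_le_left, ⟨hx, hxV⟩, ?_⟩
    exact (congrArg (fun g => TwistedSec.comp g (U ⊓ V) inf_le_left (q.restrict inf_le_right))
      ha).trans (map_zero (A.res inf_le_left)).symm
  exact U g := by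
    change TwistedSec R z U at g
    constructor
    · intro hg
      have hg : g.fst = 0 := hg
      obtain ⟨a, ha⟩ := vec_exists_of_locally A.sheaf U
        (fun W hW s => ∃ q : CocycleRep R z W, s = g.comp W hW q)
        (fun W W' hW h s ⟨q, hq⟩ => ⟨q.restrict h, by rw [hq]; exact g.res_comp hW h q⟩)
        (fun W hW s s' ⟨q, hq⟩ ⟨q', hq'⟩ => by
          obtain ⟨t, rfl⟩ := q.exists_eq_shift q'
          rw [hq, hq', g.comp_shift, hg, map_zero, map_zero, sub_zero])
        (fun x hx => by
          obtain ⟨V, hxV, ⟨q⟩⟩ := CocycleRep.exists_locally hz x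
          exact ⟨U ⊓ V, inf_le_left, ⟨hx, hxV⟩, _, q.restrict inf_le_right, rfl⟩)
      exact ⟨a, TwistedSec.ext' (U := U) hg.symm fun W hW q => ha W hW _ ⟨q, rfl⟩⟩
    · rintro ⟨a, rfl⟩
      rfl
  p_locally_surjective U l x hx := by
    obtain ⟨V, hxV, ⟨q⟩⟩ := CocycleRep.exists_locally hz x
    exact ⟨U ⊓ V, inf_le_left, ⟨hx, hxV⟩, TwistedSec.lift q inf_le_right (Λ.res inf_le_left l), rfl⟩
  square_zero U a b := (TwistedSec.incl_mul a _).trans ((congrArg (TwistedSec.incl R z U)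
    ((congrArg (MulOpposite.op · • a) (TwistedSec.incl_fst b)).trans (zero_smul _ a))).trans
      (map_zero (TwistedSec.incl R z U)))
  left_mul _ g a := TwistedSec.mul_incl a g
  right_mul _ g a := TwistedSec.incl_mul a g
  i_mem_iff n U a := by
    constructor
    · intro h
      refine A.filtration.mem_of_locally n U a fun x hx => ?_
      obtain ⟨V, hxV, ⟨q⟩⟩ := CocycleRep.exists_locally hz x
      exact ⟨U ⊓ V, inf_le_left, ⟨hx, hxV⟩, h.2 (U ⊓ V) inf_le_left (q.restrict inf_le_right)⟩
    · intro h
      exact ⟨zero_mem _, fun W hW _ => A.filtration.res_mem n hW a h⟩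
  p_mem _ _ _ hg := hg.1

/-- The splitting `j_q` of the extension classified by `z`. Its curvature is the cocycle of `q`. -/
noncomputable def twistedSplitting (hz : secMap R.d₂ ⊤ z = 0) {U : Opens X}
    (q : CocycleRep R z U) : (twisted hz).LinearSplitting U where
  j _ hV := TwistedSec.lift q hV
  j_res V W hV h l := TwistedSec.ext' (U := W) rfl fun W' hW' q' =>
    congrArg Neg.neg (congrArg _ (algRes_algRes Λ.sheaf h hW' l))
  p_j _ _ _ := rfl
  j_mem n V hV l hl := TwistedSec.mem_fil_of_comp_mem (q.restrict hV) hl (by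
    have h1 := TwistedSec.lift_comp_self q hV l V le_rfl
    have h2 : (0 : A.Sec V) ∈ A.fil n V := zero_mem _
    rwa [← h1] at h2)

theorem twisted_isLocallyTrivial (hz : secMap R.d₂ ⊤ z = 0) :
    (twisted hz).IsLocallyTrivial := fun x => by
  obtain ⟨V, hxV, ⟨q⟩⟩ := CocycleRep.exists_locally hz x
  exact ⟨V, hxV, ⟨twistedSplitting hz q⟩⟩

theorem curv_twistedSplitting (hz : secMap R.d₂ ⊤ z = 0) {U : Opens X} (q : CocycleRep R z U) :
    (twistedSplitting hz q).curv = q.c :=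
  LinearSplitting.curv_eq _ _ fun V hV l l' => by
    rw [eq_sub_iff_add_eq]
    refine TwistedSec.ext_of_comp (q := q.restrict hV) (zero_add _) ?_
    refine (congrArg₂ (· + ·) (vecRes_self A.sheaf le_rfl _)
      (TwistedSec.lift_comp_self q hV _ V le_rfl)).trans ?_
    refine Eq.trans ?_ (TwistedSec.mul_comp (TwistedSec.lift q hV l) (TwistedSec.lift q hV l')
      V le_rfl (q.restrict hV)).symm
    rw [TwistedSec.lift_comp_self q hV l V le_rfl, TwistedSec.lift_comp_self q hV l' V le_rfl,
      smul_zero, smul_zero, TwistedSec.lift_fst, TwistedSec.lift_fst, algRes_self, algRes_self]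
    simp only [add_zero]
    rfl

theorem twistedSplitting_restrict (hz : secMap R.d₂ ⊤ z = 0) {U V : Opens X}
    (q : CocycleRep R z U) (h : V ≤ U) :
    (twistedSplitting hz q).restrict h = twistedSplitting hz (q.restrict h) :=
  LinearSplitting.ext' fun W hW l => TwistedSec.ext' (U := W) rfl fun W' hW' q' => by
    refine (TwistedSec.lift_comp q (hW.trans h) l W' hW' q').trans ?_
    refine Eq.trans ?_ (TwistedSec.lift_comp (q.restrict h) hW l W' hW' q').symm
    rw [CocycleRep.restrict_restrict]

theorem twistedSplitting_shift (hz : secMap R.d₂ ⊤ z = 0) {U : Opens X}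
    (q : CocycleRep R z U) (t : filteredCochains Λ A 1 U) :
    twistedSplitting hz (q.shift t) = (twistedSplitting hz q).add t :=
  LinearSplitting.ext' fun V hV l => by
    refine TwistedSec.ext_of_comp (q := (q.shift t).restrict hV) (add_zero _).symm ?_
    refine (TwistedSec.lift_comp_self (q.shift t) hV l V le_rfl).trans ?_
    change 0 = TwistedSec.comp (TwistedSec.lift q hV l) V le_rfl ((q.shift t).restrict hV) +
      A.res le_rfl (ev₁ t V hV l)
    rw [CocycleRep.restrict_shift, TwistedSec.comp_shift, TwistedSec.lift_comp_self q hV l V le_rfl,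
      vecRes_self, TwistedSec.lift_fst, algRes_self, zero_sub, ev₁_restrict, neg_add_cancel]

/-- The extension `twisted hz` has a potential for `z`. By `exists_potential` it has one for some
`y`, and its differences with `b` at the splittings `j_q`, `q = (c, b)`, glue to a global section `β`
of `I¹` with `y + d β = z`. -/
theorem nonempty_potential_twisted (hz : secMap R.d₂ ⊤ z = 0) :
    Nonempty (Potential R (twisted hz) z) := by
  obtain ⟨y, -, ⟨P⟩⟩ := exists_potential R (twisted hz) (twisted_isLocallyTrivial hz)
  obtain ⟨β, hβ⟩ := vec_exists_of_locally R.I₁ ⊤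
    (fun U _ s => ∃ q : CocycleRep R z U, s = q.b - P.b U (twistedSplitting hz q))
    (fun W W' hW h s ⟨q, hq⟩ => ⟨q.restrict h, by
      rw [hq, map_sub, P.res_b, twistedSplitting_restrict]
      rfl⟩)
    (fun W hW s s' ⟨q, hq⟩ ⟨q', hq'⟩ => by
      obtain ⟨t, rfl⟩ := q.exists_eq_shift q'
      rw [hq, hq', twistedSplitting_shift, P.b_add]
      exact (sub_sub_sub_cancel_right _ _ _).symm)
    (fun x _ => by
      obtain ⟨V, hxV, ⟨q⟩⟩ := CocycleRep.exists_locally hz x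
      exact ⟨V, le_top, hxV, _, q, rfl⟩)
  have key : y + secMap R.d₁ ⊤ β = z := by
    refine vec_ext_locally R.I₂ ⊤ _ _ fun x _ => ?_
    obtain ⟨V, hxV, ⟨q⟩⟩ := CocycleRep.exists_locally hz x
    refine ⟨V, le_top, hxV, ?_⟩
    rw [map_add, ← secMap_res, hβ V le_top _ ⟨q, rfl⟩, P.res_eq V (twistedSplitting hz q),
      curv_twistedSplitting, q.res_eq, map_sub]
    abel
  exact ⟨key ▸ P.shift β⟩

end FilteredExtension

end FilteredDeformation

/-! ### Equivalence, multiples, Baer sums and split extensions -/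

namespace FilteredDeformation
variable {X : TopCat.{u}} {Λ : FilteredAlgebraSheaf X} {A : FilteredBimoduleSheaf Λ}

namespace FilteredExtension

variable {ξ η ζ : FilteredExtension Λ A} {c d : ℂ}

/-- Linear combinations of extensions are detected by their classes in `ℍ²`. -/
theorem nonempty_combinationHom_iff {R : HochschildResolution Λ A} {z w y : VecSec R.I₂ ⊤}
    (hξ : ξ.IsLocallyTrivial) (hη : η.IsLocallyTrivial) (hζ : ζ.IsLocallyTrivial)
    (P : Potential R ξ z) (Q : Potential R η w) (S : Potential R ζ y) :
    Nonempty (CombinationHom c d ξ η ζ) ↔ ∃ β, secMap R.d₁ ⊤ β = y - (c • z + d • w) := by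
  refine ⟨fun ⟨σ⟩ => exists_d₁_eq_of_combinationHom hξ hη σ P Q S, fun ⟨β, hβ⟩ => ?_⟩
  have h : y + secMap R.d₁ ⊤ (-β) = c • z + d • w := by
    rw [map_neg, hβ]
    abel
  exact nonempty_combinationHom hξ hη hζ P Q (h ▸ S.shift (-β))

theorem isBaerSum_iff : IsBaerSum ξ η ζ ↔ Nonempty (CombinationHom 1 1 ξ η ζ) :=
  ⟨fun ⟨σ⟩ => ⟨⟨σ.σ, σ.σ_res, σ.σ_mem, fun U a b z hz => by
      rw [σ.σ_i U a b z hz, one_smul, one_smul], σ.p_σ⟩⟩,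
    fun ⟨σ⟩ => ⟨⟨σ.σ, σ.σ_res, σ.σ_mem, fun U a b z hz => by
      rw [σ.σ_i U a b z hz, one_smul, one_smul], σ.p_σ⟩⟩⟩

/-- The diagonal of `Γ_ξ ×_Λ Γ_ξ`. -/
def diagonal (ξ : FilteredExtension Λ A) (U : Opens X) : ξ.Γ.Sec U →ₐ[ℂ] fiberProduct ξ ξ U :=
  (AlgHom.prod (AlgHom.id ℂ _) (AlgHom.id ℂ _)).codRestrict (fiberProduct ξ ξ U)
    fun _ => mem_fiberProduct rfl

/-- A multiple of `ξ` is a linear combination of two copies of `ξ`. -/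
theorem isScalarMultiple_iff :
    IsScalarMultiple c ξ ζ ↔ Nonempty (CombinationHom c 0 ξ ξ ζ) := by
  constructor
  · rintro ⟨φ⟩
    refine ⟨⟨fun U => (φ.φ U).comp ((AlgHom.fst ℂ _ _).comp (fiberProduct ξ ξ U).val),
      fun U V h z w hw => ?_, fun n U z h _ => φ.φ_mem n U _ h, fun U a b z hz => ?_,
      fun U z => φ.p_φ U _⟩⟩
    · exact (congrArg (fun x => φ.φ V x.1) hw).trans (φ.φ_res h _)
    · refine (congrArg (fun x => φ.φ U x.1) hz).trans ((φ.φ_i U a).trans ?_)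
      rw [zero_smul, add_zero]
  · rintro ⟨σ⟩
    exact ⟨⟨fun U => (σ.σ U).comp (ξ.diagonal U), fun U V h g => σ.σ_res h _ _ rfl,
      fun n U g hg => σ.σ_mem n U _ hg hg,
      fun U a => (σ.σ_i U a a _ rfl).trans (by rw [zero_smul, add_zero]),
      fun U g => σ.p_σ U _⟩⟩

/-- A splitting `j` yields the endomorphism `j p` of the extension over `Λ`, which vanishes on `A`.
Conversely, an endomorphism over `Λ` that vanishes on `A` descends along the locally surjective
morphism `p`, to a splitting. -/
theorem isSplit_iff (hξ : ξ.IsLocallyTrivial) : ξ.IsSplit ↔ IsScalarMultiple 0 ξ ξ := by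
  constructor
  · rintro ⟨j⟩
    refine ⟨⟨fun U => (j.j U).comp (ξ.p U), fun U V h g => ?_,
      fun n U g hg => j.j_mem n U _ (ξ.p_mem n U g hg), fun U a => ?_, fun U g => j.p_j U _⟩⟩
    · exact (congrArg (j.j V) (ξ.p_res h g)).trans (j.j_res h _)
    · refine (congrArg (j.j U) (ξ.p_i U a)).trans ?_
      rw [map_zero, zero_smul, map_zero]
  · rintro ⟨φ⟩
    have φ_eq : ∀ (U : Opens X) (g g' : ξ.Γ.Sec U), ξ.p U g = ξ.p U g' → φ.φ U g = φ.φ U g' := by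
      intro U g g' h
      obtain ⟨a, ha⟩ := (ξ.exact U (g - g')).1 (by rw [map_sub, h, sub_self])
      rw [← sub_eq_zero, ← map_sub, ← ha, φ.φ_i, zero_smul, map_zero]
    have glue : ∀ (U : Opens X) (l : Λ.Sec U), ∃ t : ξ.Γ.Sec U, ∀ (W : Opens X) (hW : W ≤ U)
        (g : ξ.Γ.Sec W), ξ.p W g = Λ.res hW l → ξ.Γ.res hW t = φ.φ W g := by
      intro U l
      obtain ⟨t, ht⟩ := alg_exists_of_locally ξ.Γ.sheaf U
        (fun W hW s => ∃ g, ξ.p W g = Λ.res hW l ∧ s = φ.φ W g)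
        (fun W W' hW h s ⟨g, hg, hs⟩ => ⟨ξ.Γ.res h g, by rw [ξ.p_res, hg, algRes_algRes], by
          rw [hs, φ.φ_res]⟩)
        (fun W hW s s' ⟨g, hg, hs⟩ ⟨g', hg', hs'⟩ => by
          rw [hs, hs', φ_eq W g g' (hg.trans hg'.symm)])
        (fun x hx => by
          obtain ⟨V, h, hxV, g, hg⟩ := ξ.p_locally_surjective U l x hx
          exact ⟨V, h, hxV, _, g, hg, rfl⟩)
      exact ⟨t, fun W hW g hg => ht W hW _ ⟨g, hg, rfl⟩⟩
    choose j hj using glue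
    have j_eq : ∀ (U : Opens X) (l : Λ.Sec U) (t : ξ.Γ.Sec U),
        (∀ (W : Opens X) (hW : W ≤ U) (J : ξ.LinearSplitting W),
          ξ.Γ.res hW t = φ.φ W (J.j W le_rfl (Λ.res hW l))) → j U l = t := by
      intro U l t ht
      refine alg_ext_locally ξ.Γ.sheaf U _ _ fun x hx => ?_
      obtain ⟨V, hxV, ⟨J⟩⟩ := hξ x
      refine ⟨U ⊓ V, inf_le_left, ⟨hx, hxV⟩, ?_⟩
      exact (hj U l (U ⊓ V) inf_le_left _ ((J.restrict inf_le_right).p_j (U ⊓ V) le_rfl _)).trans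
        (ht _ _ (J.restrict inf_le_right)).symm
    refine ⟨⟨fun U =>
      { toFun := j U
        map_one' := j_eq U 1 1 fun W hW J => ?_
        map_mul' := fun l l' => j_eq U _ _ fun W hW J => ?_
        map_zero' := j_eq U 0 0 fun W hW J => ?_
        map_add' := fun l l' => j_eq U _ _ fun W hW J => ?_
        commutes' := fun r => j_eq U _ _ fun W hW J => ?_ }, fun U V h l => ?_, fun U l => ?_,
      fun n U l hl => ?_⟩⟩
    · rw [map_one, ← map_one (φ.φ W)]
      exact φ_eq W _ _ (by rw [J.p_j, map_one, map_one])
    · rw [map_mul, hj U l W hW _ (J.p_j W le_rfl _), hj U l' W hW _ (J.p_j W le_rfl _), ← map_mul]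
      exact φ_eq W _ _ (by rw [map_mul, J.p_j, J.p_j, J.p_j, map_mul])
    · rw [map_zero, map_zero, map_zero, map_zero]
    · rw [map_add, hj U l W hW _ (J.p_j W le_rfl _), hj U l' W hW _ (J.p_j W le_rfl _), ← map_add]
      exact φ_eq W _ _ (by rw [map_add, J.p_j, J.p_j, J.p_j, map_add])
    · rw [AlgHom.commutes, ← AlgHom.commutes (φ.φ W)]
      exact φ_eq W _ _ (by rw [J.p_j, AlgHom.commutes, AlgHom.commutes])
    · refine j_eq V _ _ fun W hW J => ?_
      rw [algRes_algRes, algRes_algRes]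
      exact hj U l W (hW.trans h) _ (J.p_j W le_rfl _)
    · refine alg_ext_locally Λ.sheaf U _ _ fun x hx => ?_
      obtain ⟨V, hxV, ⟨J⟩⟩ := hξ x
      refine ⟨U ⊓ V, inf_le_left, ⟨hx, hxV⟩, ?_⟩
      refine (ξ.p_res inf_le_left (j U l)).symm.trans ?_
      rw [hj U l (U ⊓ V) inf_le_left _ ((J.restrict inf_le_right).p_j (U ⊓ V) le_rfl _), φ.p_φ,
        (J.restrict inf_le_right).p_j]
    · refine ξ.Γ.filtration.mem_of_locally n U (j U l) fun x hx => ?_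
      obtain ⟨V, hxV, ⟨J⟩⟩ := hξ x
      refine ⟨U ⊓ V, inf_le_left, ⟨hx, hxV⟩, ?_⟩
      have h1 := φ.φ_mem n (U ⊓ V) _ ((J.restrict inf_le_right).j_mem n (U ⊓ V) le_rfl _
        (Λ.filtration.res_mem n inf_le_left l hl))
      have h2 := hj U l (U ⊓ V) inf_le_left _
        ((J.restrict inf_le_right).p_j (U ⊓ V) le_rfl (Λ.res inf_le_left l))
      exact (congrArg (· ∈ ξ.Γ.fil n (U ⊓ V)) h2).mpr h1

end FilteredExtension

end FilteredDeformation

open FilteredDeformation in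
theorem mainTheorem4 {X : TopCat.{u}} [ParacompactSpace X]
    (Λ : FilteredAlgebraSheaf X) (A : FilteredBimoduleSheaf Λ) :
    ∃ (_ : AddCommGroup (Exal Λ A)) (_ : Module ℂ (Exal Λ A)),
      (∀ ξ η ζ : LocallyTrivialExtension Λ A,
        FilteredExtension.IsBaerSum ξ.1 η.1 ζ.1 ↔ Exal.mk ζ = Exal.mk ξ + Exal.mk η) ∧
      (∀ (c : ℂ) (ξ ζ : LocallyTrivialExtension Λ A),
        FilteredExtension.IsScalarMultiple c ξ.1 ζ.1 ↔ Exal.mk ζ = c • Exal.mk ξ) ∧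
      (∀ ξ : LocallyTrivialExtension Λ A, ξ.1.IsSplit ↔ Exal.mk ξ = 0) ∧
      Nonempty (Exal Λ A ≃ₗ[ℂ] hypercohomology (brutalTruncation (hochschildComplex Λ A)) 2) := by
  obtain ⟨R, π, hπ, hπ0⟩ := exists_hochschildResolution Λ A
  choose z hz P using fun ξ : LocallyTrivialExtension Λ A =>
    FilteredExtension.exists_potential R ξ.1 ξ.2
  let cls (ξ : LocallyTrivialExtension Λ A) :
      hypercohomology (brutalTruncation (hochschildComplex Λ A)) 2 := π ⟨z ξ, hz ξ⟩
  have hom_iff : ∀ (c d : ℂ) (ξ η ζ : LocallyTrivialExtension Λ A),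
      Nonempty (FilteredExtension.CombinationHom c d ξ.1 η.1 ζ.1) ↔
        cls ζ = c • cls ξ + d • cls η := by
    intro c d ξ η ζ
    obtain ⟨P₁⟩ := P ξ
    obtain ⟨P₂⟩ := P η
    obtain ⟨P₃⟩ := P ζ
    rw [FilteredExtension.nonempty_combinationHom_iff ξ.2 η.2 ζ.2 P₁ P₂ P₃, ← sub_eq_zero,
      ← map_smul, ← map_smul, ← map_add, ← map_sub, hπ0]
    rfl
  have multiple_iff : ∀ (c : ℂ) (ξ ζ : LocallyTrivialExtension Λ A),
      FilteredExtension.IsScalarMultiple c ξ.1 ζ.1 ↔ cls ζ = c • cls ξ := fun c ξ ζ => by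
    rw [FilteredExtension.isScalarMultiple_iff, hom_iff, zero_smul, add_zero]
  have equiv_iff : ∀ ξ ζ : LocallyTrivialExtension Λ A,
      Exal.mk ξ = Exal.mk ζ ↔ cls ξ = cls ζ := fun ξ ζ => by
    refine Quotient.eq.trans ((multiple_iff 1 ξ ζ).trans ?_)
    rw [one_smul, eq_comm]
  -- `F` maps the class of an extension to the class of the section for which it has a potential.
  let F : Exal Λ A → hypercohomology (brutalTruncation (hochschildComplex Λ A)) 2 :=
    Quotient.lift cls fun ξ ζ h => (equiv_iff ξ ζ).1 (Quotient.sound h)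
  have hF : ∀ ξ, F (Exal.mk ξ) = cls ξ := fun _ => rfl
  have F_bij : Function.Bijective F := by
    constructor
    · rintro ⟨ξ⟩ ⟨ζ⟩ h
      exact (equiv_iff ξ ζ).2 h
    · intro x
      obtain ⟨⟨y, hy⟩, rfl⟩ := hπ x
      let ξ : LocallyTrivialExtension Λ A :=
        ⟨FilteredExtension.twisted hy, FilteredExtension.twisted_isLocallyTrivial hy⟩
      obtain ⟨P₁⟩ := P ξ
      obtain ⟨P₂⟩ := FilteredExtension.nonempty_potential_twisted hy
      refine ⟨Exal.mk ξ, ?_⟩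
      obtain ⟨φ⟩ := FilteredExtension.isScalarMultiple_iff.1
        (FilteredExtension.Equivalent.refl ξ.1)
      obtain ⟨β, hβ⟩ := FilteredExtension.exists_d₁_eq_of_combinationHom ξ.2 ξ.2 φ P₂ P₂ P₁
      rw [one_smul, zero_smul, add_zero] at hβ
      rw [hF, ← sub_eq_zero]
      exact (map_sub π _ _).symm.trans ((hπ0 _).2 ⟨β, hβ⟩)
  -- The vector space structure is transported along the bijection `F`.
  let e : Exal Λ A ≃ hypercohomology (brutalTruncation (hochschildComplex Λ A)) 2 :=
    Equiv.ofBijective F F_bij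
  let : AddCommGroup (Exal Λ A) := e.addCommGroup
  let : Module ℂ (Exal Λ A) := e.module ℂ
  let L : Exal Λ A ≃ₗ[ℂ] hypercohomology (brutalTruncation (hochschildComplex Λ A)) 2 :=
    e.linearEquiv ℂ
  have hL : ∀ ξ, L (Exal.mk ξ) = cls ξ := fun _ => rfl
  refine ⟨inferInstance, inferInstance, fun ξ η ζ => ?_, fun c ξ ζ => ?_, fun ξ => ?_, ⟨L⟩⟩
  · rw [← L.injective.eq_iff, map_add, hL, hL, hL, FilteredExtension.isBaerSum_iff, hom_iff,
      one_smul, one_smul]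
  · rw [← L.injective.eq_iff, map_smul, hL, hL, multiple_iff]
  · rw [← L.map_eq_zero_iff, hL, FilteredExtension.isSplit_iff ξ.2, multiple_iff, zero_smul]
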